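/- Let $\Phi(t)=e^{t^2}-1$, with complementary function $\widetilde\Phi(s)=\max_{t\ge 0}\{st-\Phi(t)\}$ for $s\ge0$. For an open set $\Omega\subset\mathbb R^2$ and $A\in\{\Phi,\widetilde\Phi\}$ let $L^{A}(\Omega)$ be the Orlicz space of all $u\in L^1_{loc}(\Omega)$ with $\int_\Omega A(|u|/\lambda)\,dx<\infty$ for some $\lambda>0$, equip $L^\Phi(\Omega)$ with the Luxemburg norm $\|u\|_\Phi=\inf\{\lambda>0:\int_\Omega \Phi(|u|/\lambda)\,dx\le 1\}$, and let $E_\Phi(\Omega)$ be the closure in $L^\Phi(\Omega)$ of $L^\infty(\Omega)$ if $|\Omega|<\infty$, and of $C_c^\infty(\Omega)$ if $|\Omega|=\infty$. For a locally Lipschitz function $g$ on a real normed space $E$ put $g^\circ(x;v)=\limsup_{y\to x,\,s\downarrow0}\frac{g(y+sv)-g(y)}{s}$ and $\partial g(x)=\{\xi\in E^*:\langle\xi,v\rangle\le g^\circ(x;v)\ \forall v\in E\}$ (Clarke's generalized gradient; for $E=\mathbb R$ it is regarded as a set of numbers). Let $f:\mathbb R^2\times\mathbb R\to\mathbb R$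 be such that $f(x,\cdot)$ is locally integrable for each $x$, and put $F(x,t)=\int_0^t f(x,s)\,ds$. Assume that $F(\cdot,t)$ is Lebesgue measurable for each $t$ and that $F(x,\cdot)$ is locally Lipschitz for each $x$. Write $\partial_tF(x,t)$ for the generalized gradient of $F(x,\cdot)$ at $t$, and put $$\underline f(x,t)=\lim_{r\downarrow0}\operatorname{ess\,inf}\{f(x,s):|s-t|<r\},\qquad \overline f(x,t)=\lim_{r\downarrow0}\operatorname{ess\,sup}\{f(x,s):|s-t|<r\}.$$ Assume that one of the following holds: (a) $\Omega\subset\mathbb R^2$ is a bounded domain with smooth boundary, and there are $\alpha_0,c_1,c_2>0$ with $|\xi|\le c_1|t|+c_2e^{\alpha_0t^2}$ for all $x\in\mathbb R^2$, $t\in\mathbb R$ and $\xi\in\partial_tF(x,t)$; (b) $\Omega=\mathbb R^2$, and there are $\alpha_0,c_1,c_2>0$ with $|\xi|\le c_1|t|+c_2(e^{\alpha_0t^2}-1)$ for all $x\in\mathbb R^2$, $t\in\mathbb R$ and $\xi\in\partial_tF(x,t)$. Assume also that $\underline f$ and $\overline f$ are N-measurable, i.e. that $x\mapsto\underline f(x,u(x))$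 and $x\mapsto\overline f(x,u(x))$ are measurable on $\Omega$ for every measurable $u:\Omega\to\mathbb R$. Then the following hold. 1. $\Psi(u)=\int_\Omega F(x,u(x))\,dx$ is well defined ($F(\cdot,u)\in L^1(\Omega)$) for every $u\in E_\Phi(\Omega)$, and $\Psi$ is locally Lipschitz on $E_\Phi(\Omega)$. 2. $\partial_tF(x,t)=[\underline f(x,t),\overline f(x,t)]$ for all $x\in\mathbb R^2$, $t\in\mathbb R$. For every $u\in E_\Phi(\Omega)$ and every $\xi\in\partial\Psi(u)\subset E_\Phi(\Omega)^*$ there is $\tilde\xi\in L^{\widetilde\Phi}(\Omega)$ such that $\langle\xi,v\rangle=\int_\Omega\tilde\xi v\,dx$ for all $v\in E_\Phi(\Omega)$ (with $\tilde\xi v\in L^1(\Omega)$) and $\tilde\xi(x)\in\partial_tF(x,u(x))=[\underline f(x,u(x)),\overline f(x,u(x))]$ for a.e. $x\in\Omega$. 3. Let $X=H^1(\Omega)$ or $X=H^1_0(\Omega)$ with the norm of $H^1(\Omega)$. Then $X\subset E_\Phi(\Omega)$ with continuous embedding, and $\partial(\Psi|_X)(u)\subset\partial\Psi(u)$ for every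 $u\in X$; that is, every $\zeta\in\partial(\Psi|_X)(u)\subset X^*$ is the restriction to $X$ of some $\xi\in\partial\Psi(u)$. -/

import Mathlib

open MeasureTheory Filter Topology Set
open scoped ENNReal ContDiff

noncomputable section

namespace OrliczClarke

/-- The Euclidean plane. -/
abbrev Plane : Type := EuclideanSpace ℝ (Fin 2)

/-! ### N-functions and Orlicz spaces -/

/-- N-functions: continuous, convex, even, vanishing only at `0`, with `A t / t → 0` at `0`
and `A t / t → ∞` at infinity. -/
structure NFunction where
  toFun : ℝ → ℝ
  continuous' : Continuous toFun
  nonneg' : ∀ t, 0 ≤ toFun t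
  convex' : ConvexOn ℝ univ toFun
  eq_zero_iff' : ∀ t, toFun t = 0 ↔ t = 0
  even' : ∀ t, toFun (-t) = toFun t
  lim_zero' : Tendsto (fun t => toFun t / t) (𝓝[≠] 0) (𝓝 0)
  lim_top' : Tendsto (fun t => toFun t / t) atTop atTop

namespace NFunction

variable (A : NFunction)

theorem map_zero : A.toFun 0 = 0 := (A.eq_zero_iff' 0).2 rfl

theorem map_smul_le {s t : ℝ} (hs : 0 ≤ s) (hs1 : s ≤ 1) :
    A.toFun (s * t) ≤ s * A.toFun t := by
  have h := A.convex'.2 (mem_univ t) (mem_univ 0) hs (sub_nonneg.2 hs1) (by ring)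
  simpa [A.map_zero] using h

theorem mono {s t : ℝ} (hs : 0 ≤ s) (hst : s ≤ t) : A.toFun s ≤ A.toFun t := by
  rcases hs.eq_or_lt with rfl | hs'
  · rw [A.map_zero]; exact A.nonneg' t
  have ht : 0 < t := hs'.trans_le hst
  have h1 : s / t ≤ 1 := (div_le_one ht).2 hst
  have h0 : 0 ≤ s / t := by positivity
  have h := A.map_smul_le (t := t) h0 h1
  rw [div_mul_cancel₀ _ ht.ne'] at h
  exact h.trans (mul_le_of_le_one_left (A.nonneg' t) h1)

end NFunction

/-- The modular `∫_Ω A(|u| / r) dx` (an extended nonnegative number). -/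
def modular (A : ℝ → ℝ) (Ω : Set Plane) (r : ℝ) (u : Plane → ℝ) : ℝ≥0∞ :=
  ∫⁻ x in Ω, ENNReal.ofReal (A (|u x| / r))

/-- Membership in the Orlicz space `L^A(Ω)`. -/
def MemOrlicz (A : ℝ → ℝ) (Ω : Set Plane) (u : Plane → ℝ) : Prop :=
  LocallyIntegrableOn u Ω volume ∧ ∃ r : ℝ, 0 < r ∧ modular A Ω r u < ⊤

/-- The complementary function, i.e. the Legendre transform `s ↦ max_{t ≥ 0} (s t - A t)`. -/
def conjugate (A : ℝ → ℝ) (s : ℝ) : ℝ := sSup ((fun t => s * t - A t) '' Ici 0)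

theorem modular_congr {A : ℝ → ℝ} {Ω : Set Plane} {r : ℝ} {u v : Plane → ℝ}
    (h : u =ᵐ[volume.restrict Ω] v) : modular A Ω r u = modular A Ω r v := by
  refine lintegral_congr_ae ?_
  filter_upwards [h] with x hx
  rw [hx]

theorem memOrlicz_congr {A : ℝ → ℝ} {Ω : Set Plane} {u v : Plane → ℝ}
    (h : u =ᵐ[volume.restrict Ω] v) (hu : MemOrlicz A Ω u) : MemOrlicz A Ω v := by
  refine ⟨fun x hx => ?_, ?_⟩
  · obtain ⟨s, hs, hus⟩ := hu.1 x hx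
    refine ⟨s ∩ Ω, inter_mem hs self_mem_nhdsWithin, ?_⟩
    have h1 : IntegrableOn u (s ∩ Ω) volume := hus.mono_set inter_subset_left
    exact h1.congr_fun_ae (ae_restrict_of_ae_restrict_of_subset inter_subset_right h)
  · obtain ⟨r, hr, hm⟩ := hu.2
    exact ⟨r, hr, by rwa [← modular_congr h]⟩

section Modular

variable {A : NFunction} {Ω : Set Plane}

theorem modular_anti {r s : ℝ} (hr : 0 < r) (hrs : r ≤ s) (u : Plane → ℝ) :
    modular A.toFun Ω s u ≤ modular A.toFun Ω r u := by
  have hs : 0 < s := hr.trans_le hrs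
  refine lintegral_mono fun x => ENNReal.ofReal_le_ofReal (A.mono (by positivity) ?_)
  exact div_le_div_of_nonneg_left (abs_nonneg _) hr hrs

theorem modular_scale {r k : ℝ} (hk : 1 ≤ k) (u : Plane → ℝ) :
    modular A.toFun Ω (r * k) u ≤ ENNReal.ofReal k⁻¹ * modular A.toFun Ω r u := by
  have hk0 : 0 < k := one_pos.trans_le hk
  unfold modular
  rw [← lintegral_const_mul' _ _ ENNReal.ofReal_ne_top]
  refine lintegral_mono fun x => ?_
  rw [← ENNReal.ofReal_mul (by positivity : (0 : ℝ) ≤ k⁻¹)]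
  refine ENNReal.ofReal_le_ofReal ?_
  have : |u x| / (r * k) = k⁻¹ * (|u x| / r) := by field_simp
  rw [this]
  exact A.map_smul_le (by positivity) (inv_le_one_of_one_le₀ hk)

theorem exists_modular_le_one {u : Plane → ℝ} (h : ∃ r : ℝ, 0 < r ∧ modular A.toFun Ω r u < ⊤) :
    ∃ r : ℝ, 0 < r ∧ modular A.toFun Ω r u ≤ 1 := by
  obtain ⟨r, hr, hm⟩ := h
  set M := (modular A.toFun Ω r u).toReal
  have hk : 1 ≤ max 1 M := le_max_left _ _
  refine ⟨r * max 1 M, by positivity, (modular_scale hk u).trans ?_⟩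
  rw [← ENNReal.ofReal_toReal hm.ne, ← ENNReal.ofReal_mul (by positivity)]
  refine ENNReal.ofReal_le_one.2 ?_
  rw [inv_mul_le_one₀ (by positivity)]
  exact le_max_right _ _

theorem modular_add {a b : ℝ} (ha : 0 < a) (hb : 0 < b) {u v : Plane → ℝ}
    (hu : AEMeasurable u (volume.restrict Ω)) :
    modular A.toFun Ω (a + b) (fun x => u x + v x) ≤
      ENNReal.ofReal (a / (a + b)) * modular A.toFun Ω a u +
        ENNReal.ofReal (b / (a + b)) * modular A.toFun Ω b v := by
  unfold modular
  rw [← lintegral_const_mul' _ _ ENNReal.ofReal_ne_top,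
    ← lintegral_const_mul' _ _ ENNReal.ofReal_ne_top]
  have hmeas : AEMeasurable (fun x => ENNReal.ofReal (a / (a + b)) *
      ENNReal.ofReal (A.toFun (|u x| / a))) (volume.restrict Ω) := by
    refine AEMeasurable.const_mul (ENNReal.measurable_ofReal.comp_aemeasurable ?_) _
    exact A.continuous'.measurable.comp_aemeasurable
      ((continuous_abs.measurable.comp_aemeasurable hu).div_const a)
  rw [← lintegral_add_left' hmeas]
  refine lintegral_mono fun x => ?_
  have hA := A.nonneg'
  have p1 := hA (|u x| / a)
  have p2 := hA (|v x| / b)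
  dsimp only
  rw [← ENNReal.ofReal_mul (by positivity), ← ENNReal.ofReal_mul (by positivity),
    ← ENNReal.ofReal_add (by positivity) (by positivity)]
  refine ENNReal.ofReal_le_ofReal ?_
  have hc := A.convex'.2 (mem_univ (|u x| / a)) (mem_univ (|v x| / b))
    (show 0 ≤ a / (a + b) by positivity) (show 0 ≤ b / (a + b) by positivity) (by field_simp)
  simp only [smul_eq_mul] at hc
  refine le_trans (A.mono (by positivity) ?_) hc
  have e : a / (a + b) * (|u x| / a) + b / (a + b) * (|v x| / b) = (|u x| + |v x|) / (a + b) := by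
    field_simp
  rw [e]
  exact div_le_div_of_nonneg_right (abs_add_le _ _) (by positivity)

theorem modular_smul {c : ℝ} (hc : c ≠ 0) (r : ℝ) (u : Plane → ℝ) :
    modular A.toFun Ω (|c| * r) (fun x => c * u x) = modular A.toFun Ω r u := by
  have hc' : |c| ≠ 0 := abs_ne_zero.2 hc
  unfold modular
  congr 1
  funext x
  rw [abs_mul, mul_div_mul_left _ _ hc']

end Modular

/-- The Orlicz space `L^A(Ω)` as a space of classes of functions modulo a.e. equality on `Ω`. -/
def orliczSubmodule (A : NFunction) (Ω : Set Plane) :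
    Submodule ℝ (Plane →ₘ[volume.restrict Ω] ℝ) where
  carrier := {u | MemOrlicz A.toFun Ω u}
  zero_mem' := by
    refine memOrlicz_congr (u := fun _ => 0) AEEqFun.coeFn_zero.symm ⟨?_, 1, one_pos, ?_⟩
    · exact (locallyIntegrable_zero).locallyIntegrableOn Ω
    · simp [modular, A.map_zero]
  add_mem' := by
    intro u v hu hv
    refine memOrlicz_congr (u := fun x => u x + v x) (AEEqFun.coeFn_add u v).symm
      ⟨hu.1.add hv.1, ?_⟩
    obtain ⟨a, ha, hua⟩ := hu.2
    obtain ⟨b, hb, hvb⟩ := hv.2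
    refine ⟨a + b, by positivity, (modular_add ha hb u.aemeasurable).trans_lt ?_⟩
    exact ENNReal.add_lt_top.2 ⟨ENNReal.mul_lt_top ENNReal.ofReal_lt_top hua,
      ENNReal.mul_lt_top ENNReal.ofReal_lt_top hvb⟩
  smul_mem' := by
    intro c u hu
    rcases eq_or_ne c 0 with rfl | hc
    · rw [zero_smul]
      refine memOrlicz_congr (u := fun _ => 0) AEEqFun.coeFn_zero.symm ⟨?_, 1, one_pos, ?_⟩
      · exact (locallyIntegrable_zero).locallyIntegrableOn Ω
      · simp [modular, A.map_zero]
    refine memOrlicz_congr (u := fun x => c * u x) (AEEqFun.coeFn_smul c u).symm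
      ⟨hu.1.smul c, ?_⟩
    obtain ⟨a, ha, hua⟩ := hu.2
    exact ⟨|c| * a, by positivity, by rwa [modular_smul hc]⟩

/-- `L^A(Ω)`, to be equipped with the Luxemburg norm. -/
def OrliczSpace (A : NFunction) (Ω : Set Plane) : Type := ↥(orliczSubmodule A Ω)

namespace OrliczSpace

variable {A : NFunction} {Ω : Set Plane}

instance : AddCommGroup (OrliczSpace A Ω) := inferInstanceAs (AddCommGroup ↥(orliczSubmodule A Ω))

instance : Module ℝ (OrliczSpace A Ω) := inferInstanceAs (Module ℝ ↥(orliczSubmodule A Ω))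

/-- A representative of an element of `L^A(Ω)`; its values matter only a.e. on `Ω`. -/
def rep (u : OrliczSpace A Ω) : Plane → ℝ := (u.1 : Plane →ₘ[volume.restrict Ω] ℝ)

theorem rep_aemeasurable (u : OrliczSpace A Ω) : AEMeasurable u.rep (volume.restrict Ω) :=
  u.1.aemeasurable

theorem rep_mem (u : OrliczSpace A Ω) : MemOrlicz A.toFun Ω u.rep := u.2

theorem rep_add (u v : OrliczSpace A Ω) :
    (u + v).rep =ᵐ[volume.restrict Ω] fun x => u.rep x + v.rep x := AEEqFun.coeFn_add u.1 v.1

theorem rep_smul (c : ℝ) (u : OrliczSpace A Ω) :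
    (c • u).rep =ᵐ[volume.restrict Ω] fun x => c * u.rep x := AEEqFun.coeFn_smul c u.1

theorem rep_zero : (0 : OrliczSpace A Ω).rep =ᵐ[volume.restrict Ω] fun _ => 0 :=
  AEEqFun.coeFn_zero

theorem ext_rep {u v : OrliczSpace A Ω} (h : u.rep =ᵐ[volume.restrict Ω] v.rep) : u = v :=
  Subtype.ext (AEEqFun.ext h)

/-- The admissible constants in the definition of the Luxemburg norm. -/
def lux (u : OrliczSpace A Ω) : Set ℝ := {r | 0 < r ∧ modular A.toFun Ω r u.rep ≤ 1}

theorem lux_nonempty (u : OrliczSpace A Ω) : u.lux.Nonempty := exists_modular_le_one u.rep_mem.2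

theorem lux_bddBelow (u : OrliczSpace A Ω) : BddBelow u.lux := ⟨0, fun _ hr => hr.1.le⟩

theorem lux_up {u : OrliczSpace A Ω} {r s : ℝ} (hr : r ∈ u.lux) (hrs : r ≤ s) : s ∈ u.lux :=
  ⟨hr.1.trans_le hrs, (modular_anti hr.1 hrs _).trans hr.2⟩

/-- The Luxemburg norm. -/
instance : Norm (OrliczSpace A Ω) where
  norm u := sInf {r : ℝ | 0 < r ∧ modular A.toFun Ω r u.rep ≤ 1}

theorem norm_def (u : OrliczSpace A Ω) : ‖u‖ = sInf u.lux := rfl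

theorem mem_lux_of_norm_lt {u : OrliczSpace A Ω} {r : ℝ} (h : ‖u‖ < r) : r ∈ u.lux := by
  obtain ⟨s, hs, hsr⟩ := exists_lt_of_csInf_lt u.lux_nonempty h
  exact lux_up hs hsr.le

theorem norm_le_of_mem {u : OrliczSpace A Ω} {r : ℝ} (h : r ∈ u.lux) : ‖u‖ ≤ r :=
  csInf_le u.lux_bddBelow h

theorem norm_nonneg' (u : OrliczSpace A Ω) : 0 ≤ ‖u‖ :=
  le_csInf u.lux_nonempty fun _ hr => hr.1.le

theorem norm_zero' : ‖(0 : OrliczSpace A Ω)‖ = 0 := by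
  refine le_antisymm (le_of_forall_pos_le_add fun ε hε => ?_) (norm_nonneg' _)
  rw [zero_add]
  refine norm_le_of_mem ⟨hε, ?_⟩
  rw [modular_congr rep_zero]
  simp [modular, A.map_zero]

theorem norm_smul_le' (c : ℝ) (u : OrliczSpace A Ω) : ‖c • u‖ ≤ |c| * ‖u‖ := by
  rcases eq_or_ne c 0 with rfl | hc
  · rw [zero_smul, norm_zero', abs_zero, zero_mul]
  have hc' : 0 < |c| := abs_pos.2 hc
  rw [← div_le_iff₀' hc']
  refine le_csInf u.lux_nonempty fun r hr => ?_
  rw [div_le_iff₀' hc']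
  refine norm_le_of_mem ⟨mul_pos hc' hr.1, ?_⟩
  rw [modular_congr (rep_smul c u), modular_smul hc]
  exact hr.2

theorem normCore : NormedSpace.Core ℝ (OrliczSpace A Ω) where
  norm_nonneg := norm_nonneg'
  norm_smul c u := by
    rw [Real.norm_eq_abs]
    refine le_antisymm (norm_smul_le' c u) ?_
    rcases eq_or_ne c 0 with rfl | hc
    · rw [abs_zero, zero_mul]; exact norm_nonneg' _
    have hc' : 0 < |c| := abs_pos.2 hc
    have h := norm_smul_le' c⁻¹ (c • u)
    rw [smul_smul, inv_mul_cancel₀ hc, one_smul, abs_inv] at h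
    rwa [← div_eq_inv_mul, le_div_iff₀' hc'] at h
  norm_triangle u v := by
    refine le_of_forall_pos_le_add fun ε hε => ?_
    have hu := mem_lux_of_norm_lt (u := u) (r := ‖u‖ + ε / 2) (by linarith)
    have hv := mem_lux_of_norm_lt (u := v) (r := ‖v‖ + ε / 2) (by linarith)
    set a := ‖u‖ + ε / 2
    set b := ‖v‖ + ε / 2
    have ha := hu.1
    have hb := hv.1
    have hm : a + b ∈ (u + v).lux := by
      refine ⟨by positivity, ?_⟩
      rw [modular_congr (rep_add u v)]
      refine (modular_add ha hb u.rep_aemeasurable).trans ?_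
      refine (add_le_add (mul_le_mul_right hu.2 _) (mul_le_mul_right hv.2 _)).trans ?_
      rw [mul_one, mul_one, ← ENNReal.ofReal_add (by positivity) (by positivity), ← add_div,
        div_self (by positivity), ENNReal.ofReal_one]
    have := norm_le_of_mem hm
    simp only [a, b] at this
    linarith
  norm_eq_zero_iff u := by
    refine ⟨fun h => ?_, fun h => by rw [h]; exact norm_zero'⟩
    have key : modular A.toFun Ω 1 u.rep = 0 := by
      refine le_antisymm ?_ zero_le
      refine le_of_forall_gt fun δ hδ => ?_
      obtain ⟨k, hk⟩ : ∃ k : ℕ, ENNReal.ofReal ((k : ℝ) + 1)⁻¹ < δ := by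
        have ht : Tendsto (fun k : ℕ => ENNReal.ofReal ((k : ℝ) + 1)⁻¹) atTop (𝓝 0) := by
          have := ENNReal.tendsto_ofReal tendsto_one_div_add_atTop_nhds_zero_nat
          simpa using this
        exact (ht.eventually (gt_mem_nhds hδ)).exists
      refine lt_of_le_of_lt ?_ hk
      have hpos : (0 : ℝ) < ((k : ℝ) + 1)⁻¹ := by positivity
      have hm := (mem_lux_of_norm_lt (u := u) (h.trans_lt hpos)).2
      have hs := modular_scale (A := A) (Ω := Ω) (r := ((k : ℝ) + 1)⁻¹) (k := (k : ℝ) + 1)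
        (by linarith [(Nat.cast_nonneg k : (0 : ℝ) ≤ k)]) u.rep
      rw [inv_mul_cancel₀ (by positivity)] at hs
      exact hs.trans ((mul_le_mul_right hm _).trans_eq (mul_one _))
    have hmeas : AEMeasurable (fun x => ENNReal.ofReal (A.toFun (|u.rep x| / 1)))
        (volume.restrict Ω) :=
      ENNReal.measurable_ofReal.comp_aemeasurable (A.continuous'.measurable.comp_aemeasurable
        ((continuous_abs.measurable.comp_aemeasurable u.rep_aemeasurable).div_const 1))
    refine ext_rep ?_
    filter_upwards [(lintegral_eq_zero_iff' hmeas).1 key, rep_zero (A := A) (Ω := Ω)]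
      with x hx h0
    rw [h0]
    have h1 : A.toFun (|u.rep x| / 1) = 0 :=
      le_antisymm (ENNReal.ofReal_eq_zero.1 hx) (A.nonneg' _)
    simpa using (A.eq_zero_iff' _).1 h1

instance : NormedAddCommGroup (OrliczSpace A Ω) := NormedAddCommGroup.ofCore normCore

instance : NormedSpace ℝ (OrliczSpace A Ω) := NormedSpace.ofCore normCore

end OrliczSpace

/-- `φ ∈ C_c^∞(Ω)`, as a function on the whole plane. -/
def IsTestFunction (Ω : Set Plane) (φ : Plane → ℝ) : Prop :=
  ContDiff ℝ ∞ φ ∧ HasCompactSupport φ ∧ tsupport φ ⊆ Ω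

theorem IsTestFunction.zero (Ω : Set Plane) : IsTestFunction Ω 0 := by
  refine ⟨contDiff_const, HasCompactSupport.zero, ?_⟩
  simp [tsupport]

theorem IsTestFunction.add {Ω : Set Plane} {φ ψ : Plane → ℝ} (hφ : IsTestFunction Ω φ)
    (hψ : IsTestFunction Ω ψ) : IsTestFunction Ω (φ + ψ) :=
  ⟨hφ.1.add hψ.1, hφ.2.1.add hψ.2.1, (tsupport_add φ ψ).trans (union_subset hφ.2.2 hψ.2.2)⟩

theorem IsTestFunction.smul {Ω : Set Plane} {φ : Plane → ℝ} (c : ℝ) (hφ : IsTestFunction Ω φ) :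
    IsTestFunction Ω (c • φ) :=
  ⟨contDiff_const.smul hφ.1, hφ.2.1.smul_left (f := fun _ => c),
    (tsupport_smul_subset_right (fun _ => c) φ).trans hφ.2.2⟩

/-- The (classes of) essentially bounded functions in `L^A(Ω)`. -/
def boundedSubmodule (A : NFunction) (Ω : Set Plane) : Submodule ℝ (OrliczSpace A Ω) where
  carrier := {u | ∃ C : ℝ, ∀ᵐ x ∂(volume.restrict Ω), |u.rep x| ≤ C}
  zero_mem' := ⟨0, by filter_upwards [OrliczSpace.rep_zero (A := A) (Ω := Ω)] with x hx; simp [hx]⟩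
  add_mem' := by
    rintro u v ⟨C, hC⟩ ⟨D, hD⟩
    refine ⟨C + D, ?_⟩
    filter_upwards [hC, hD, OrliczSpace.rep_add u v] with x h1 h2 h3
    rw [h3]
    exact (abs_add_le _ _).trans (add_le_add h1 h2)
  smul_mem' := by
    rintro c u ⟨C, hC⟩
    refine ⟨|c| * C, ?_⟩
    filter_upwards [hC, OrliczSpace.rep_smul c u] with x h1 h3
    rw [h3, abs_mul]
    exact mul_le_mul_of_nonneg_left h1 (abs_nonneg c)

/-- The (classes of) test functions in `L^A(Ω)`. -/
def testSubmodule (A : NFunction) (Ω : Set Plane) : Submodule ℝ (OrliczSpace A Ω) where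
  carrier := {u | ∃ φ : Plane → ℝ, IsTestFunction Ω φ ∧ u.rep =ᵐ[volume.restrict Ω] φ}
  zero_mem' := ⟨0, IsTestFunction.zero Ω, OrliczSpace.rep_zero⟩
  add_mem' := by
    rintro u v ⟨φ, hφ, hu⟩ ⟨ψ, hψ, hv⟩
    refine ⟨φ + ψ, hφ.add hψ, (OrliczSpace.rep_add u v).trans ?_⟩
    filter_upwards [hu, hv] with x h1 h2
    simp [h1, h2]
  smul_mem' := by
    rintro c u ⟨φ, hφ, hu⟩
    refine ⟨c • φ, hφ.smul c, (OrliczSpace.rep_smul c u).trans ?_⟩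
    filter_upwards [hu] with x h1
    simp [h1]

open Classical in
/-- The subspace `E_A(Ω)` of `L^A(Ω)`, with the Luxemburg norm: the closure of `L^∞(Ω)` if `Ω`
has finite measure, and the closure of `C_c^∞(Ω)` otherwise. -/
def orliczE (A : NFunction) (Ω : Set Plane) : Submodule ℝ (OrliczSpace A Ω) :=
  if volume Ω < ⊤ then (boundedSubmodule A Ω).topologicalClosure
  else (testSubmodule A Ω).topologicalClosure

/-! ### The N-function `exp (t²) - 1` -/

theorem convexOn_expSq : ConvexOn ℝ univ (fun t : ℝ => Real.exp (t ^ 2) - 1) := by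
  have h1 : ConvexOn ℝ univ (fun t : ℝ => Real.exp (t ^ 2)) := by
    refine ⟨convex_univ, fun x _ y _ a b ha hb hab => ?_⟩
    have h2 : (a • x + b • y) ^ 2 ≤ a • x ^ 2 + b • y ^ 2 :=
      (even_two.convexOn_pow (𝕜 := ℝ)).2 (mem_univ x) (mem_univ y) ha hb hab
    exact (Real.exp_le_exp.2 h2).trans
      (convexOn_exp.2 (mem_univ (x ^ 2)) (mem_univ (y ^ 2)) ha hb hab)
  exact (h1.add_const (-1)).congr fun t _ => (sub_eq_add_neg _ _).symm

/-- The N-function `Φ(t) = exp (t²) - 1`. -/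
def Phi : NFunction where
  toFun t := Real.exp (t ^ 2) - 1
  continuous' := by fun_prop
  nonneg' t := by
    have := Real.one_le_exp (sq_nonneg t)
    linarith
  convex' := convexOn_expSq
  eq_zero_iff' t := by
    rw [sub_eq_zero, Real.exp_eq_one_iff]
    simp
  even' t := by simp
  lim_zero' := by
    have h : HasDerivAt (fun t : ℝ => Real.exp (t ^ 2) - 1) 0 0 := by
      have := ((hasDerivAt_pow 2 (0 : ℝ)).exp).sub_const 1
      simpa using this
    have h2 := hasDerivAt_iff_tendsto_slope.1 h
    refine h2.congr fun t => ?_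
    simp [slope_def_field]
  lim_top' := by
    refine tendsto_atTop_mono' atTop ?_ tendsto_id
    filter_upwards [eventually_gt_atTop 0] with t ht
    rw [id, le_div_iff₀ ht]
    have := Real.add_one_le_exp (t ^ 2)
    nlinarith

/-- The space `E_Φ(Ω)` for `Φ(t) = exp (t²) - 1`. -/
abbrev EPhi (Ω : Set Plane) : Submodule ℝ (OrliczSpace Phi Ω) := orliczE Phi Ω

/-! ### Sobolev spaces -/

/-- Pairs (function, vector field) in `L²(Ω) × L²(Ω; ℝ²)` with the Hilbert norm
`(‖u‖² + ‖G‖²)^(1/2)`. -/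
abbrev SobolevPair (Ω : Set Plane) : Type :=
  WithLp 2 (Lp ℝ 2 ((volume : Measure Plane).restrict Ω) ×
    Lp Plane 2 ((volume : Measure Plane).restrict Ω))

theorem integrable_smul_gradient {Ω : Set Plane} (u : Lp ℝ 2 (volume.restrict Ω))
    {φ : Plane → ℝ} (hφ : IsTestFunction Ω φ) :
    Integrable (fun x => u x • gradient φ x) (volume.restrict Ω) := by
  have hc : Continuous (gradient φ) := by
    unfold gradient
    exact (LinearIsometryEquiv.continuous _).comp (hφ.1.continuous_fderiv (by simp))
  have hs : HasCompactSupport (gradient φ) := by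
    refine (hφ.2.1.fderiv (𝕜 := ℝ)).comp_left
      (g := (InnerProductSpace.toDual ℝ Plane).symm) (map_zero _)
  have h2 : MemLp (gradient φ) 2 (volume.restrict Ω) := hc.memLp_of_hasCompactSupport hs
  exact memLp_one_iff_integrable.1 (h2.smul (Lp.memLp u))

theorem integrable_smul_field {Ω : Set Plane} (G : Lp Plane 2 (volume.restrict Ω))
    {φ : Plane → ℝ} (hφ : IsTestFunction Ω φ) :
    Integrable (fun x => φ x • G x) (volume.restrict Ω) := by
  have h2 : MemLp φ 2 (volume.restrict Ω) :=
    hφ.1.continuous.memLp_of_hasCompactSupport hφ.2.1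
  exact memLp_one_iff_integrable.1 ((Lp.memLp G).smul h2)

/-- The Sobolev space `H¹(Ω)`: an element is a function `u ∈ L²(Ω)` together with its weak
gradient `G ∈ L²(Ω; ℝ²)` (which `u` determines when `Ω` is open); the norm is the usual one. -/
def sobolevH1 (Ω : Set Plane) : Submodule ℝ (SobolevPair Ω) where
  carrier := {w | ∀ φ : Plane → ℝ, IsTestFunction Ω φ →
    ∫ x in Ω, w.fst x • gradient φ x = -∫ x in Ω, φ x • w.snd x}
  zero_mem' := by
    intro φ _
    have h1 : (fun x => (0 : SobolevPair Ω).fst x • gradient φ x) =ᵐ[volume.restrict Ω]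
        fun _ => 0 := by
      filter_upwards [Lp.coeFn_zero ℝ 2 ((volume : Measure Plane).restrict Ω)] with x hx
      change (0 : Lp ℝ 2 ((volume : Measure Plane).restrict Ω)) x • gradient φ x = 0
      rw [hx]; simp
    have h2 : (fun x => φ x • (0 : SobolevPair Ω).snd x) =ᵐ[volume.restrict Ω]
        fun _ => 0 := by
      filter_upwards [Lp.coeFn_zero Plane 2 ((volume : Measure Plane).restrict Ω)] with x hx
      change φ x • (0 : Lp Plane 2 ((volume : Measure Plane).restrict Ω)) x = 0
      rw [hx]; simp
    rw [integral_congr_ae h1, integral_congr_ae h2]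
    simp
  add_mem' := by
    intro v w hv hw φ hφ
    have h1 : (fun x => (v + w).fst x • gradient φ x) =ᵐ[volume.restrict Ω]
        fun x => v.fst x • gradient φ x + w.fst x • gradient φ x := by
      filter_upwards [Lp.coeFn_add v.fst w.fst] with x hx
      change (v.fst + w.fst) x • gradient φ x = _
      rw [hx, Pi.add_apply, add_smul]
    have h2 : (fun x => φ x • (v + w).snd x) =ᵐ[volume.restrict Ω]
        fun x => φ x • v.snd x + φ x • w.snd x := by
      filter_upwards [Lp.coeFn_add v.snd w.snd] with x hx
      change φ x • (v.snd + w.snd) x = _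
      rw [hx, Pi.add_apply, smul_add]
    rw [integral_congr_ae h1, integral_congr_ae h2,
      integral_add (integrable_smul_gradient _ hφ) (integrable_smul_gradient _ hφ),
      integral_add (integrable_smul_field _ hφ) (integrable_smul_field _ hφ),
      hv φ hφ, hw φ hφ, neg_add]
  smul_mem' := by
    intro c w hw φ hφ
    have h1 : (fun x => (c • w).fst x • gradient φ x) =ᵐ[volume.restrict Ω]
        fun x => c • (w.fst x • gradient φ x) := by
      filter_upwards [Lp.coeFn_smul c w.fst] with x hx
      change (c • w.fst) x • gradient φ x = _
      rw [hx, Pi.smul_apply, smul_assoc]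
    have h2 : (fun x => φ x • (c • w).snd x) =ᵐ[volume.restrict Ω]
        fun x => c • (φ x • w.snd x) := by
      filter_upwards [Lp.coeFn_smul c w.snd] with x hx
      change φ x • (c • w.snd) x = _
      rw [hx, Pi.smul_apply, smul_comm]
    rw [integral_congr_ae h1, integral_congr_ae h2, integral_smul, integral_smul, hw φ hφ,
      smul_neg]

/-- The pairs `(φ, ∇φ)` with `φ ∈ C_c^∞(Ω)`. -/
def testPairs (Ω : Set Plane) : Set (SobolevPair Ω) :=
  {w | ∃ φ : Plane → ℝ, IsTestFunction Ω φ ∧ w.fst =ᵐ[volume.restrict Ω] φ ∧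
    w.snd =ᵐ[volume.restrict Ω] gradient φ}

/-- The Sobolev space `H¹₀(Ω)`: the closure of `C_c^∞(Ω)` in the norm of `H¹(Ω)`. -/
def sobolevH10 (Ω : Set Plane) : Submodule ℝ (SobolevPair Ω) :=
  (Submodule.span ℝ (testPairs Ω)).topologicalClosure

/-! ### Domains -/

/-- A bounded domain with smooth boundary: near each boundary point, `Ω` is, in suitable
orthonormal coordinates, the region strictly above the graph of a smooth function. -/
def IsSmoothBoundedDomain (Ω : Set Plane) : Prop :=
  IsOpen Ω ∧ IsConnected Ω ∧ Bornology.IsBounded Ω ∧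
    ∀ p ∈ frontier Ω, ∃ (r : ℝ) (L : Plane ≃ₗᵢ[ℝ] Plane) (γ : ℝ → ℝ), 0 < r ∧
      ContDiff ℝ ∞ γ ∧
        Ω ∩ Metric.ball p r = {x ∈ Metric.ball p r | γ (L x 0) < L x 1}

/-! ### Clarke's generalized gradient -/

section Clarke

variable {E : Type*} [NormedAddCommGroup E] [NormedSpace ℝ E]

/-- Clarke's generalized directional derivative
`g°(x; v) = limsup_{y → x, s ↓ 0} (g (y + s v) - g y) / s`. -/
def clarkeDeriv (g : E → ℝ) (x v : E) : EReal :=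
  limsup (fun p : E × ℝ => (((g (p.1 + p.2 • v) - g p.1) / p.2 : ℝ) : EReal))
    (𝓝 x ×ˢ 𝓝[>] (0 : ℝ))

/-- Clarke's generalized gradient
`∂g(x) = {ξ ∈ E* | ⟨ξ, v⟩ ≤ g°(x; v) for all v}`. -/
def clarkeGradient (g : E → ℝ) (x : E) : Set (StrongDual ℝ E) :=
  {ξ | ∀ v : E, ((ξ v : ℝ) : EReal) ≤ clarkeDeriv g x v}

/-- For `g : ℝ → ℝ`, the generalized gradient as a set of numbers, a functional `ξ` on `ℝ` being
identified with the number `ξ 1`. -/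
def clarkeGradientReal (g : ℝ → ℝ) (t : ℝ) : Set ℝ :=
  (fun ξ : StrongDual ℝ ℝ => ξ 1) '' clarkeGradient g t

end Clarke

/-! ### The nonlinearity -/

/-- The primitive `F(x, t) = ∫₀ᵗ f(x, s) ds`. -/
def primitive (f : Plane → ℝ → ℝ) (x : Plane) (t : ℝ) : ℝ := ∫ s in (0 : ℝ)..t, f x s

/-- `f̲(x, t) = lim_{r ↓ 0} ess inf {f(x, s) : |s - t| < r}`. -/
def lowerEnvelope (f : Plane → ℝ → ℝ) (x : Plane) (t : ℝ) : ℝ :=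
  limUnder (𝓝[>] (0 : ℝ)) fun r => essInf (f x) (volume.restrict {s : ℝ | |s - t| < r})

/-- `f̄(x, t) = lim_{r ↓ 0} ess sup {f(x, s) : |s - t| < r}`. -/
def upperEnvelope (f : Plane → ℝ → ℝ) (x : Plane) (t : ℝ) : ℝ :=
  limUnder (𝓝[>] (0 : ℝ)) fun r => essSup (f x) (volume.restrict {s : ℝ | |s - t| < r})

/-- N-measurability (superpositional measurability) on `Ω`: `x ↦ g(x, u(x))` is Lebesgue
measurable for every Lebesgue measurable `u`. -/
def NMeasurable (Ω : Set Plane) (g : Plane → ℝ → ℝ) : Prop :=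
  ∀ u : Plane → ℝ, AEMeasurable u (volume.restrict Ω) →
    AEMeasurable (fun x => g x (u x)) (volume.restrict Ω)

/-- `|ξ| ≤ c₁ |t| + c₂ exp (α₀ t²)` for all `ξ ∈ ∂ₜF(x, t)`. -/
def GrowthBounded (f : Plane → ℝ → ℝ) : Prop :=
  ∃ α₀ c₁ c₂ : ℝ, 0 < α₀ ∧ 0 < c₁ ∧ 0 < c₂ ∧
    ∀ (x : Plane) (t : ℝ), ∀ ξ ∈ clarkeGradientReal (primitive f x) t,
      |ξ| ≤ c₁ * |t| + c₂ * Real.exp (α₀ * t ^ 2)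

/-- `|ξ| ≤ c₁ |t| + c₂ (exp (α₀ t²) - 1)` for all `ξ ∈ ∂ₜF(x, t)`. -/
def GrowthPlane (f : Plane → ℝ → ℝ) : Prop :=
  ∃ α₀ c₁ c₂ : ℝ, 0 < α₀ ∧ 0 < c₁ ∧ 0 < c₂ ∧
    ∀ (x : Plane) (t : ℝ), ∀ ξ ∈ clarkeGradientReal (primitive f x) t,
      |ξ| ≤ c₁ * |t| + c₂ * (Real.exp (α₀ * t ^ 2) - 1)

/-- The functional `Ψ(u) = ∫_Ω F(x, u(x)) dx` on functions. -/
def energy (Ω : Set Plane) (f : Plane → ℝ → ℝ) (u : Plane → ℝ) : ℝ :=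
  ∫ x in Ω, primitive f x (u x)

/-- `Ψ` on `E_Φ(Ω)`. -/
def Psi (Ω : Set Plane) (f : Plane → ℝ → ℝ) (u : EPhi Ω) : ℝ :=
  energy Ω f u.1.rep

/-- The restriction of `Ψ` to a subspace `X` of `H¹(Ω)`. -/
def PsiOn {Ω : Set Plane} (X : Submodule ℝ (SobolevPair Ω)) (f : Plane → ℝ → ℝ) (w : X) : ℝ :=
  energy Ω f w.1.fst

end OrliczClarke

end

noncomputable section

namespace OrliczClarke

/-! ### Envelopes and the generalized gradient of a primitive -/

section Envelope

variable {f : Plane → ℝ → ℝ} {x : Plane}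

/-! The growth condition enters only through its square. With r = (2α₀)^(-1/2) one has exp(2α₀t²) =
Φ(|t|/r) + 1, so ξ² ≤ C(Φ(|t|/r) + B) for every ξ in ∂ₜF(x,t), where B = 1 for bounded Ω and B = 0
in the plane (`exists_admissible`). Members of E_Φ have finite modular at every scale
(`mem_orliczE_iff`), so along u ∈ E_Φ this bound for ∂ₜF is square integrable. Since t² ≤ Φ(t),
moreover L^Φ ⊂ L² and L² ⊂ L^Φ̃, and L² can replace the Orlicz duality throughout.

By Cauchy-Schwarz, Ψ is Lipschitz for the L² norm on small Luxemburg balls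
(`exists_abs_Psi_sub_le`). Hence every ξ ∈ ∂Ψ(u) is bounded by a multiple of the L² norm;
Hahn-Banach extends it to L², and Riesz representation gives a density (`exists_density`).

To locate the density, one computes F°(x,·)(t;a) = max(f̄ a, f̲ a): increments of F are integrals of
f, and near t there are points of differentiability whose derivatives approach either envelope. Then
Ψ°(u;v) ≤ ∫ F°(x,·)(u;v) by dominated convergence along fast sequences (`clarkeDeriv_Psi_le`), and
testing with v = ±1_S traps the density between the envelopes.

Restriction to X is a chain rule: (Ψ∘ι)°(w;v) ≤ Ψ°(ιw;ιv), and Hahn-Banach extends functionals under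
this sublinear bound (`exists_mem_clarkeGradient_comp`).

The embedding is Trudinger's inequality. Averaging over shrinking balls inside a cone in Ω bounds
|u(x)| by ‖u‖₂ plus a truncated potential of |∇u| with kernel 1/|w|. Splitting the kernel at a
radius ε, with a pointwise bound far away and an L² bound nearby, and optimizing ε gives Gaussian
tails (`volume_annulusPotential_gt_le`) whose rate grows as the L² norm of the density shrinks.
Writing |∇u| as a bounded function plus one of small L² norm makes every modular finite, so u lies
in E_Φ and not merely in L^Φ. -/

theorem intervalIntegrable_of_locallyIntegrable {g : ℝ → ℝ} (hg : LocallyIntegrable g volume)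
    (a b : ℝ) : IntervalIntegrable g volume a b :=
  intervalIntegrable_iff.2 ((hg.integrableOn_isCompact isCompact_uIcc).mono_set uIoc_subset_uIcc)

theorem ae_hasDerivAt_primitive (hf : LocallyIntegrable (f x) volume) :
    ∀ᵐ s, HasDerivAt (primitive f x) (f x s) s := by
  filter_upwards [LocallyIntegrable.ae_hasDerivAt_integral hf] with s hs using hs 0

/-- Almost everywhere the integrand is the derivative of the primitive, hence at most its local
Lipschitz constant. This local bound is what makes the real-valued `essSup` and `essInf` meaningful.
-/
theorem exists_ae_abs_le (hf : LocallyIntegrable (f x) volume)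
    (hF : LocallyLipschitz (primitive f x)) (t : ℝ) :
    ∃ K r : ℝ, 0 < r ∧ ∀ᵐ s, |s - t| < r → |f x s| ≤ K := by
  obtain ⟨K, U, hU, hK⟩ := hF t
  obtain ⟨r, hr, hrU⟩ := Metric.mem_nhds_iff.1 hU
  refine ⟨K, r, hr, ?_⟩
  filter_upwards [ae_hasDerivAt_primitive hf] with s hs hst
  have hsU : Metric.ball t r ∈ 𝓝 s := Metric.isOpen_ball.mem_nhds (by simpa [Real.dist_eq] using hst)
  have := norm_deriv_le_of_lipschitzOn (mem_of_superset hsU hrU) hK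
  rwa [hs.deriv, Real.norm_eq_abs] at this

theorem measurableSet_abs_sub_lt (t r : ℝ) : MeasurableSet {s : ℝ | |s - t| < r} :=
  measurableSet_lt (by fun_prop) (by fun_prop)

theorem restrict_abs_sub_lt_ne_zero (t : ℝ) {r : ℝ} (hr : 0 < r) :
    (volume : Measure ℝ).restrict {s : ℝ | |s - t| < r} ≠ 0 := by
  rw [Ne, Measure.restrict_eq_zero]
  have : {s : ℝ | |s - t| < r} = Metric.ball t r := by ext s; simp [Real.dist_eq]
  rw [this]
  exact (Metric.measure_ball_pos volume t hr).ne'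

theorem exists_mem_of_ae {p : ℝ → Prop} (t : ℝ) {r : ℝ} (hr : 0 < r) (h : ∀ᵐ s, p s) :
    ∃ s, |s - t| < r ∧ p s := by
  have h0 := restrict_abs_sub_lt_ne_zero t hr
  have : NeBot (ae ((volume : Measure ℝ).restrict {s : ℝ | |s - t| < r})) := ae_neBot.2 h0
  have h1 := ae_restrict_of_ae (s := {s : ℝ | |s - t| < r}) h
  have h2 := ae_restrict_mem (μ := volume) (measurableSet_abs_sub_lt t r)
  exact (h2.and h1).exists

section

variable (hf : LocallyIntegrable (f x) volume) (hF : LocallyLipschitz (primitive f x)) (t : ℝ)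
include hf hF

theorem exists_isBounded_ae :
    ∃ K r : ℝ, 0 < r ∧ ∀ ρ ∈ Ioo 0 r,
      (∀ᵐ s ∂(volume.restrict {s : ℝ | |s - t| < ρ}), |f x s| ≤ K) ∧
      IsBoundedUnder (· ≤ ·) (ae (volume.restrict {s : ℝ | |s - t| < ρ})) (f x) ∧
      IsBoundedUnder (· ≥ ·) (ae (volume.restrict {s : ℝ | |s - t| < ρ})) (f x) := by
  obtain ⟨K, r, hr, hK⟩ := exists_ae_abs_le hf hF t
  refine ⟨K, r, hr, fun ρ hρ => ?_⟩
  have : ∀ᵐ s ∂(volume.restrict {s : ℝ | |s - t| < ρ}), |f x s| ≤ K := by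
    rw [ae_restrict_iff' (measurableSet_abs_sub_lt t ρ)]
    filter_upwards [hK] with s hs hst using hs (lt_trans hst hρ.2)
  refine ⟨this, ⟨K, ?_⟩, ⟨-K, ?_⟩⟩
  · rw [eventually_map]; exact this.mono fun s hs => (abs_le.1 hs).2
  · rw [eventually_map]; exact this.mono fun s hs => (abs_le.1 hs).1

/-- Essential suprema decrease as the interval shrinks and are bounded below by the local bound of
the integrand, so the `limUnder` is a genuine limit. -/
theorem tendsto_upperEnvelope :
    Tendsto (fun r => essSup (f x) (volume.restrict {s : ℝ | |s - t| < r})) (𝓝[>] 0)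
      (𝓝 (upperEnvelope f x t)) := by
  refine tendsto_nhds_limUnder ?_
  obtain ⟨K, r, hr, hK⟩ := exists_isBounded_ae hf hF t
  refine ⟨_, MonotoneOn.tendsto_nhdsWithin_Ioo_right (nonempty_Ioo.2 hr) (fun a ha b hb hab => ?_) ⟨-K, ?_⟩⟩
  · have : NeBot (ae ((volume : Measure ℝ).restrict {s : ℝ | |s - t| < a})) :=
      ae_neBot.2 (restrict_abs_sub_lt_ne_zero t ha.1)
    refine limsup_le_limsup_of_le (ae_mono (Measure.restrict_mono ?_ le_rfl))
      (hK a ha).2.2.isCoboundedUnder_le (hK b hb).2.1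
    exact fun s hs => lt_of_lt_of_le hs hab
  · rintro _ ⟨a, ha, rfl⟩
    have : NeBot (ae ((volume : Measure ℝ).restrict {s : ℝ | |s - t| < a})) :=
      ae_neBot.2 (restrict_abs_sub_lt_ne_zero t ha.1)
    exact le_limsup_of_frequently_le ((hK a ha).1.mono fun s hs => (abs_le.1 hs).1).frequently
      (hK a ha).2.1

theorem tendsto_lowerEnvelope :
    Tendsto (fun r => essInf (f x) (volume.restrict {s : ℝ | |s - t| < r})) (𝓝[>] 0)
      (𝓝 (lowerEnvelope f x t)) := by
  refine tendsto_nhds_limUnder ?_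
  obtain ⟨K, r, hr, hK⟩ := exists_isBounded_ae hf hF t
  refine ⟨_, AntitoneOn.tendsto_nhdsWithin_Ioo_right (nonempty_Ioo.2 hr) (fun a ha b hb hab => ?_) ⟨K, ?_⟩⟩
  · have : NeBot (ae ((volume : Measure ℝ).restrict {s : ℝ | |s - t| < a})) :=
      ae_neBot.2 (restrict_abs_sub_lt_ne_zero t ha.1)
    refine liminf_le_liminf_of_le (ae_mono (Measure.restrict_mono ?_ le_rfl))
      (hK b hb).2.2 (hK a ha).2.1.isCoboundedUnder_ge
    exact fun s hs => lt_of_lt_of_le hs hab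
  · rintro _ ⟨a, ha, rfl⟩
    have : NeBot (ae ((volume : Measure ℝ).restrict {s : ℝ | |s - t| < a})) :=
      ae_neBot.2 (restrict_abs_sub_lt_ne_zero t ha.1)
    exact liminf_le_of_frequently_le ((hK a ha).1.mono fun s hs => (abs_le.1 hs).2).frequently
      (hK a ha).2.2

/-- Near `t`, the integrand lies a.e. between the envelopes at `t`, up to `ε`. -/
theorem exists_ae_mem_Ioo_envelope {ε : ℝ} (hε : 0 < ε) :
    ∃ r > 0, ∀ᵐ s, |s - t| < r →
      f x s ∈ Ioo (lowerEnvelope f x t - ε) (upperEnvelope f x t + ε) := by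
  obtain ⟨K, r, hr, hK⟩ := exists_isBounded_ae hf hF t
  have h1 := (tendsto_upperEnvelope hf hF t).eventually
    (gt_mem_nhds (show _ < upperEnvelope f x t + ε by linarith))
  have h2 := (tendsto_lowerEnvelope hf hF t).eventually
    (lt_mem_nhds (show lowerEnvelope f x t - ε < _ by linarith))
  obtain ⟨ρ, ⟨h1, h2⟩, hρ⟩ := ((h1.and h2).and (Ioo_mem_nhdsGT hr)).exists
  refine ⟨ρ, hρ.1, ?_⟩
  have a1 := ae_lt_of_essSup_lt h1 (hK ρ hρ).2.1
  have a2 := ae_lt_of_lt_essInf h2 (hK ρ hρ).2.2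
  rw [ae_restrict_iff' (measurableSet_abs_sub_lt t ρ)] at a1 a2
  filter_upwards [a1, a2] with s h1 h2 hs using ⟨h2 hs, h1 hs⟩

theorem lowerEnvelope_le_upperEnvelope : lowerEnvelope f x t ≤ upperEnvelope f x t := by
  refine le_of_forall_pos_le_add fun ε hε => ?_
  obtain ⟨r, hr, h⟩ := exists_ae_mem_Ioo_envelope hf hF t (half_pos hε)
  obtain ⟨s, hs, h'⟩ := exists_mem_of_ae t hr h
  have := h' hs
  linarith [this.1, this.2]

/-- Near `t` there are points of differentiability of the primitive at which the derivative is
close to the upper envelope. -/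
theorem exists_hasDerivAt_near_upperEnvelope {ε r : ℝ} (hε : 0 < ε) (hr : 0 < r) :
    ∃ s, |s - t| < r ∧ HasDerivAt (primitive f x) (f x s) s ∧
      |f x s - upperEnvelope f x t| < ε := by
  obtain ⟨r₁, hr₁, h₁⟩ := exists_ae_mem_Ioo_envelope hf hF t hε
  obtain ⟨K, r₂, hr₂, hK⟩ := exists_isBounded_ae hf hF t
  -- The integrand cannot exceed the envelope by `ε` near `t`; if it also never came within `ε`, it
  -- would stay `ε` below almost everywhere, and so would the limit of the essential suprema.
  by_contra! hcon
  have hae : ∀ᵐ s, |s - t| < min r r₁ → f x s ≤ upperEnvelope f x t - ε := by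
    filter_upwards [h₁, ae_hasDerivAt_primitive hf] with s hs hd hst
    have := hcon s (hst.trans_le (min_le_left _ _)) hd
    have h2 := (hs (hst.trans_le (min_le_right _ _))).2
    rcases le_abs.1 this with h | h <;> linarith
  have hev : ∀ᶠ ρ in 𝓝[>] (0 : ℝ),
      essSup (f x) (volume.restrict {s : ℝ | |s - t| < ρ}) ≤ upperEnvelope f x t - ε := by
    filter_upwards [Ioo_mem_nhdsGT (lt_min (lt_min hr hr₁) hr₂)] with ρ hρ
    have : NeBot (ae ((volume : Measure ℝ).restrict {s : ℝ | |s - t| < ρ})) :=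
      ae_neBot.2 (restrict_abs_sub_lt_ne_zero t hρ.1)
    refine essSup_le_of_ae_le _ ?_
      (hK ρ ⟨hρ.1, hρ.2.trans_le (min_le_right _ _)⟩).2.2.isCoboundedUnder_le
    rw [EventuallyLE, ae_restrict_iff' (measurableSet_abs_sub_lt t ρ)]
    filter_upwards [hae] with s hs hst
    exact hs (lt_trans hst (hρ.2.trans_le (min_le_left _ _)))
  have := le_of_tendsto (tendsto_upperEnvelope hf hF t) hev
  linarith

theorem exists_hasDerivAt_near_lowerEnvelope {ε r : ℝ} (hε : 0 < ε) (hr : 0 < r) :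
    ∃ s, |s - t| < r ∧ HasDerivAt (primitive f x) (f x s) s ∧
      |f x s - lowerEnvelope f x t| < ε := by
  obtain ⟨r₁, hr₁, h₁⟩ := exists_ae_mem_Ioo_envelope hf hF t hε
  obtain ⟨K, r₂, hr₂, hK⟩ := exists_isBounded_ae hf hF t
  by_contra! hcon
  have hae : ∀ᵐ s, |s - t| < min r r₁ → lowerEnvelope f x t + ε ≤ f x s := by
    filter_upwards [h₁, ae_hasDerivAt_primitive hf] with s hs hd hst
    have := hcon s (hst.trans_le (min_le_left _ _)) hd
    have h2 := (hs (hst.trans_le (min_le_right _ _))).1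
    rcases le_abs.1 this with h | h <;> linarith
  have hev : ∀ᶠ ρ in 𝓝[>] (0 : ℝ),
      lowerEnvelope f x t + ε ≤ essInf (f x) (volume.restrict {s : ℝ | |s - t| < ρ}) := by
    filter_upwards [Ioo_mem_nhdsGT (lt_min (lt_min hr hr₁) hr₂)] with ρ hρ
    have : NeBot (ae ((volume : Measure ℝ).restrict {s : ℝ | |s - t| < ρ})) :=
      ae_neBot.2 (restrict_abs_sub_lt_ne_zero t hρ.1)
    refine le_essInf_of_ae_le _ ?_
      (hK ρ ⟨hρ.1, hρ.2.trans_le (min_le_right _ _)⟩).2.1.isCoboundedUnder_ge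
    rw [EventuallyLE, ae_restrict_iff' (measurableSet_abs_sub_lt t ρ)]
    filter_upwards [hae] with s hs hst
    exact hs (lt_trans hst (hρ.2.trans_le (min_le_left _ _)))
  have := ge_of_tendsto (tendsto_lowerEnvelope hf hF t) hev
  linarith

omit hF in
theorem primitive_sub (a b : ℝ) : primitive f x b - primitive f x a = ∫ s in a..b, f x s := by
  have hi := intervalIntegrable_of_locallyIntegrable hf
  exact intervalIntegral.integral_interval_sub_left (hi _ _) (hi _ _)

/-- The increment is the integral of the integrand over a short interval near `t`. For `a ≥ 0` the
upper envelope controls it; for `a ≤ 0` the orientation is reversed and the lower one does. -/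
theorem eventually_primitive_quotient_le (a : ℝ) {ε : ℝ} (hε : 0 < ε) :
    ∀ᶠ p : ℝ × ℝ in 𝓝 t ×ˢ 𝓝[>] 0,
      (primitive f x (p.1 + p.2 * a) - primitive f x p.1) / p.2 ≤
        max (upperEnvelope f x t * a) (lowerEnvelope f x t * a) + ε := by
  have ha1 : 0 < |a| + 1 := by positivity
  set δ := ε / (|a| + 1)
  have hδ : 0 < δ := by positivity
  have hδa : δ * |a| ≤ ε := by
    rw [div_mul_eq_mul_div, div_le_iff₀ ha1]; nlinarith
  obtain ⟨r, hr, h⟩ := exists_ae_mem_Ioo_envelope hf hF t hδ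
  have c1 : ∀ᶠ p : ℝ × ℝ in 𝓝 t ×ˢ 𝓝[>] 0, |p.1 - t| < r := by
    have : Tendsto (fun p : ℝ × ℝ => |p.1 - t|) (𝓝 t ×ˢ 𝓝[>] 0) (𝓝 |t - t|) :=
      (tendsto_fst.sub_const t).abs
    rw [sub_self, abs_zero] at this
    exact this.eventually (gt_mem_nhds hr)
  have c2 : ∀ᶠ p : ℝ × ℝ in 𝓝 t ×ˢ 𝓝[>] 0, |p.1 + p.2 * a - t| < r := by
    have h2 : Tendsto (fun p : ℝ × ℝ => p.2) (𝓝 t ×ˢ 𝓝[>] 0) (𝓝 0) :=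
      tendsto_snd.mono_right nhdsWithin_le_nhds
    have : Tendsto (fun p : ℝ × ℝ => |p.1 + p.2 * a - t|) (𝓝 t ×ˢ 𝓝[>] 0) (𝓝 |t + 0 * a - t|) :=
      ((tendsto_fst.add (h2.mul_const a)).sub_const t).abs
    simp only [zero_mul, add_zero, sub_self, abs_zero] at this
    exact this.eventually (gt_mem_nhds hr)
  have c3 : ∀ᶠ p : ℝ × ℝ in 𝓝 t ×ˢ 𝓝[>] 0, 0 < p.2 :=
    tendsto_snd.eventually self_mem_nhdsWithin
  filter_upwards [c1, c2, c3] with p h1 h2 h3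
  rw [abs_lt] at h1 h2
  have hi : ∀ a b, IntervalIntegrable (f x) volume a b := intervalIntegrable_of_locallyIntegrable hf
  rw [div_le_iff₀ h3]
  rcases le_total 0 a with ha | ha
  · have hle : p.1 ≤ p.1 + p.2 * a := by nlinarith
    rw [primitive_sub hf]
    have : ∫ s in p.1..(p.1 + p.2 * a), f x s ≤
        ∫ _ in p.1..(p.1 + p.2 * a), (upperEnvelope f x t + δ) := by
      refine intervalIntegral.integral_mono_ae_restrict hle (hi _ _) (by simp) ?_
      rw [EventuallyLE, ae_restrict_iff' measurableSet_Icc]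
      filter_upwards [h] with s hs hsm
      exact (hs (abs_lt.2 ⟨by linarith [hsm.1], by linarith [hsm.2]⟩)).2.le
    rw [intervalIntegral.integral_const, smul_eq_mul] at this
    rw [abs_of_nonneg ha] at hδa
    have := le_max_left (upperEnvelope f x t * a) (lowerEnvelope f x t * a)
    nlinarith
  · have hle : p.1 + p.2 * a ≤ p.1 := by nlinarith
    rw [← neg_sub, primitive_sub hf]
    have : ∫ _ in (p.1 + p.2 * a)..p.1, (lowerEnvelope f x t - δ) ≤
        ∫ s in (p.1 + p.2 * a)..p.1, f x s := by
      refine intervalIntegral.integral_mono_ae_restrict hle (by simp) (hi _ _) ?_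
      rw [EventuallyLE, ae_restrict_iff' measurableSet_Icc]
      filter_upwards [h] with s hs hsm
      exact (hs (abs_lt.2 ⟨by linarith [hsm.1], by linarith [hsm.2]⟩)).1.le
    rw [intervalIntegral.integral_const, smul_eq_mul] at this
    rw [abs_of_nonpos ha] at hδa
    have := le_max_right (upperEnvelope f x t * a) (lowerEnvelope f x t * a)
    nlinarith

omit hf hF in
-- In Clarke's limsup the base point moves. It may sit at a differentiability point `s` near `t`,
-- where the quotients tend to `f x s * a`, even if the primitive is not differentiable at `t`.
theorem le_clarkeDeriv_of_near {c : ℝ} (a : ℝ)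
    (hc : ∀ ε r : ℝ, 0 < ε → 0 < r → ∃ s, |s - t| < r ∧ HasDerivAt (primitive f x) (f x s) s ∧
      |f x s - c| < ε) :
    ((c * a : ℝ) : EReal) ≤ clarkeDeriv (primitive f x) t a := by
  refine le_of_forall_lt fun d hd => ?_
  obtain ⟨e, hde, hec⟩ := EReal.lt_iff_exists_real_btwn.1 hd
  refine hde.trans_le ?_
  have hec' : e < c * a := by exact_mod_cast hec
  refine le_limsup_of_frequently_le ?_
  rw [frequently_iff]
  intro S hS
  obtain ⟨U, hU, V, hV, hUV⟩ := mem_prod_iff.1 hS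
  obtain ⟨r, hr, hrU⟩ := Metric.mem_nhds_iff.1 hU
  have ha1 : 0 < |a| + 1 := by positivity
  obtain ⟨s, hst, hsd, hsc⟩ := hc ((c * a - e) / (|a| + 1)) r
    (div_pos (by linarith) ha1) hr
  have hlt : e < f x s * a := by
    have h1 : |f x s - c| * |a| < c * a - e := by
      rcases eq_or_ne a 0 with rfl | ha
      · simp at hec' ⊢; exact hec'
      have : 0 < |a| := abs_pos.2 ha
      calc |f x s - c| * |a| < (c * a - e) / (|a| + 1) * |a| := by gcongr
        _ ≤ c * a - e := by rw [div_mul_eq_mul_div, div_le_iff₀ ha1]; nlinarith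
    rw [← abs_mul, sub_mul] at h1
    linarith [neg_abs_le (f x s * a - c * a)]
  have hlim : Tendsto (fun h : ℝ => (primitive f x (s + h * a) - primitive f x s) / h)
      (𝓝[>] 0) (𝓝 (f x s * a)) := by
    have h0 : HasDerivAt (fun h : ℝ => s + h * a) a 0 := by
      simpa using ((hasDerivAt_id (0 : ℝ)).mul_const a).const_add s
    have h1 : HasDerivAt (fun h : ℝ => primitive f x (s + h * a)) (f x s * a) 0 :=
      HasDerivAt.comp (0 : ℝ) (h₂ := primitive f x) (by simpa using hsd) h0
    have h2 := (hasDerivAt_iff_tendsto_slope.1 h1).mono_left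
      (nhdsWithin_mono (0 : ℝ) (show Ioi (0 : ℝ) ⊆ {0}ᶜ from fun y hy => ne_of_gt hy))
    refine h2.congr fun h => ?_
    simp [slope_def_field]
  obtain ⟨h, hh, hhV⟩ := ((hlim.eventually (lt_mem_nhds hlt)).and hV).exists
  refine ⟨(s, h), hUV ⟨hrU (by simpa [Real.dist_eq] using hst), hhV⟩, ?_⟩
  simpa using hh.le

theorem clarkeDeriv_primitive (a : ℝ) :
    clarkeDeriv (primitive f x) t a =
      ((max (upperEnvelope f x t * a) (lowerEnvelope f x t * a) : ℝ) : EReal) := by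
  refine le_antisymm ?_ ?_
  · refine le_of_forall_gt fun d hd => ?_
    obtain ⟨e, hde, hec⟩ := EReal.lt_iff_exists_real_btwn.1 hd
    refine lt_of_le_of_lt ?_ hec
    have hde' : max (upperEnvelope f x t * a) (lowerEnvelope f x t * a) < e := by exact_mod_cast hde
    refine limsup_le_of_le (h := ?_)
    filter_upwards [eventually_primitive_quotient_le hf hF t a (sub_pos.2 hde')] with p hp
    rw [smul_eq_mul, EReal.coe_le_coe_iff]
    linarith
  · have h1 := le_clarkeDeriv_of_near t a
      fun ε r hε hr => exists_hasDerivAt_near_upperEnvelope hf hF t hε hr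
    have h2 := le_clarkeDeriv_of_near t a
      fun ε r hε hr => exists_hasDerivAt_near_lowerEnvelope hf hF t hε hr
    rcases max_choice (upperEnvelope f x t * a) (lowerEnvelope f x t * a) with h | h <;> rw [h]
    exacts [h1, h2]

/-- The generalized derivative is the support function of the envelope interval; the directions `1`
and `-1` already recover both endpoints. -/
theorem clarkeGradientReal_primitive :
    clarkeGradientReal (primitive f x) t = Icc (lowerEnvelope f x t) (upperEnvelope f x t) := by
  have hle := lowerEnvelope_le_upperEnvelope hf hF t
  ext ξ
  constructor
  · rintro ⟨ζ, hζ, rfl⟩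
    have h1 := hζ 1
    have h2 := hζ (-1)
    rw [clarkeDeriv_primitive hf hF, EReal.coe_le_coe_iff] at h1 h2
    rw [map_neg] at h2
    simp only [mul_one, mul_neg, max_eq_left hle, max_eq_right (neg_le_neg hle)] at h1 h2
    exact ⟨by simpa using h2, h1⟩
  · rintro ⟨h1, h2⟩
    refine ⟨ξ • ContinuousLinearMap.id ℝ ℝ, fun v => ?_, by simp⟩
    rw [clarkeDeriv_primitive hf hF, EReal.coe_le_coe_iff]
    simp only [smul_apply, ContinuousLinearMap.id_apply, smul_eq_mul]
    rcases le_total 0 v with hv | hv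
    · exact le_max_of_le_left (mul_le_mul_of_nonneg_right h2 hv)
    · exact le_max_of_le_right (mul_le_mul_of_nonpos_right h1 hv)

omit t in
-- Where the primitive is differentiable its derivative belongs to the generalized gradient, which
-- is the envelope interval. The growth condition on ∂ₜF thereby becomes an a.e. bound on `f`.
theorem ae_mem_Icc_envelope :
    ∀ᵐ s, f x s ∈ Icc (lowerEnvelope f x s) (upperEnvelope f x s) := by
  filter_upwards [ae_hasDerivAt_primitive hf] with s hs
  rw [← clarkeGradientReal_primitive hf hF]
  refine ⟨f x s • ContinuousLinearMap.id ℝ ℝ, fun v => ?_, by simp⟩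
  simpa using le_clarkeDeriv_of_near s v
    fun ε r hε hr => ⟨s, by simpa using hr, hs, by simpa using hε⟩

end

end Envelope

/-! ### Clarke's calculus on normed spaces -/

/-- A linear functional dominated by a sublinear function along a linear map factors through that
map, with a factor dominated by the sublinear function. -/
theorem exists_linearMap_comp_eq_of_le_sublinear {X F : Type*} [AddCommGroup X] [Module ℝ X]
    [AddCommGroup F] [Module ℝ F] (T : X →ₗ[ℝ] F) (ζ : X →ₗ[ℝ] ℝ) (N : F → ℝ)
    (N_hom : ∀ c : ℝ, 0 < c → ∀ v, N (c • v) = c * N v) (N_add : ∀ v w, N (v + w) ≤ N v + N w)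
    (h : ∀ v, ζ v ≤ N (T v)) :
    ∃ ξ : F →ₗ[ℝ] ℝ, (∀ v, ξ (T v) = ζ v) ∧ ∀ v, ξ v ≤ N v := by
  have N_0 : N 0 = 0 := by
    have := N_hom 2 (by norm_num) 0
    rw [smul_zero] at this
    linarith
  -- Domination at `v` and at `-v` makes `ζ` vanish on the kernel of `T`. It therefore descends to
  -- the range, and Hahn-Banach extends it from there.
  have hker : ∀ v, T v = 0 → ζ v = 0 := fun v hv => by
    have h1 := h v
    have h2 := h (-v)
    rw [map_neg, map_neg, hv, neg_zero, N_0] at h2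
    rw [hv, N_0] at h1
    linarith
  obtain ⟨S, hS⟩ := T.rangeRestrict.exists_rightInverse_of_surjective T.range_rangeRestrict
  have hTS : ∀ w : T.range, T (S w) = w := fun w => by
    have := LinearMap.congr_fun hS w
    simpa using congrArg Subtype.val this
  obtain ⟨ξ, h1, h2⟩ := exists_extension_of_le_sublinear ⟨T.range, ζ.comp S⟩ N N_hom N_add
    (fun w => by
      have := h (S w)
      rwa [hTS] at this)
  refine ⟨ξ, fun v => ?_, h2⟩
  have h3 := h1 ⟨T v, LinearMap.mem_range_self T v⟩
  rw [h3]
  have h4 := hker (S ⟨T v, LinearMap.mem_range_self T v⟩ - v) (by rw [map_sub, hTS, sub_self])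
  rw [map_sub, sub_eq_zero] at h4
  exact h4

section Clarke

variable {E : Type*} [NormedAddCommGroup E] [NormedSpace ℝ E] {g : E → ℝ} {x : E}

/-- Trades the limsup in `EReal` for eventual inequalities between reals, the form in which all
later estimates are made. -/
theorem clarkeDeriv_le_coe_iff {v : E} {a : ℝ} :
    clarkeDeriv g x v ≤ a ↔ ∀ ε > 0, ∀ᶠ p : E × ℝ in 𝓝 x ×ˢ 𝓝[>] (0 : ℝ),
      (g (p.1 + p.2 • v) - g p.1) / p.2 ≤ a + ε := by
  constructor
  · intro h ε hε
    have : clarkeDeriv g x v < ((a + ε : ℝ) : EReal) :=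
      h.trans_lt (by exact_mod_cast lt_add_of_pos_right a hε)
    filter_upwards [eventually_lt_of_limsup_lt this] with p hp
    exact_mod_cast hp.le
  · intro h
    refine le_of_forall_gt fun d hd => ?_
    obtain ⟨e, hde, hec⟩ := EReal.lt_iff_exists_real_btwn.1 hd
    refine lt_of_le_of_lt ?_ hec
    have hde' : a < e := by exact_mod_cast hde
    refine limsup_le_of_le (h := ?_)
    filter_upwards [h (e - a) (sub_pos.2 hde')] with p hp
    rw [EReal.coe_le_coe_iff]
    linarith

omit [NormedSpace ℝ E] in
theorem eventually_snd_pos : ∀ᶠ p : E × ℝ in 𝓝 x ×ˢ 𝓝[>] (0 : ℝ), 0 < p.2 :=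
  tendsto_snd.eventually self_mem_nhdsWithin

theorem tendsto_fst_add_smul (x v : E) :
    Tendsto (fun p : E × ℝ => p.1 + p.2 • v) (𝓝 x ×ˢ 𝓝[>] (0 : ℝ)) (𝓝 x) := by
  have h2 : Tendsto (fun p : E × ℝ => p.2) (𝓝 x ×ˢ 𝓝[>] 0) (𝓝 0) :=
    tendsto_snd.mono_right nhdsWithin_le_nhds
  have : Tendsto (fun p : E × ℝ => p.1 + p.2 • v) (𝓝 x ×ˢ 𝓝[>] (0 : ℝ)) (𝓝 (x + (0 : ℝ) • v)) :=
    tendsto_fst.add (h2.smul_const v)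
  simpa using this

/-- Needed both for `q` a multiple of the norm and for `q` a multiple of the weaker L² norm on `EPhi
Ω`; hence only positive homogeneity is required of `q`. -/
theorem clarkeDeriv_le_of_eventually_sub_le {q : E → ℝ}
    (hq : ∀ c : ℝ, 0 < c → ∀ v, q (c • v) = c * q v)
    (h : ∀ᶠ z : E × E in 𝓝 x ×ˢ 𝓝 x, g z.1 - g z.2 ≤ q (z.1 - z.2)) (v : E) :
    clarkeDeriv g x v ≤ q v := by
  rw [clarkeDeriv_le_coe_iff]
  intro ε hε
  filter_upwards [((tendsto_fst_add_smul x v).prodMk tendsto_fst).eventually h,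
    eventually_snd_pos] with p hp hp0
  simp only [add_sub_cancel_left] at hp
  rw [hq _ hp0] at hp
  rw [div_le_iff₀ hp0]
  nlinarith

omit [NormedSpace ℝ E] in
theorem exists_abs_sub_le (hg : LocallyLipschitz g) (x : E) :
    ∃ K : ℝ, 0 ≤ K ∧ ∀ᶠ z : E × E in 𝓝 x ×ˢ 𝓝 x, |g z.1 - g z.2| ≤ K * ‖z.1 - z.2‖ := by
  obtain ⟨K, U, hU, hK⟩ := hg x
  refine ⟨K, K.2, ?_⟩
  filter_upwards [prod_mem_prod hU hU] with z hz
  simpa [dist_eq_norm] using hK.dist_le_mul z.1 hz.1 z.2 hz.2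

theorem exists_clarkeDeriv_bound (hg : LocallyLipschitz g) (x : E) :
    ∃ K : ℝ, 0 ≤ K ∧ ∀ v, clarkeDeriv g x v ≤ ((K * ‖v‖ : ℝ) : EReal) ∧
      ((-(K * ‖v‖) : ℝ) : EReal) ≤ clarkeDeriv g x v := by
  obtain ⟨K, hK0, hK⟩ := exists_abs_sub_le hg x
  refine ⟨K, hK0, fun v => ⟨?_, ?_⟩⟩
  · refine clarkeDeriv_le_of_eventually_sub_le (q := fun v => K * ‖v‖) (fun c hc v => ?_) ?_ v
    · rw [norm_smul, Real.norm_of_nonneg hc.le]; ring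
    · filter_upwards [hK] with z hz using (le_abs_self _).trans hz
  · refine le_limsup_of_frequently_le (Eventually.frequently ?_)
    filter_upwards [((tendsto_fst_add_smul x v).prodMk tendsto_fst).eventually hK,
      eventually_snd_pos] with p hp hp0
    simp only [add_sub_cancel_left, norm_smul, Real.norm_of_nonneg hp0.le] at hp
    rw [EReal.coe_le_coe_iff, le_div_iff₀ hp0]
    have := (abs_le.1 hp).1
    linarith

theorem coe_toReal_clarkeDeriv (hg : LocallyLipschitz g) (x v : E) :
    (((clarkeDeriv g x v).toReal : ℝ) : EReal) = clarkeDeriv g x v := by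
  obtain ⟨K, -, hK⟩ := exists_clarkeDeriv_bound hg x
  refine EReal.coe_toReal (fun h => ?_) (fun h => ?_)
  · have := (hK v).1
    rw [h, top_le_iff] at this
    exact EReal.coe_ne_top _ this
  · have := (hK v).2
    rw [h, le_bot_iff] at this
    exact EReal.coe_ne_bot _ this

theorem toReal_clarkeDeriv_smul_le (hg : LocallyLipschitz g) (x v : E) {c : ℝ} (hc : 0 < c) :
    (clarkeDeriv g x (c • v)).toReal ≤ c * (clarkeDeriv g x v).toReal := by
  rw [← EReal.coe_le_coe_iff, coe_toReal_clarkeDeriv hg, clarkeDeriv_le_coe_iff]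
  intro ε hε
  have h := clarkeDeriv_le_coe_iff.1 (coe_toReal_clarkeDeriv hg x v).ge (ε / c) (by positivity)
  have ht : Tendsto (fun p : E × ℝ => (p.1, c * p.2)) (𝓝 x ×ˢ 𝓝[>] (0 : ℝ))
      (𝓝 x ×ˢ 𝓝[>] (0 : ℝ)) := by
    refine tendsto_fst.prodMk (tendsto_nhdsWithin_iff.2 ⟨?_, ?_⟩)
    · have : Tendsto (fun p : E × ℝ => c * p.2) (𝓝 x ×ˢ 𝓝[>] (0 : ℝ)) (𝓝 (c * 0)) :=
        (tendsto_snd.mono_right nhdsWithin_le_nhds).const_mul c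
      simpa using this
    · filter_upwards [eventually_snd_pos] with p hp using mul_pos hc hp
  filter_upwards [ht.eventually h, eventually_snd_pos] with p hp hp0
  simp only [smul_smul] at hp ⊢
  rw [mul_comm p.2 c]
  rw [div_le_iff₀ (by positivity)] at hp ⊢
  have : c * (ε / c) = ε := by field_simp
  calc _ ≤ _ := hp
    _ = (c * (clarkeDeriv g x v).toReal + c * (ε / c)) * p.2 := by ring
    _ = _ := by rw [this]

theorem toReal_clarkeDeriv_smul (hg : LocallyLipschitz g) (x v : E) {c : ℝ} (hc : 0 < c) :
    (clarkeDeriv g x (c • v)).toReal = c * (clarkeDeriv g x v).toReal := by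
  refine le_antisymm (toReal_clarkeDeriv_smul_le hg x v hc) ?_
  have h := toReal_clarkeDeriv_smul_le hg x (c • v) (inv_pos.2 hc)
  rw [smul_smul, inv_mul_cancel₀ hc.ne', one_smul] at h
  rwa [← div_eq_inv_mul, le_div_iff₀' hc] at h

/-- The increment along `v + w` splits at the intermediate point `y + s v`, which still tends to `x`
and is thus an admissible base point for the direction `w`. -/
theorem toReal_clarkeDeriv_add_le (hg : LocallyLipschitz g) (x v w : E) :
    (clarkeDeriv g x (v + w)).toReal ≤
      (clarkeDeriv g x v).toReal + (clarkeDeriv g x w).toReal := by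
  rw [← EReal.coe_le_coe_iff, coe_toReal_clarkeDeriv hg, clarkeDeriv_le_coe_iff]
  intro ε hε
  have hv := clarkeDeriv_le_coe_iff.1 (coe_toReal_clarkeDeriv hg x v).ge (ε / 2) (by positivity)
  have hw := clarkeDeriv_le_coe_iff.1 (coe_toReal_clarkeDeriv hg x w).ge (ε / 2) (by positivity)
  filter_upwards [hv, ((tendsto_fst_add_smul x v).prodMk tendsto_snd).eventually hw,
    eventually_snd_pos] with p h1 h2 hp0
  rw [smul_add, ← add_assoc]
  rw [div_le_iff₀ hp0] at h1 h2 ⊢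
  linarith

/-- The generalized gradient of `g ∘ T`, for `T` linear and bounded, consists of functionals
`ξ ∘ T` with `ξ` in the generalized gradient of `g`. -/
theorem exists_mem_clarkeGradient_comp {X : Type*} [NormedAddCommGroup X] [NormedSpace ℝ X]
    (hg : LocallyLipschitz g) (T : X →L[ℝ] E) (w : X) {ζ : StrongDual ℝ X}
    (hζ : ζ ∈ clarkeGradient (fun z => g (T z)) w) :
    ∃ ξ ∈ clarkeGradient g (T w), ζ = ξ.comp T := by
  -- Base points of the form `T y` are only some of the points near `T w`, so the limsup on the left
  -- is the smaller one.
  have hle : ∀ v, clarkeDeriv (fun z => g (T z)) w v ≤ clarkeDeriv g (T w) (T v) := by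
    intro v
    rw [← coe_toReal_clarkeDeriv hg, clarkeDeriv_le_coe_iff]
    intro ε hε
    have h := clarkeDeriv_le_coe_iff.1 (coe_toReal_clarkeDeriv hg (T w) (T v)).ge ε hε
    have ht : Tendsto (fun p : X × ℝ => (T p.1, p.2)) (𝓝 w ×ˢ 𝓝[>] (0 : ℝ))
        (𝓝 (T w) ×ˢ 𝓝[>] (0 : ℝ)) :=
      ((T.continuous.tendsto w).comp tendsto_fst).prodMk tendsto_snd
    filter_upwards [ht.eventually h] with p hp
    simpa using hp
  obtain ⟨ξ, h1, h2⟩ := exists_linearMap_comp_eq_of_le_sublinear (T : X →ₗ[ℝ] E) (ζ : X →ₗ[ℝ] ℝ)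
    (fun v => (clarkeDeriv g (T w) v).toReal) (fun c hc v => toReal_clarkeDeriv_smul hg _ v hc)
    (fun v v' => toReal_clarkeDeriv_add_le hg _ v v')
    (fun v => by
      rw [← EReal.coe_le_coe_iff, coe_toReal_clarkeDeriv hg]
      exact (hζ v).trans (hle v))
  obtain ⟨K, hK0, hK⟩ := exists_clarkeDeriv_bound hg (T w)
  have hb : ∀ v, ξ v ≤ K * ‖v‖ := fun v => by
    rw [← EReal.coe_le_coe_iff]
    refine le_trans ?_ (hK v).1
    rw [← coe_toReal_clarkeDeriv hg, EReal.coe_le_coe_iff]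
    exact h2 v
  refine ⟨ξ.mkContinuous K fun v => abs_le.2 ⟨?_, hb v⟩, fun v => ?_, ?_⟩
  · have := hb (-v)
    rw [map_neg, norm_neg] at this
    linarith
  · rw [← coe_toReal_clarkeDeriv hg, EReal.coe_le_coe_iff]
    exact h2 v
  · ext v
    exact (h1 v).symm

end Clarke

/-! ### The space `E_A(Ω)` consists of the functions all of whose modulars are finite -/

section Orlicz

variable {A : NFunction} {Ω : Set Plane}

/-- The class in `L^A(Ω)` of a function. -/
def OrliczSpace.ofFun (u : Plane → ℝ) (hu : AEMeasurable u (volume.restrict Ω))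
    (h : MemOrlicz A.toFun Ω u) : OrliczSpace A Ω :=
  ⟨AEEqFun.mk u hu.aestronglyMeasurable,
    memOrlicz_congr (AEEqFun.coeFn_mk _ hu.aestronglyMeasurable).symm h⟩

theorem OrliczSpace.rep_ofFun {u : Plane → ℝ} (hu : AEMeasurable u (volume.restrict Ω))
    (h : MemOrlicz A.toFun Ω u) :
    (OrliczSpace.ofFun u hu h).rep =ᵐ[volume.restrict Ω] u :=
  AEEqFun.coeFn_mk _ hu.aestronglyMeasurable

theorem OrliczSpace.rep_sub (u v : OrliczSpace A Ω) :
    (u - v).rep =ᵐ[volume.restrict Ω] fun x => u.rep x - v.rep x := AEEqFun.coeFn_sub u.1 v.1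

theorem locallyIntegrableOn_of_forall_ball {u : Plane → ℝ}
    (h : ∀ x ∈ Ω, IntegrableOn u (Metric.ball x 1 ∩ Ω) volume) :
    LocallyIntegrableOn u Ω volume := fun x hx =>
  ⟨Metric.ball x 1 ∩ Ω, inter_mem (mem_nhdsWithin_of_mem_nhds (Metric.ball_mem_nhds x one_pos))
    self_mem_nhdsWithin, h x hx⟩

theorem isFiniteMeasure_restrict_ball_inter (x : Plane) (r : ℝ) :
    IsFiniteMeasure ((volume : Measure Plane).restrict (Metric.ball x r ∩ Ω)) :=
  ⟨by
    rw [Measure.restrict_apply_univ]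
    exact (measure_mono inter_subset_left).trans_lt measure_ball_lt_top⟩

theorem locallyIntegrableOn_of_bounded {u : Plane → ℝ} {C : ℝ}
    (hu : AEMeasurable u (volume.restrict Ω)) (hC : ∀ᵐ x ∂(volume.restrict Ω), |u x| ≤ C) :
    LocallyIntegrableOn u Ω volume := by
  refine locallyIntegrableOn_of_forall_ball fun x _ => ?_
  have := isFiniteMeasure_restrict_ball_inter (Ω := Ω) x 1
  refine Integrable.of_bound (C := C)
    (hu.aestronglyMeasurable.mono_measure (Measure.restrict_mono inter_subset_right le_rfl)) ?_
  exact ae_restrict_of_ae_restrict_of_subset inter_subset_right hC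

theorem locallyIntegrableOn_of_memLp {u : Plane → ℝ} (hu : MemLp u 2 (volume.restrict Ω)) :
    LocallyIntegrableOn u Ω volume := by
  refine locallyIntegrableOn_of_forall_ball fun x _ => ?_
  have := isFiniteMeasure_restrict_ball_inter (Ω := Ω) x 1
  exact (hu.mono_measure (Measure.restrict_mono inter_subset_right le_rfl)).integrable one_le_two

theorem modular_mono {r : ℝ} (hr : 0 < r) {u v : Plane → ℝ}
    (h : ∀ᵐ x ∂(volume.restrict Ω), |u x| ≤ |v x|) :
    modular A.toFun Ω r u ≤ modular A.toFun Ω r v := by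
  refine lintegral_mono_ae ?_
  filter_upwards [h] with x hx
  exact ENNReal.ofReal_le_ofReal (A.mono (by positivity)
    (div_le_div_of_nonneg_right hx hr.le))

theorem modular_indicator_lt_top {K : Set Plane} (hK : MeasurableSet K) (hΩ : volume (K ∩ Ω) < ⊤)
    (C r : ℝ) : modular A.toFun Ω r (K.indicator fun _ => C) < ⊤ := by
  have h : ∀ x, ENNReal.ofReal (A.toFun (|K.indicator (fun _ => C) x| / r)) =
      K.indicator (fun _ => ENNReal.ofReal (A.toFun (|C| / r))) x := by
    intro x
    by_cases hx : x ∈ K <;> simp [hx, A.map_zero]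
  unfold modular
  simp_rw [h]
  rw [lintegral_indicator_const hK, Measure.restrict_apply hK]
  exact ENNReal.mul_lt_top ENNReal.ofReal_lt_top hΩ

theorem modular_lt_top_of_bounded {u : Plane → ℝ} {C : ℝ} {K : Set Plane} (hK : MeasurableSet K)
    (hΩ : volume (K ∩ Ω) < ⊤) (hC : ∀ᵐ x ∂(volume.restrict Ω), |u x| ≤ C)
    (h0 : ∀ᵐ x ∂(volume.restrict Ω), x ∉ K → u x = 0) {r : ℝ} (hr : 0 < r) :
    modular A.toFun Ω r u < ⊤ := by
  refine (modular_mono hr ?_).trans_lt (modular_indicator_lt_top hK hΩ C r)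
  filter_upwards [hC, h0] with x h1 h2
  by_cases hx : x ∈ K
  · simpa [hx] using h1.trans (le_abs_self C)
  · simp [hx, h2 hx]

theorem aemeasurable_modular {u : Plane → ℝ} (hu : AEMeasurable u (volume.restrict Ω)) (r : ℝ) :
    AEMeasurable (fun x => ENNReal.ofReal (A.toFun (|u x| / r))) (volume.restrict Ω) :=
  ENNReal.measurable_ofReal.comp_aemeasurable (A.continuous'.measurable.comp_aemeasurable
    ((continuous_abs.measurable.comp_aemeasurable hu).div_const r))

theorem modular_add_lt_top {a b : ℝ} (ha : 0 < a) (hb : 0 < b) {u v : Plane → ℝ}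
    (hu : AEMeasurable u (volume.restrict Ω)) (h1 : modular A.toFun Ω a u < ⊤)
    (h2 : modular A.toFun Ω b v < ⊤) :
    modular A.toFun Ω (a + b) (fun x => u x + v x) < ⊤ :=
  (modular_add ha hb hu).trans_lt (ENNReal.add_lt_top.2
    ⟨ENNReal.mul_lt_top ENNReal.ofReal_lt_top h1, ENNReal.mul_lt_top ENNReal.ofReal_lt_top h2⟩)

/-- Write `u = (u - s) + s` with `s ∈ S` and `‖u - s‖ < r / 2`. By convexity the modular at scale
`r` is at most the mean of the two modulars at scale `r / 2`. -/
theorem modular_lt_top_of_mem_topologicalClosure {S : Submodule ℝ (OrliczSpace A Ω)}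
    (hS : ∀ s ∈ S, ∀ r : ℝ, 0 < r → modular A.toFun Ω r s.rep < ⊤) {u : OrliczSpace A Ω}
    (hu : u ∈ S.topologicalClosure) {r : ℝ} (hr : 0 < r) : modular A.toFun Ω r u.rep < ⊤ := by
  obtain ⟨s, hs, hus⟩ := Metric.mem_closure_iff.1 hu (r / 2) (by positivity)
  rw [dist_eq_norm] at hus
  have h1 := (OrliczSpace.mem_lux_of_norm_lt hus).2.trans_lt ENNReal.one_lt_top
  have h2 := modular_add_lt_top (half_pos hr) (half_pos hr) (u - s).rep_aemeasurable h1
    (hS s hs (r / 2) (half_pos hr))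
  rw [add_halves, ← modular_congr (OrliczSpace.rep_add _ _), sub_add_cancel] at h2
  exact h2

/-- A modular at most `1` at scale `ε / 2` means norm at most `ε / 2`, so convergence of the
modulars at every scale is convergence in norm. -/
theorem mem_topologicalClosure_of_tendsto_modular {S : Submodule ℝ (OrliczSpace A Ω)}
    {u : OrliczSpace A Ω} {v : ℕ → OrliczSpace A Ω} (hv : ∀ n, v n ∈ S)
    (h : ∀ r : ℝ, 0 < r →
      Tendsto (fun n => modular A.toFun Ω r fun x => u.rep x - (v n).rep x) atTop (𝓝 0)) :
    u ∈ S.topologicalClosure := by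
  refine Metric.mem_closure_iff.2 fun ε hε => ?_
  have h1 := (h (ε / 2) (by positivity)).eventually (gt_mem_nhds one_pos)
  obtain ⟨n, hn⟩ := h1.exists
  refine ⟨v n, hv n, ?_⟩
  rw [dist_eq_norm]
  refine lt_of_le_of_lt (OrliczSpace.norm_le_of_mem ⟨half_pos hε, ?_⟩) (half_lt_self hε)
  rw [modular_congr (OrliczSpace.rep_sub _ _)]
  exact hn.le

/-- Dominated convergence in the modular. -/
theorem tendsto_modular_sub {u w : Plane → ℝ} {v : ℕ → Plane → ℝ}
    (hu : AEMeasurable u (volume.restrict Ω)) (hv : ∀ n, AEMeasurable (v n) (volume.restrict Ω))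
    {r : ℝ} (hr : 0 < r) (hb : ∀ n, ∀ᵐ x ∂(volume.restrict Ω), |u x - v n x| ≤ |w x|)
    (hw : modular A.toFun Ω r w < ⊤)
    (hl : ∀ᵐ x ∂(volume.restrict Ω), Tendsto (fun n => v n x) atTop (𝓝 (u x))) :
    Tendsto (fun n => modular A.toFun Ω r fun x => u x - v n x) atTop (𝓝 0) := by
  have := tendsto_lintegral_of_dominated_convergence' (μ := volume.restrict Ω)
    (F := fun n x => ENNReal.ofReal (A.toFun (|u x - v n x| / r))) (f := fun _ => 0)
    (fun x => ENNReal.ofReal (A.toFun (|w x| / r)))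
    (fun n => aemeasurable_modular (hu.sub (hv n)) r) (fun n => ?_) hw.ne ?_
  · simpa [modular] using this
  · filter_upwards [hb n] with x hx
    exact ENNReal.ofReal_le_ofReal (A.mono (by positivity)
      (div_le_div_of_nonneg_right hx hr.le))
  · filter_upwards [hl] with x hx
    have h1 : Tendsto (fun n => |u x - v n x| / r) atTop (𝓝 (|u x - u x| / r)) :=
      ((tendsto_const_nhds.sub hx).abs).div_const r
    rw [sub_self, abs_zero, zero_div] at h1
    have h2 := ENNReal.tendsto_ofReal ((A.continuous'.tendsto 0).comp h1)
    rwa [A.map_zero, ENNReal.ofReal_zero] at h2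

/-- Truncation of the values to `[-n, n]` and of the support to the ball of radius `n`. -/
def truncation (n : ℕ) (u : Plane → ℝ) : Plane → ℝ :=
  (Metric.ball (0 : Plane) n).indicator fun x => max (-(n : ℝ)) (min n (u x))

theorem abs_truncation_le (n : ℕ) (u : Plane → ℝ) (x : Plane) : |truncation n u x| ≤ n := by
  unfold truncation
  by_cases hx : x ∈ Metric.ball (0 : Plane) n
  · rw [indicator_of_mem hx, abs_le]
    exact ⟨le_max_left _ _, max_le (by linarith [(Nat.cast_nonneg n : (0 : ℝ) ≤ n)]) (min_le_left _ _)⟩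
  · rw [indicator_of_notMem hx]; simp

theorem abs_sub_truncation_le (n : ℕ) (u : Plane → ℝ) (x : Plane) :
    |u x - truncation n u x| ≤ |u x| := by
  unfold truncation
  by_cases hx : x ∈ Metric.ball (0 : Plane) n
  · rw [indicator_of_mem hx]
    have hn : (0 : ℝ) ≤ n := Nat.cast_nonneg n
    rcases le_total (n : ℝ) (u x) with h | h
    · rw [min_eq_left h, max_eq_right (by linarith), abs_of_nonneg (by linarith),
        abs_of_nonneg (by linarith)]
      linarith
    · rw [min_eq_right h]
      rcases le_total (-(n : ℝ)) (u x) with h' | h'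
      · rw [max_eq_right h', sub_self, abs_zero]; positivity
      · rw [max_eq_left h', abs_of_nonpos (by linarith), abs_of_nonpos (by linarith)]
        linarith
  · rw [indicator_of_notMem hx, sub_zero]

theorem tendsto_truncation (u : Plane → ℝ) (x : Plane) :
    Tendsto (fun n => truncation n u x) atTop (𝓝 (u x)) := by
  obtain ⟨N, hN⟩ := exists_nat_gt (max ‖x‖ |u x|)
  refine tendsto_const_nhds.congr' ?_
  filter_upwards [eventually_ge_atTop N] with n hn
  have hn' : (N : ℝ) ≤ n := by exact_mod_cast hn
  have h1 := (le_max_left ‖x‖ |u x|).trans_lt (hN.trans_le hn')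
  have h2 := (le_max_right ‖x‖ |u x|).trans_lt (hN.trans_le hn')
  rw [abs_lt] at h2
  rw [truncation, indicator_of_mem (by simpa using h1), min_eq_right h2.2.le,
    max_eq_right h2.1.le]

theorem aemeasurable_truncation (n : ℕ) {u : Plane → ℝ}
    (hu : AEMeasurable u (volume.restrict Ω)) :
    AEMeasurable (truncation n u) (volume.restrict Ω) :=
  ((aemeasurable_const.max (aemeasurable_const.min hu))).indicator Metric.isOpen_ball.measurableSet

theorem volume_ball_inter_lt_top (R : ℝ) : volume (Metric.ball (0 : Plane) R ∩ Ω) < ⊤ :=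
  (measure_mono inter_subset_left).trans_lt measure_ball_lt_top

theorem memOrlicz_truncation (n : ℕ) {u : Plane → ℝ} (hu : AEMeasurable u (volume.restrict Ω)) :
    MemOrlicz A.toFun Ω (truncation n u) :=
  ⟨locallyIntegrableOn_of_bounded (aemeasurable_truncation n hu)
    (Eventually.of_forall fun x => abs_truncation_le n u x), 1, one_pos,
    modular_lt_top_of_bounded Metric.isOpen_ball.measurableSet (volume_ball_inter_lt_top n)
      (Eventually.of_forall fun x => abs_truncation_le n u x)
      (Eventually.of_forall fun x hx => by rw [truncation, indicator_of_notMem hx]) one_pos⟩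

theorem mem_topologicalClosure_of_truncation {S : Submodule ℝ (OrliczSpace A Ω)}
    (hS : ∀ (n : ℕ) (u : Plane → ℝ) (hu : AEMeasurable u (volume.restrict Ω)),
      OrliczSpace.ofFun (truncation n u) (aemeasurable_truncation n hu)
        (memOrlicz_truncation n hu) ∈ S)
    {u : OrliczSpace A Ω} (h : ∀ r : ℝ, 0 < r → modular A.toFun Ω r u.rep < ⊤) :
    u ∈ S.topologicalClosure := by
  refine mem_topologicalClosure_of_tendsto_modular
    (fun n => hS n u.rep u.rep_aemeasurable) fun r hr => ?_
  refine tendsto_modular_sub u.rep_aemeasurable (fun n => OrliczSpace.rep_aemeasurable _) hr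
    (w := u.rep) (fun n => ?_) (h r hr) ?_
  · filter_upwards [OrliczSpace.rep_ofFun (A := A) (aemeasurable_truncation n u.rep_aemeasurable)
      (memOrlicz_truncation n u.rep_aemeasurable)] with x hx
    rw [hx]
    exact abs_sub_truncation_le n u.rep x
  · have := ae_all_iff.2 fun n => OrliczSpace.rep_ofFun (A := A)
      (aemeasurable_truncation n u.rep_aemeasurable) (memOrlicz_truncation n u.rep_aemeasurable)
    filter_upwards [this] with x hx
    simp_rw [hx]
    exact tendsto_truncation u.rep x

theorem IsTestFunction.exists_bound {φ : Plane → ℝ} (hφ : IsTestFunction Ω φ) :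
    ∃ C, ∀ x, |φ x| ≤ C := by
  obtain ⟨C, hC⟩ := hφ.2.1.exists_bound_of_continuous hφ.1.continuous
  exact ⟨C, hC⟩

theorem IsTestFunction.modular_lt_top {φ : Plane → ℝ} (hφ : IsTestFunction Ω φ) {r : ℝ}
    (hr : 0 < r) : modular A.toFun Ω r φ < ⊤ := by
  obtain ⟨C, hC⟩ := hφ.exists_bound
  refine modular_lt_top_of_bounded (isClosed_tsupport φ).measurableSet
    ((measure_mono inter_subset_left).trans_lt hφ.2.1.measure_lt_top)
    (Eventually.of_forall hC) (Eventually.of_forall fun x hx => image_eq_zero_of_notMem_tsupport hx) hr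

theorem IsTestFunction.memOrlicz {φ : Plane → ℝ} (hφ : IsTestFunction Ω φ) :
    MemOrlicz A.toFun Ω φ :=
  ⟨(hφ.1.continuous.locallyIntegrable).locallyIntegrableOn Ω, 1, one_pos,
    hφ.modular_lt_top one_pos⟩

/-- A bump function of radius `1 / (k + 1)`. -/
def smallBump (k : ℕ) : ContDiffBump (0 : Plane) where
  rIn := 1 / (2 * ((k : ℝ) + 1))
  rOut := 1 / ((k : ℝ) + 1)
  rIn_pos := by positivity
  rIn_lt_rOut := by
    apply one_div_lt_one_div_of_lt <;> linarith [(Nat.cast_nonneg k : (0 : ℝ) ≤ k)]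

theorem smallBump_rOut_le (k : ℕ) : (smallBump k).rOut ≤ 1 := by
  change 1 / ((k : ℝ) + 1) ≤ 1
  rw [div_le_one (by positivity)]
  linarith [(Nat.cast_nonneg k : (0 : ℝ) ≤ k)]

open scoped Convolution in
/-- Regularization of a function by convolution with `smallBump k`. -/
def mollify (k : ℕ) (v : Plane → ℝ) : Plane → ℝ :=
  (smallBump k).normed volume ⋆[ContinuousLinearMap.lsmul ℝ ℝ, volume] v

theorem abs_mollify_le (k : ℕ) {v : Plane → ℝ} {x : Plane} {C : ℝ} (hC : 0 ≤ C)
    (hv : AEStronglyMeasurable v volume) (h : ∀ y ∈ Metric.ball x 1, |v y| ≤ C) :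
    |mollify k v x| ≤ C := by
  have := dist_convolution_le (f := (smallBump k).normed volume) (g := v) (z₀ := 0) (x₀ := x)
    (R := (smallBump k).rOut) (μ := volume) hC
    (smallBump k).support_normed_eq.subset (smallBump k).nonneg_normed (smallBump k).integral_normed
    hv (fun y hy => by
      simpa using h y (Metric.ball_subset_ball (smallBump_rOut_le k) hy))
  simpa [mollify] using this

theorem isTestFunction_mollify (k : ℕ) {v : Plane → ℝ} (hv : LocallyIntegrable v volume) {R : ℝ}
    (hR : ∀ x, x ∉ Metric.ball (0 : Plane) R → v x = 0) : IsTestFunction univ (mollify k v) := by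
  refine ⟨(smallBump k).hasCompactSupport_normed.contDiff_convolution_left _
    (ContDiffBump.contDiff_normed _) hv, ?_, subset_univ _⟩
  refine HasCompactSupport.intro (isCompact_closedBall (0 : Plane) (R + 1)) fun x hx => ?_
  have := abs_mollify_le (x := x) k (le_refl 0) hv.aestronglyMeasurable (fun y hy => ?_)
  · simpa using this
  rw [hR y ?_, abs_zero]
  intro hy0
  apply hx
  rw [Metric.mem_ball, dist_comm] at hy
  rw [Metric.mem_ball] at hy0
  rw [Metric.mem_closedBall]
  linarith [dist_triangle x y 0]

/-- Mollifications at radius at most `1` remain bounded by `C` and vanish off the ball of radius `R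
+ 1`. The differences are dominated by `2 * C` on that ball, and they tend to `0` almost everywhere
by Lebesgue differentiation. -/
theorem ofFun_mem_topologicalClosure_testSubmodule {v : Plane → ℝ} {C R : ℝ}
    (hm : AEMeasurable v volume) (hC : ∀ x, |v x| ≤ C)
    (hR : ∀ x, x ∉ Metric.ball (0 : Plane) R → v x = 0) {u : OrliczSpace A univ}
    (huv : u.rep =ᵐ[volume.restrict univ] v) :
    u ∈ (testSubmodule A univ).topologicalClosure := by
  have hC0 : 0 ≤ C := (abs_nonneg _).trans (hC 0)
  have hli : LocallyIntegrable v volume := by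
    have := locallyIntegrableOn_of_bounded (Ω := univ) (u := v) (C := C)
      (by rwa [Measure.restrict_univ]) (Eventually.of_forall hC)
    rwa [locallyIntegrableOn_univ] at this
  have ht := fun k => isTestFunction_mollify k hli hR
  have hmeas : ∀ k, AEMeasurable (mollify k v) (volume.restrict univ) :=
    fun k => (ht k).1.continuous.aemeasurable
  refine mem_topologicalClosure_of_tendsto_modular
    (v := fun k => OrliczSpace.ofFun (mollify k v) (hmeas k) (ht k).memOrlicz)
    (fun k => ⟨mollify k v, ht k, OrliczSpace.rep_ofFun _ _⟩) fun r hr => ?_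
  have hK : modular A.toFun univ r
      ((Metric.ball (0 : Plane) (R + 1)).indicator fun _ => 2 * C) < ⊤ :=
    modular_indicator_lt_top Metric.isOpen_ball.measurableSet (volume_ball_inter_lt_top _) _ _
  refine tendsto_modular_sub u.rep_aemeasurable (fun n => OrliczSpace.rep_aemeasurable _) hr
    (w := (Metric.ball (0 : Plane) (R + 1)).indicator fun _ => 2 * C) (fun n => ?_) hK ?_
  · filter_upwards [huv, OrliczSpace.rep_ofFun (A := A) (hmeas n) (ht n).memOrlicz] with x h1 h2
    rw [h1, h2]
    by_cases hx : x ∈ Metric.ball (0 : Plane) (R + 1)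
    · rw [indicator_of_mem hx, abs_of_nonneg (by positivity : 0 ≤ 2 * C)]
      have := abs_mollify_le n (x := x) hC0 hli.aestronglyMeasurable fun y _ => hC y
      linarith [abs_sub (v x) (mollify n v x), hC x]
    · have h0 : ∀ y ∈ Metric.ball x 1, v y = 0 := fun y hy => hR y fun hy0 => hx (by
        rw [Metric.mem_ball, dist_comm] at hy
        rw [Metric.mem_ball] at hy0 ⊢
        linarith [dist_triangle x y 0])
      have := abs_mollify_le n (x := x) le_rfl hli.aestronglyMeasurable
        fun y hy => by rw [h0 y hy, abs_zero]
      rw [h0 x (Metric.mem_ball_self one_pos), zero_sub, abs_neg]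
      exact this.trans (abs_nonneg _)
  -- `K = 2` is the ratio of the outer to the inner radius of `smallBump`.
  · have hae := ContDiffBump.ae_convolution_tendsto_right_of_locallyIntegrable (φ := smallBump)
      (l := atTop) (K := 2) tendsto_one_div_add_atTop_nhds_zero_nat
      (Eventually.of_forall fun k => by
        change 1 / ((k : ℝ) + 1) ≤ 2 * (1 / (2 * ((k : ℝ) + 1)))
        apply le_of_eq; field_simp) hli
    have h2 := ae_all_iff.2 fun k => OrliczSpace.rep_ofFun (A := A) (hmeas k) (ht k).memOrlicz
    rw [Measure.restrict_univ] at huv h2 ⊢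
    filter_upwards [hae, huv, h2] with x h1 h3 h4
    rw [h3]
    simp_rw [h4]
    exact h1

/-- Finiteness of all modulars survives norm limits. Conversely, truncations of `u` converge to it
in every modular by dominated convergence, with `u` itself as the dominating function. Elements of
L^Φ need not have this property, since there only some scale has finite modular. -/
theorem mem_orliczE_iff (hΩ : volume Ω < ⊤ ∨ Ω = univ) (u : OrliczSpace A Ω) :
    u ∈ orliczE A Ω ↔ ∀ r : ℝ, 0 < r → modular A.toFun Ω r u.rep < ⊤ := by
  unfold orliczE
  split_ifs with hfin
  · refine ⟨fun hu r hr => modular_lt_top_of_mem_topologicalClosure ?_ hu hr, fun h =>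
      mem_topologicalClosure_of_truncation (S := boundedSubmodule A Ω)
        (fun n v hv => ⟨(n : ℝ), ?_⟩) h⟩
    · rintro s ⟨C, hC⟩ r hr
      exact modular_lt_top_of_bounded (K := univ) MeasurableSet.univ (by simpa using hfin) hC
        (by simp) hr
    · filter_upwards [OrliczSpace.rep_ofFun (A := A) (aemeasurable_truncation n hv)
        (memOrlicz_truncation n hv)] with x hx
      rw [hx]
      exact abs_truncation_le n v x
  · obtain rfl : Ω = univ := hΩ.resolve_left hfin
    refine ⟨fun hu r hr => modular_lt_top_of_mem_topologicalClosure ?_ hu hr, fun h => ?_⟩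
    · rintro s ⟨φ, hφ, hs⟩ r hr
      rw [modular_congr hs]
      exact hφ.modular_lt_top hr
    -- Truncations are themselves only limits of test functions, so the closure is taken twice.
    · have : u ∈ (testSubmodule A univ).topologicalClosure.topologicalClosure := by
        refine mem_topologicalClosure_of_truncation (fun n v hv => ?_) h
        refine ofFun_mem_topologicalClosure_testSubmodule (v := truncation n v) (C := n) (R := n)
          ?_ (abs_truncation_le n v) (fun x hx => by rw [truncation, indicator_of_notMem hx])
          (OrliczSpace.rep_ofFun _ _)
        have := aemeasurable_truncation n hv
        rwa [Measure.restrict_univ] at this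
      rwa [(Submodule.isClosed_topologicalClosure _).submodule_topologicalClosure_eq] at this

end Orlicz

/-! ### Square integrability of Orlicz functions -/

section SquareIntegrable

variable {Ω : Set Plane}

theorem Phi_apply (t : ℝ) : Phi.toFun t = Real.exp (t ^ 2) - 1 := rfl

theorem sq_le_Phi (t : ℝ) : t ^ 2 ≤ Phi.toFun t := by
  rw [Phi_apply]
  linarith [Real.add_one_le_exp (t ^ 2)]

theorem NFunction.map_abs (A : NFunction) (t : ℝ) : A.toFun |t| = A.toFun t := by
  rcases abs_choice t with h | h <;> rw [h]
  exact A.even' t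

theorem integrable_of_modular_lt_top {A : NFunction} {u : Plane → ℝ}
    (hu : AEMeasurable u (volume.restrict Ω)) {r : ℝ} (h : modular A.toFun Ω r u < ⊤) :
    Integrable (fun x => A.toFun (|u x| / r)) (volume.restrict Ω) := by
  refine ⟨(A.continuous'.measurable.comp_aemeasurable
    ((continuous_abs.measurable.comp_aemeasurable hu).div_const r)).aestronglyMeasurable, ?_⟩
  rw [hasFiniteIntegral_iff_ofReal (Eventually.of_forall fun x => A.nonneg' _)]
  exact h

theorem integral_eq_toReal_modular {A : NFunction} {u : Plane → ℝ}
    (hu : AEMeasurable u (volume.restrict Ω)) (r : ℝ) :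
    ∫ x in Ω, A.toFun (|u x| / r) = (modular A.toFun Ω r u).toReal :=
  integral_eq_lintegral_of_nonneg_ae (Eventually.of_forall fun _ => A.nonneg' _)
    (A.continuous'.measurable.comp_aemeasurable
    ((continuous_abs.measurable.comp_aemeasurable hu).div_const r)).aestronglyMeasurable

theorem sq_div_le_Phi (u r : ℝ) : u ^ 2 / r ^ 2 ≤ Phi.toFun (|u| / r) := by
  refine le_trans (le_of_eq ?_) (sq_le_Phi _)
  rw [div_pow, sq_abs]

theorem integrable_sq_of_modular_lt_top {u : Plane → ℝ}
    (hu : AEMeasurable u (volume.restrict Ω)) {r : ℝ} (hr : 0 < r)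
    (h : modular Phi.toFun Ω r u < ⊤) :
    Integrable (fun x => u x ^ 2) (volume.restrict Ω) := by
  refine ((integrable_of_modular_lt_top hu h).const_mul (r ^ 2)).mono'
    (hu.pow_const 2).aestronglyMeasurable (Eventually.of_forall fun x => ?_)
  rw [Real.norm_of_nonneg (sq_nonneg _), ← div_le_iff₀' (by positivity)]
  exact sq_div_le_Phi _ _

theorem memLp_two_of_modular_lt_top {u : Plane → ℝ}
    (hu : AEMeasurable u (volume.restrict Ω)) {r : ℝ} (hr : 0 < r)
    (h : modular Phi.toFun Ω r u < ⊤) : MemLp u 2 (volume.restrict Ω) :=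
  (memLp_two_iff_integrable_sq hu.aestronglyMeasurable).2 (integrable_sq_of_modular_lt_top hu hr h)

theorem integral_sq_le_of_modular_le_one {u : Plane → ℝ}
    (hu : AEMeasurable u (volume.restrict Ω)) {r : ℝ} (hr : 0 < r)
    (h : modular Phi.toFun Ω r u ≤ 1) : ∫ x in Ω, u x ^ 2 ≤ r ^ 2 := by
  have hlt := h.trans_lt ENNReal.one_lt_top
  have h1 : ∫ x in Ω, u x ^ 2 ≤ ∫ x in Ω, r ^ 2 * Phi.toFun (|u x| / r) := by
    refine integral_mono (integrable_sq_of_modular_lt_top hu hr hlt)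
      ((integrable_of_modular_lt_top hu hlt).const_mul _) fun x => ?_
    dsimp only
    rw [← div_le_iff₀' (by positivity)]
    exact sq_div_le_Phi _ _
  rw [integral_const_mul, integral_eq_toReal_modular hu] at h1
  have h2 : (modular Phi.toFun Ω r u).toReal ≤ 1 := by
    simpa using ENNReal.toReal_mono ENNReal.one_ne_top h
  nlinarith [sq_nonneg r]

/-- The Cauchy-Schwarz inequality for integrals. -/
theorem integral_abs_mul_le {α : Type*} [MeasurableSpace α] {μ : Measure α} {a b : α → ℝ}
    (ha : MemLp a 2 μ) (hb : MemLp b 2 μ) :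
    ∫ x, |a x| * |b x| ∂μ ≤ √(∫ x, a x ^ 2 ∂μ) * √(∫ x, b x ^ 2 ∂μ) := by
  have h := integral_mul_norm_le_Lp_mul_Lq (μ := μ) (f := a) (g := b) (p := 2) (q := 2)
    Real.HolderConjugate.two_two (by simpa using ha) (by simpa using hb)
  simpa [Real.sqrt_eq_rpow] using h

theorem OrliczSpace.rep_memLp (u : OrliczSpace Phi Ω) : MemLp u.rep 2 (volume.restrict Ω) := by
  obtain ⟨r, hr, h⟩ := u.rep_mem.2
  exact memLp_two_of_modular_lt_top u.rep_aemeasurable hr h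

theorem OrliczSpace.integral_sq_le (u : OrliczSpace Phi Ω) :
    ∫ x in Ω, u.rep x ^ 2 ≤ ‖u‖ ^ 2 := by
  have h : ∀ r, ‖u‖ < r → ∫ x in Ω, u.rep x ^ 2 ≤ r ^ 2 := fun r hr =>
    integral_sq_le_of_modular_le_one u.rep_aemeasurable (mem_lux_of_norm_lt hr).1
      (mem_lux_of_norm_lt hr).2
  have ht : Tendsto (fun r : ℝ => r ^ 2) (𝓝[>] ‖u‖) (𝓝 (‖u‖ ^ 2)) :=
    ((continuous_pow 2).tendsto _).mono_left nhdsWithin_le_nhds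
  refine ge_of_tendsto ht ?_
  filter_upwards [self_mem_nhdsWithin] with r hr using h r hr

/-- The inclusion of `L^Φ(Ω)` in `L²(Ω)`. -/
def toL2 (Ω : Set Plane) : OrliczSpace Phi Ω →ₗ[ℝ] Lp ℝ 2 ((volume : Measure Plane).restrict Ω) where
  toFun u := u.rep_memLp.toLp u.rep
  map_add' u v := by
    rw [← MemLp.toLp_add u.rep_memLp v.rep_memLp]
    exact MemLp.toLp_congr _ _ (OrliczSpace.rep_add u v)
  map_smul' c u := by
    rw [RingHom.id_apply, ← MemLp.toLp_const_smul c u.rep_memLp]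
    exact MemLp.toLp_congr _ _ (OrliczSpace.rep_smul c u)

theorem coeFn_toL2 (u : OrliczSpace Phi Ω) : toL2 Ω u =ᵐ[volume.restrict Ω] u.rep :=
  u.rep_memLp.coeFn_toLp

theorem norm_L2_eq_sqrt (g : Lp ℝ 2 ((volume : Measure Plane).restrict Ω)) :
    ‖g‖ = √(∫ x in Ω, g x ^ 2) := by
  rw [← Real.sqrt_sq (norm_nonneg g), ← real_inner_self_eq_norm_sq, L2.inner_def]
  congr 1
  refine integral_congr_ae (Eventually.of_forall fun x => ?_)
  simp [sq]

theorem norm_toL2_eq_sqrt (u : OrliczSpace Phi Ω) : ‖toL2 Ω u‖ = √(∫ x in Ω, u.rep x ^ 2) := by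
  rw [norm_L2_eq_sqrt]
  congr 1
  refine integral_congr_ae ?_
  filter_upwards [coeFn_toL2 u] with x hx
  rw [hx]

theorem norm_toL2_le (u : OrliczSpace Phi Ω) : ‖toL2 Ω u‖ ≤ ‖u‖ := by
  rw [norm_toL2_eq_sqrt]
  exact Real.sqrt_le_iff.2 ⟨norm_nonneg _, u.integral_sq_le⟩

/-- From `t² ≤ Φ(t)` it follows that `s t - Φ(t) ≤ s t - t² ≤ s²`. This reduces membership in the
complementary space to square integrability. -/
theorem conjugate_Phi_le (s : ℝ) : conjugate Phi.toFun s ≤ s ^ 2 := by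
  refine csSup_le (nonempty_Ici.image _) ?_
  rintro _ ⟨t, -, rfl⟩
  have := sq_le_Phi t
  nlinarith [sq_nonneg (s - t), sq_nonneg s]

/-- Square integrable functions belong to the complementary Orlicz space. -/
theorem memOrlicz_conjugate_Phi_of_memLp {η : Plane → ℝ} (hη : MemLp η 2 (volume.restrict Ω)) :
    MemOrlicz (conjugate Phi.toFun) Ω η := by
  refine ⟨locallyIntegrableOn_of_memLp hη, 1, one_pos, ?_⟩
  have h1 : Integrable (fun x => η x ^ 2) (volume.restrict Ω) :=
    (memLp_two_iff_integrable_sq hη.1).1 hη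
  refine lt_of_le_of_lt (lintegral_mono fun x => ?_)
    ((hasFiniteIntegral_iff_ofReal (Eventually.of_forall fun x => sq_nonneg (η x))).1 h1.2)
  refine ENNReal.ofReal_le_ofReal ((conjugate_Phi_le _).trans (le_of_eq ?_))
  rw [div_one, sq_abs]

/-- A sequence converging to `0` fast in norm is dominated in modular and converges a.e. -/
theorem exists_integrable_dominating {w : ℕ → OrliczSpace Phi Ω} {ρ : ℝ} (hρ : 0 < ρ)
    (hw : ∀ n, ‖w n‖ < ρ * (1 / 2) ^ n) :
    ∃ G : Plane → ℝ, Integrable G (volume.restrict Ω) ∧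
      ∀ᵐ x ∂(volume.restrict Ω), (∀ n, Phi.toFun (|(w n).rep x| / ρ) ≤ G x) ∧
        Tendsto (fun n => (w n).rep x) atTop (𝓝 0) := by
  -- At scale `ρ / 2ⁿ` the modular is at most `1`; enlarging the scale to `ρ` gains a factor `2⁻ⁿ`
  -- by convexity. The sum over `n` is then integrable and dominates every term.
  have hm : ∀ n, modular Phi.toFun Ω ρ (w n).rep ≤ ENNReal.ofReal ((1 / 2) ^ n) := fun n => by
    have h1 := (OrliczSpace.mem_lux_of_norm_lt (hw n)).2
    have h2 := modular_scale (A := Phi) (Ω := Ω) (r := ρ * (1 / 2) ^ n) (k := 2 ^ n)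
      (one_le_pow₀ one_le_two) (w n).rep
    have h3 : ρ * (1 / 2) ^ n * 2 ^ n = ρ := by
      rw [mul_assoc, ← mul_pow]; norm_num
    rw [h3] at h2
    refine h2.trans ((mul_le_mul_right h1 _).trans_eq ?_)
    rw [mul_one, one_div, inv_pow]
  have hmeas : ∀ n, AEMeasurable (fun x => ENNReal.ofReal (Phi.toFun (|(w n).rep x| / ρ)))
      (volume.restrict Ω) := fun n => aemeasurable_modular (w n).rep_aemeasurable ρ
  set G : Plane → ℝ≥0∞ := fun x => ∑' n, ENNReal.ofReal (Phi.toFun (|(w n).rep x| / ρ))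
  have hG : ∫⁻ x in Ω, G x ≠ ⊤ := by
    rw [lintegral_tsum hmeas]
    refine ((ENNReal.tsum_le_tsum hm).trans_lt ?_).ne
    rw [← ENNReal.ofReal_tsum_of_nonneg (fun n => by positivity) summable_geometric_two]
    exact ENNReal.ofReal_lt_top
  have hGm : AEMeasurable G (volume.restrict Ω) := AEMeasurable.tsum hmeas
  refine ⟨fun x => (G x).toReal, integrable_toReal_of_lintegral_ne_top hGm hG, ?_⟩
  filter_upwards [ae_lt_top' hGm hG] with x hx
  refine ⟨fun n => ?_, ?_⟩
  · rw [← ENNReal.toReal_ofReal (Phi.nonneg' (|(w n).rep x| / ρ))]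
    exact ENNReal.toReal_mono hx.ne (ENNReal.le_tsum n)
  · have h1 := ENNReal.tendsto_atTop_zero_of_tsum_ne_top hx.ne
    have h2 := (ENNReal.tendsto_toReal ENNReal.zero_ne_top).comp h1
    have h3 : Tendsto (fun n => Phi.toFun (|(w n).rep x| / ρ)) atTop (𝓝 0) := by
      refine h2.congr fun n => ?_
      exact ENNReal.toReal_ofReal (Phi.nonneg' _)
    have h4 : Tendsto (fun n => (w n).rep x ^ 2 / ρ ^ 2) atTop (𝓝 0) :=
      squeeze_zero (fun n => by positivity) (fun n => sq_div_le_Phi _ _) h3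
    have h5 : Tendsto (fun n => (w n).rep x ^ 2) atTop (𝓝 0) := by
      have := h4.mul_const (ρ ^ 2)
      rw [zero_mul] at this
      refine this.congr fun n => ?_
      field_simp
    have h6 := (Real.continuous_sqrt.tendsto 0).comp h5
    rw [Real.sqrt_zero] at h6
    refine (tendsto_zero_iff_abs_tendsto_zero _).2 (h6.congr fun n => ?_)
    exact Real.sqrt_sq_eq_abs _

end SquareIntegrable

/-! ### The integral functional -/

/-- The standing assumptions on the nonlinearity, with the two growth conditions merged into
one for the square of the generalized gradient. -/
structure Admissible (Ω : Set Plane) (f : Plane → ℝ → ℝ) (C r B : ℝ) : Prop where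
  int : ∀ x, LocallyIntegrable (f x) volume
  meas : ∀ t, AEMeasurable (fun x => primitive f x t) volume
  lip : ∀ x, LocallyLipschitz (primitive f x)
  lower : NMeasurable Ω (lowerEnvelope f)
  upper : NMeasurable Ω (upperEnvelope f)
  domain : volume Ω < ⊤ ∨ Ω = univ
  C_nonneg : 0 ≤ C
  r_pos : 0 < r
  B_nonneg : 0 ≤ B
  finite : volume Ω < ⊤ ∨ B = 0
  growth : ∀ x t, ∀ ξ ∈ Icc (lowerEnvelope f x t) (upperEnvelope f x t),
    ξ ^ 2 ≤ C * (Phi.toFun (|t| / r) + B)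

/-- The growth bound for the generalized gradient. -/
def growthBound (C r B t : ℝ) : ℝ := √(C * (Phi.toFun (|t| / r) + B))

namespace Admissible

variable {Ω : Set Plane} {f : Plane → ℝ → ℝ} {C r B : ℝ} (h : Admissible Ω f C r B)
include h

theorem sq_growthBound (t : ℝ) :
    growthBound C r B t ^ 2 = C * (Phi.toFun (|t| / r) + B) :=
  Real.sq_sqrt (mul_nonneg h.C_nonneg (add_nonneg (Phi.nonneg' _) h.B_nonneg))

theorem growthBound_mono {s t : ℝ} (hst : |s| ≤ |t|) :
    growthBound C r B s ≤ growthBound C r B t := by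
  have hr := h.r_pos
  refine Real.sqrt_le_sqrt (mul_le_mul_of_nonneg_left ?_ h.C_nonneg)
  have := Phi.mono (s := |s| / r) (t := |t| / r) (by positivity) (by gcongr)
  linarith

omit h in
theorem _root_.OrliczClarke.growthBound_nonneg (t : ℝ) : 0 ≤ growthBound C r B t :=
  Real.sqrt_nonneg _

omit h in
theorem _root_.OrliczClarke.continuous_growthBound : Continuous (growthBound C r B) := by
  unfold growthBound
  have := Phi.continuous'
  fun_prop

theorem abs_le_growthBound {x : Plane} {t ξ : ℝ}
    (hξ : ξ ∈ Icc (lowerEnvelope f x t) (upperEnvelope f x t)) : |ξ| ≤ growthBound C r B t :=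
  Real.abs_le_sqrt (h.growth x t ξ hξ)

theorem envelope_le (x : Plane) (t : ℝ) : lowerEnvelope f x t ≤ upperEnvelope f x t :=
  lowerEnvelope_le_upperEnvelope (h.int x) (h.lip x) t

/-- Between `a` and `b` the integrand lies a.e. in the envelope interval at a point of modulus at
most `|a| + |b|`, and the growth bound is monotone in the modulus. -/
theorem abs_primitive_sub_le (x : Plane) (a b : ℝ) :
    |primitive f x b - primitive f x a| ≤ |b - a| * growthBound C r B (|a| + |b|) := by
  rw [primitive_sub (h.int x), mul_comm, ← Real.norm_eq_abs]
  refine intervalIntegral.norm_integral_le_of_norm_le_const_ae ?_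
  filter_upwards [ae_mem_Icc_envelope (h.int x) (h.lip x)] with s hs hsm
  refine (h.abs_le_growthBound hs).trans (h.growthBound_mono ?_)
  rw [abs_of_nonneg (by positivity : 0 ≤ |a| + |b|)]
  have h1 := abs_le_max_abs_abs hsm.1.le hsm.2
  refine h1.trans (max_le ?_ ?_)
  · rcases min_choice a b with h' | h' <;> rw [h'] <;> linarith [abs_nonneg a, abs_nonneg b]
  · rcases max_choice a b with h' | h' <;> rw [h'] <;> linarith [abs_nonneg a, abs_nonneg b]

omit h in
theorem _root_.OrliczClarke.primitive_zero (x : Plane) : primitive f x 0 = 0 := by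
  simp [primitive]

/-- The superposition operator of a Carathéodory function preserves measurability. -/
theorem aemeasurable_primitive {u : Plane → ℝ} (hu : AEMeasurable u (volume.restrict Ω)) :
    AEMeasurable (fun x => primitive f x (u x)) (volume.restrict Ω) := by
  have hm : ∀ q : ℚ, AEMeasurable (fun x => primitive f x q) (volume.restrict Ω) :=
    fun q => (h.meas q).mono_measure Measure.restrict_le_self
  have hae : ∀ᵐ x ∂(volume.restrict Ω), ∀ q : ℚ, primitive f x q = (hm q).mk _ x :=
    ae_all_iff.2 fun q => (hm q).ae_eq_mk
  -- Outside one Borel null set all sections at rational `t` agree with Borel representatives.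
  -- Replacing the primitive by `0` on that set makes it continuous in `t` and Borel in `x`, hence
  -- jointly measurable.
  obtain ⟨N, hN1, hN2, hN3⟩ := exists_measurable_superset_of_null (ae_iff.1 hae)
  have hNc : ∀ x, x ∉ N → ∀ q : ℚ, primitive f x q = (hm q).mk _ x := fun x hx => by
    by_contra hcon
    exact hx (hN1 hcon)
  set g : ℝ → Plane → ℝ := fun t => Nᶜ.indicator fun x => primitive f x t
  have hgc : ∀ x, Continuous fun t => g t x := fun x => by
    by_cases hx : x ∈ N
    · have : (fun t => g t x) = fun _ => 0 := by
        funext t; simp [g, hx]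
      rw [this]; exact continuous_const
    · have : (fun t => g t x) = primitive f x := by
        funext t; simp [g, hx]
      rw [this]; exact (h.lip x).continuous
  have hgq : ∀ q : ℚ, Measurable (g q) := fun q => by
    have : g q = Nᶜ.indicator ((hm q).mk _) := by
      funext x
      by_cases hx : x ∈ N
      · simp [g, hx]
      · simp [g, hx, hNc x hx q]
    rw [this]
    exact (hm q).measurable_mk.indicator hN2.compl
  have hgm : ∀ t : ℝ, Measurable (g t) := fun t => by
    obtain ⟨s, hs, hst⟩ := mem_closure_iff_seq_limit.1 (Rat.denseRange_cast (𝕜 := ℝ) t)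
    choose q hq using hs
    refine measurable_of_tendsto_metrizable (fun n => hgq (q n)) (tendsto_pi_nhds.2 fun x => ?_)
    have := ((hgc x).tendsto t).comp hst
    refine this.congr fun n => ?_
    simp [Function.comp, hq]
  have hunc := stronglyMeasurable_uncurry_of_continuous_of_stronglyMeasurable hgc
    fun t => (hgm t).stronglyMeasurable
  have h1 : AEMeasurable (fun x => g (u x) x) (volume.restrict Ω) :=
    hunc.measurable.comp_aemeasurable (hu.prodMk aemeasurable_id)
  refine h1.congr ?_
  filter_upwards [measure_eq_zero_iff_ae_notMem.1 hN3] with x hx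
  simp [g, hx]

theorem modular_lt_top (u : EPhi Ω) {ρ : ℝ} (hρ : 0 < ρ) :
    modular Phi.toFun Ω ρ u.1.rep < ⊤ :=
  (mem_orliczE_iff h.domain u.1).1 u.2 ρ hρ

theorem integrable_growthBound_sq {w : Plane → ℝ} (hw : AEMeasurable w (volume.restrict Ω))
    (hm : modular Phi.toFun Ω r w < ⊤) :
    Integrable (fun x => growthBound C r B (w x) ^ 2) (volume.restrict Ω) := by
  simp_rw [h.sq_growthBound]
  refine Integrable.const_mul (Integrable.add (integrable_of_modular_lt_top hw hm) ?_) C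
  -- The constant `B` is integrable because either `Ω` has finite measure or `B = 0`.
  rcases h.finite with h' | h'
  · have : IsFiniteMeasure ((volume : Measure Plane).restrict Ω) :=
      ⟨by rwa [Measure.restrict_apply_univ]⟩
    exact integrable_const _
  · rw [h']; exact integrable_zero _ _ _

theorem integral_growthBound_sq {w : Plane → ℝ} (hw : AEMeasurable w (volume.restrict Ω))
    (hm : modular Phi.toFun Ω r w < ⊤) :
    ∫ x in Ω, growthBound C r B (w x) ^ 2 =
      C * ((modular Phi.toFun Ω r w).toReal + ∫ _ in Ω, B) := by
  simp_rw [h.sq_growthBound]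
  rw [integral_const_mul, integral_add (integrable_of_modular_lt_top hw hm),
    integral_eq_toReal_modular hw]
  rcases h.finite with h' | h'
  · have : IsFiniteMeasure ((volume : Measure Plane).restrict Ω) :=
      ⟨by rwa [Measure.restrict_apply_univ]⟩
    exact integrable_const _
  · rw [h']; exact integrable_zero _ _ _

theorem memLp_growthBound {w : Plane → ℝ} (hw : AEMeasurable w (volume.restrict Ω))
    (hm : modular Phi.toFun Ω r w < ⊤) :
    MemLp (fun x => growthBound C r B (w x)) 2 (volume.restrict Ω) :=
  (memLp_two_iff_integrable_sq
    (continuous_growthBound.measurable.comp_aemeasurable hw).aestronglyMeasurable).2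
    (h.integrable_growthBound_sq hw hm)

theorem integrable_primitive (u : EPhi Ω) :
    Integrable (fun x => primitive f x (u.1.rep x)) (volume.restrict Ω) := by
  have h1 := u.1.rep_memLp
  have h2 := h.memLp_growthBound u.1.rep_aemeasurable (h.modular_lt_top u h.r_pos)
  refine (h1.integrable_mul h2).mono
    (h.aemeasurable_primitive u.1.rep_aemeasurable).aestronglyMeasurable
    (Eventually.of_forall fun x => ?_)
  have := h.abs_primitive_sub_le x 0 (u.1.rep x)
  rw [primitive_zero, sub_zero, sub_zero, abs_zero, zero_add] at this
  rw [Real.norm_eq_abs, Pi.mul_apply, norm_mul, Real.norm_eq_abs, Real.norm_eq_abs]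
  refine this.trans (mul_le_mul_of_nonneg_left ?_ (abs_nonneg _))
  exact (h.growthBound_mono (by rw [abs_abs])).trans (le_abs_self _)

/-- Since `|v| + |w| ≤ 2|u| + (|v - u| + |w - u|)`, convexity assigns scale `r / 2` to each summand
and then `r / 4` to each difference. This fixes the radius `r / 4` and makes the bound depend on `u`
alone. -/
theorem modular_near (u : EPhi Ω) {v w : EPhi Ω} (hv : ‖v - u‖ < r / 4) (hw : ‖w - u‖ < r / 4) :
    modular Phi.toFun Ω r (fun x => |v.1.rep x| + |w.1.rep x|) ≤
      modular Phi.toFun Ω (r / 2) (fun x => 2 * |u.1.rep x|) + 1 := by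
  have hr := h.r_pos
  have hr4 : 0 < r / 4 := by positivity
  have hr2 : 0 < r / 2 := by positivity
  have m1 := (OrliczSpace.mem_lux_of_norm_lt hv).2
  have m2 := (OrliczSpace.mem_lux_of_norm_lt hw).2
  have habs : ∀ (ρ : ℝ) (g : Plane → ℝ),
      modular Phi.toFun Ω ρ (fun x => |g x|) = modular Phi.toFun Ω ρ g := fun ρ g => by
    simp [modular]
  have hcoe : ∀ ρ : ℝ, 0 < ρ → ENNReal.ofReal (ρ / (ρ + ρ)) ≤ 1 := fun ρ hρ => by
    rw [ENNReal.ofReal_le_one, div_le_one (by positivity)]; linarith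
  have a1 := modular_add (A := Phi) (Ω := Ω) hr4 hr4 (u := fun x => |(v - u).1.rep x|)
    (v := fun x => |(w - u).1.rep x|) (v - u).1.rep_aemeasurable.abs
  have e1 : ENNReal.ofReal (r / 4 / (r / 4 + r / 4)) + ENNReal.ofReal (r / 4 / (r / 4 + r / 4))
      = 1 := by
    rw [← ENNReal.ofReal_add (by positivity) (by positivity), ← add_div, div_self (by positivity),
      ENNReal.ofReal_one]
  have a2 : modular Phi.toFun Ω (r / 4 + r / 4)
      (fun x => |(v - u).1.rep x| + |(w - u).1.rep x|) ≤ 1 := by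
    refine a1.trans ?_
    rw [habs, habs]
    refine (add_le_add (mul_le_mul_right m1 _) (mul_le_mul_right m2 _)).trans ?_
    rw [mul_one, e1]
  rw [show r / 4 + r / 4 = r / 2 by ring] at a2
  have a3 := modular_add (A := Phi) (Ω := Ω) hr2 hr2 (u := fun x => 2 * |u.1.rep x|)
    (v := fun x => |(v - u).1.rep x| + |(w - u).1.rep x|) (u.1.rep_aemeasurable.abs.const_mul 2)
  rw [add_halves] at a3
  refine (modular_mono hr ?_).trans (a3.trans ?_)
  · filter_upwards [OrliczSpace.rep_sub v.1 u.1, OrliczSpace.rep_sub w.1 u.1] with x h1 h2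
    refine abs_le_abs_of_nonneg (by positivity) ?_
    change _ ≤ 2 * |u.1.rep x| + (|(v.1 - u.1).rep x| + |(w.1 - u.1).rep x|)
    rw [h1, h2]
    linarith [abs_sub_abs_le_abs_sub (v.1.rep x) (u.1.rep x),
      abs_sub_abs_le_abs_sub (w.1.rep x) (u.1.rep x)]
  · have hc : ENNReal.ofReal (r / 2 / r) ≤ 1 := by
      rw [ENNReal.ofReal_le_one, div_le_one (by positivity)]; linarith
    exact add_le_add (mul_le_of_le_one_left zero_le hc)
      ((mul_le_of_le_one_left zero_le hc).trans a2)

theorem modular_two_mul_lt_top (u : EPhi Ω) {ρ : ℝ} (hρ : 0 < ρ) :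
    modular Phi.toFun Ω ρ (fun x => 2 * |u.1.rep x|) < ⊤ := by
  have e : modular Phi.toFun Ω ρ (fun x => 2 * |u.1.rep x|) =
      modular Phi.toFun Ω ρ (fun x => 2 * u.1.rep x) := by
    simp [modular, abs_mul]
  have := modular_smul (A := Phi) (Ω := Ω) (two_ne_zero (α := ℝ)) (ρ / 2) u.1.rep
  rw [show |(2 : ℝ)| * (ρ / 2) = ρ by rw [abs_two]; ring] at this
  rw [e, this]
  exact h.modular_lt_top u (half_pos hρ)

/-- `Ψ` is locally Lipschitz for the norm of `L²(Ω)`. -/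
theorem exists_abs_Psi_sub_le (u : EPhi Ω) :
    ∃ K : ℝ, 0 ≤ K ∧ ∀ v w : EPhi Ω, ‖v - u‖ < r / 4 → ‖w - u‖ < r / 4 →
      |Psi Ω f v - Psi Ω f w| ≤ K * ‖toL2 Ω (v - w).1‖ := by
  set M := modular Phi.toFun Ω (r / 2) (fun x => 2 * |u.1.rep x|) + 1
  have hM : M < ⊤ := ENNReal.add_lt_top.2
    ⟨h.modular_two_mul_lt_top u (half_pos h.r_pos), ENNReal.one_lt_top⟩
  refine ⟨√(C * (M.toReal + ∫ _ in Ω, B)), Real.sqrt_nonneg _, fun v w hv hw => ?_⟩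
  have hm := h.modular_near u hw hv
  have hmeas : AEMeasurable (fun x => |w.1.rep x| + |v.1.rep x|) (volume.restrict Ω) :=
    w.1.rep_aemeasurable.abs.add v.1.rep_aemeasurable.abs
  have hlt := hm.trans_lt hM
  have hd := (v - w).1.rep_memLp
  have hg := h.memLp_growthBound hmeas hlt
  have hint := hd.integrable_mul hg
  unfold Psi energy
  rw [← integral_sub (h.integrable_primitive v) (h.integrable_primitive w)]
  have h1 : |∫ x in Ω, (primitive f x (v.1.rep x) - primitive f x (w.1.rep x))| ≤
      ∫ x in Ω, |(v - w).1.rep x| * |growthBound C r B (|w.1.rep x| + |v.1.rep x|)| := by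
    refine (norm_integral_le_integral_norm _).trans (integral_mono_ae
      ((h.integrable_primitive v).sub (h.integrable_primitive w)).norm ?_ ?_)
    · refine hint.norm.congr (Eventually.of_forall fun x => ?_)
      simp
    · filter_upwards [OrliczSpace.rep_sub v.1 w.1] with x hx
      change _ ≤ |(v.1 - w.1).rep x| * _
      rw [hx, abs_of_nonneg (growthBound_nonneg _), Real.norm_eq_abs]
      exact h.abs_primitive_sub_le x _ _
  -- Cauchy-Schwarz separates the increment from the growth bound, whose L² norm is controlled
  -- uniformly by `modular_near`.
  refine h1.trans ((integral_abs_mul_le hd hg).trans ?_)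
  rw [mul_comm, norm_toL2_eq_sqrt]
  refine mul_le_mul_of_nonneg_right (Real.sqrt_le_sqrt ?_) (Real.sqrt_nonneg _)
  rw [h.integral_growthBound_sq hmeas hlt]
  refine mul_le_mul_of_nonneg_left ?_ h.C_nonneg
  have := ENNReal.toReal_mono hM.ne hm
  linarith

theorem locallyLipschitz_Psi : LocallyLipschitz (Psi Ω f) := by
  intro u
  obtain ⟨K, hK, hL⟩ := h.exists_abs_Psi_sub_le u
  have hr := h.r_pos
  refine ⟨⟨K, hK⟩, Metric.ball u (r / 4), Metric.ball_mem_nhds u (by positivity), ?_⟩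
  refine LipschitzOnWith.of_dist_le_mul fun v hv w hw => ?_
  rw [Metric.mem_ball, dist_eq_norm] at hv hw
  rw [Real.dist_eq, dist_eq_norm]
  exact (hL v w hv hw).trans (mul_le_mul_of_nonneg_left (norm_toL2_le _) hK)

/-- The L² Lipschitz estimate for `Psi` passes to its generalized derivative. Functionals in the
gradient are thus continuous for a norm weaker than the Luxemburg norm, which is the reason they
have L² densities. -/
theorem exists_clarkeGradient_le_toL2 (u : EPhi Ω) :
    ∃ K : ℝ, 0 ≤ K ∧ ∀ ξ ∈ clarkeGradient (Psi Ω f) u, ∀ v : EPhi Ω, ξ v ≤ K * ‖toL2 Ω v.1‖ := by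
  obtain ⟨K, hK, hL⟩ := h.exists_abs_Psi_sub_le u
  refine ⟨K, hK, fun ξ hξ v => ?_⟩
  have hr := h.r_pos
  have := clarkeDeriv_le_of_eventually_sub_le (g := Psi Ω f) (x := u)
    (q := fun v : EPhi Ω => K * ‖toL2 Ω v.1‖) (fun c hc v => ?_) ?_ v
  · rw [← EReal.coe_le_coe_iff]
    exact (hξ v).trans this
  · have : toL2 Ω (c • v).1 = c • toL2 Ω v.1 := (toL2 Ω).map_smul c v.1
    rw [this, norm_smul, Real.norm_of_nonneg hc.le]
    ring
  · filter_upwards [prod_mem_prod (Metric.ball_mem_nhds u (show 0 < r / 4 by positivity))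
      (Metric.ball_mem_nhds u (show 0 < r / 4 by positivity))] with z hz
    have h1 := hz.1
    have h2 := hz.2
    rw [Metric.mem_ball, dist_eq_norm] at h1 h2
    exact (le_abs_self _).trans (hL _ _ h1 h2)

end Admissible

/-! ### Generalized gradient of the integral functional -/

namespace Admissible

variable {Ω : Set Plane} {f : Plane → ℝ → ℝ} {C r B : ℝ} (h : Admissible Ω f C r B)
include h

/-- If `m` is the largest of the three numbers, then `2a + 2b + c ≤ 6m`, and `Φ(6m / r)` is one of
the summands. It is applied to `|y| + |y + s v| ≤ 2|u| + 2|w| + |v|` with `y = u + w`. -/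
theorem Phi_add_three_div_le {a b c : ℝ} (ha : 0 ≤ a) (hb : 0 ≤ b) (hc : 0 ≤ c) :
    Phi.toFun ((2 * a + 2 * b + c) / r) ≤
      Phi.toFun (a / (r / 6)) + Phi.toFun (b / (r / 6)) + Phi.toFun (c / (r / 6)) := by
  have hr := h.r_pos
  have p1 := Phi.nonneg' (a / (r / 6))
  have p2 := Phi.nonneg' (b / (r / 6))
  have p3 := Phi.nonneg' (c / (r / 6))
  have key : ∀ m : ℝ, a ≤ m → b ≤ m → c ≤ m →
      Phi.toFun ((2 * a + 2 * b + c) / r) ≤ Phi.toFun (m / (r / 6)) := fun m h1 h2 h3 => by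
    refine Phi.mono (by positivity) ?_
    rw [div_div_eq_mul_div]
    exact div_le_div_of_nonneg_right (by linarith) hr.le
  rcases le_total a b with hab | hab
  · rcases le_total b c with hbc | hbc
    · linarith [key c (hab.trans hbc) hbc le_rfl]
    · linarith [key b hab le_rfl hbc]
  · rcases le_total a c with hac | hac
    · linarith [key c hac (hab.trans hac) le_rfl]
    · linarith [key a le_rfl hab hac]

theorem mul_growthBound_le (a t : ℝ) :
    |a| * growthBound C r B t ≤ a ^ 2 + C * (Phi.toFun (|t| / r) + B) := by
  rw [← h.sq_growthBound t]
  nlinarith [sq_nonneg (|a| - growthBound C r B t), sq_abs a, sq_nonneg a,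
    sq_nonneg (growthBound C r B t)]

theorem abs_envelope_max_le (x : Plane) (t a : ℝ) :
    |max (upperEnvelope f x t * a) (lowerEnvelope f x t * a)| ≤ |a| * growthBound C r B t := by
  have hle := h.envelope_le x t
  rcases max_choice (upperEnvelope f x t * a) (lowerEnvelope f x t * a) with h' | h' <;>
    rw [h', abs_mul, mul_comm] <;> refine mul_le_mul_of_nonneg_left ?_ (abs_nonneg a)
  · exact h.abs_le_growthBound (right_mem_Icc.2 hle)
  · exact h.abs_le_growthBound (left_mem_Icc.2 hle)

theorem integrable_const_restrict : Integrable (fun _ => B) (volume.restrict Ω) := by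
  rcases h.finite with h' | h'
  · have : IsFiniteMeasure ((volume : Measure Plane).restrict Ω) :=
      ⟨by rwa [Measure.restrict_apply_univ]⟩
    exact integrable_const _
  · rw [h']; exact integrable_zero _ _ _

theorem integrable_Phi (u : EPhi Ω) {ρ : ℝ} (hρ : 0 < ρ) :
    Integrable (fun x => Phi.toFun (|u.1.rep x| / ρ)) (volume.restrict Ω) :=
  integrable_of_modular_lt_top u.1.rep_aemeasurable (h.modular_lt_top u hρ)

theorem aemeasurable_envelope_max (u v : EPhi Ω) :
    AEMeasurable (fun x => max (upperEnvelope f x (u.1.rep x) * v.1.rep x)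
      (lowerEnvelope f x (u.1.rep x) * v.1.rep x)) (volume.restrict Ω) :=
  ((h.upper _ u.1.rep_aemeasurable).mul v.1.rep_aemeasurable).max
    ((h.lower _ u.1.rep_aemeasurable).mul v.1.rep_aemeasurable)

theorem integrable_envelope_max (u v : EPhi Ω) :
    Integrable (fun x => max (upperEnvelope f x (u.1.rep x) * v.1.rep x)
      (lowerEnvelope f x (u.1.rep x) * v.1.rep x)) (volume.restrict Ω) := by
  refine Integrable.mono' (g := fun x => v.1.rep x ^ 2 +
      C * (Phi.toFun (|u.1.rep x| / r) + B)) ?_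
    (h.aemeasurable_envelope_max u v).aestronglyMeasurable (Eventually.of_forall fun x => ?_)
  · exact ((memLp_two_iff_integrable_sq v.1.rep_memLp.1).1 v.1.rep_memLp).add
      (((h.integrable_Phi u h.r_pos).add h.integrable_const_restrict).const_mul C)
  · exact (h.abs_envelope_max_le x _ _).trans (h.mul_growthBound_le _ _)

theorem abs_quotient_le (x : Plane) {y w u v s : ℝ} (hy : y = u + w) (hs : 0 < s) (hs1 : s ≤ 1) :
    |(primitive f x (y + s * v) - primitive f x y) / s| ≤
      v ^ 2 + C * ((Phi.toFun (|u| / (r / 6)) + Phi.toFun (|w| / (r / 6)) +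
        Phi.toFun (|v| / (r / 6))) + B) := by
  have h1 := h.abs_primitive_sub_le x y (y + s * v)
  have h2 : |y| + |y + s * v| ≤ 2 * |u| + 2 * |w| + |v| := by
    have a1 : |y| ≤ |u| + |w| := hy ▸ abs_add_le u w
    have a2 : |y + s * v| ≤ |y| + |v| := (abs_add_le _ _).trans (by
      rw [abs_mul, abs_of_pos hs]
      linarith [mul_le_of_le_one_left (abs_nonneg v) hs1])
    linarith
  have h0 : 0 ≤ 2 * |u| + 2 * |w| + |v| := by positivity
  have h3 : growthBound C r B (|y| + |y + s * v|) ≤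
      growthBound C r B (2 * |u| + 2 * |w| + |v|) :=
    h.growthBound_mono (abs_le_abs_of_nonneg (by positivity) h2)
  rw [abs_div, abs_of_pos hs, div_le_iff₀ hs]
  rw [add_sub_cancel_left, abs_mul, abs_of_pos hs] at h1
  have h4 := h.mul_growthBound_le v (2 * |u| + 2 * |w| + |v|)
  rw [abs_of_nonneg h0] at h4
  have h5 := h.Phi_add_three_div_le (abs_nonneg u) (abs_nonneg w) (abs_nonneg v)
  have h6 := mul_le_mul_of_nonneg_left (add_le_add_left h5 B) h.C_nonneg
  have h7 := mul_le_mul_of_nonneg_left h3 (abs_nonneg v)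
  calc _ ≤ s * |v| * growthBound C r B (|y| + |y + s * v|) := h1
    _ = (|v| * growthBound C r B (|y| + |y + s * v|)) * s := by ring
    _ ≤ _ := mul_le_mul_of_nonneg_right (h7.trans (h4.trans (by linarith))) hs.le

/-- If the bound failed by `ε`, there would be base points tending to `u` and steps tending to `0`
whose quotients exceed the right side by `ε`. Pointwise, the limsup of the quotients of the
primitive is at most the integrand on the right, and a dominated limit gives a contradiction. -/
theorem clarkeDeriv_Psi_le (u v : EPhi Ω) :
    clarkeDeriv (Psi Ω f) u v ≤
      ((∫ x in Ω, max (upperEnvelope f x (u.1.rep x) * v.1.rep x)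
        (lowerEnvelope f x (u.1.rep x) * v.1.rep x) : ℝ) : EReal) := by
  set b : Plane → ℝ := fun x => max (upperEnvelope f x (u.1.rep x) * v.1.rep x)
    (lowerEnvelope f x (u.1.rep x) * v.1.rep x)
  have hb : Integrable b (volume.restrict Ω) := h.integrable_envelope_max u v
  have hr := h.r_pos
  rw [clarkeDeriv_le_coe_iff]
  intro ε hε
  by_contra hcon
  rw [not_eventually] at hcon
  -- The rate `r / 6 * 2⁻ⁿ` is that required by `exists_integrable_dominating`; it yields a single
  -- integrable majorant and a.e. convergence without passing to subsequences.
  have hpick : ∀ n : ℕ, ∃ p : EPhi Ω × ℝ,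
      (¬(Psi Ω f (p.1 + p.2 • v) - Psi Ω f p.1) / p.2 ≤ (∫ x in Ω, b x) + ε) ∧
      ‖p.1 - u‖ < r / 6 * (1 / 2) ^ n ∧ p.2 ∈ Ioo (0 : ℝ) (1 / ((n : ℝ) + 1)) := fun n => by
    refine (hcon.and_eventually (Filter.Eventually.and ?_ ?_)).exists
    · filter_upwards [tendsto_fst.eventually (Metric.ball_mem_nhds u
        (show 0 < r / 6 * (1 / 2) ^ n by positivity))] with p hp
      rwa [← dist_eq_norm]
    · exact tendsto_snd.eventually (Ioo_mem_nhdsGT (by positivity))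
  choose p hp1 hp2 hp3 using hpick
  obtain ⟨G, hG, hGae⟩ := exists_integrable_dominating (Ω := Ω) (w := fun n => (p n).1.1 - u.1)
    (show 0 < r / 6 by positivity) hp2
  have hs0 : ∀ n, 0 < (p n).2 := fun n => (hp3 n).1
  have hs1 : ∀ n, (p n).2 ≤ 1 := fun n => (hp3 n).2.le.trans (by
    rw [div_le_one (by positivity)]; linarith [(Nat.cast_nonneg n : (0 : ℝ) ≤ n)])
  have hst : Tendsto (fun n => (p n).2) atTop (𝓝[>] 0) :=
    tendsto_nhdsWithin_iff.2 ⟨squeeze_zero (fun n => (hs0 n).le) (fun n => (hp3 n).2.le)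
      tendsto_one_div_add_atTop_nhds_zero_nat, Eventually.of_forall hs0⟩
  set q : ℕ → Plane → ℝ := fun n x =>
    (primitive f x (((p n).1 + (p n).2 • v).1.rep x) - primitive f x ((p n).1.1.rep x)) / (p n).2
  have hq : ∀ n, Integrable (q n) (volume.restrict Ω) := fun n =>
    ((h.integrable_primitive _).sub (h.integrable_primitive _)).div_const _
  have hqint : ∀ n, (∫ x in Ω, b x) + ε < ∫ x in Ω, q n x := fun n => by
    have : ∫ x in Ω, q n x = (Psi Ω f ((p n).1 + (p n).2 • v) - Psi Ω f (p n).1) / (p n).2 := by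
      rw [integral_div, integral_sub (h.integrable_primitive _) (h.integrable_primitive _)]
      rfl
    rw [this]
    exact not_le.1 (hp1 n)
  have hrep : ∀ᵐ x ∂(volume.restrict Ω), ∀ n,
      ((p n).1 + (p n).2 • v).1.rep x = (p n).1.1.rep x + (p n).2 * v.1.rep x ∧
      ((p n).1.1 - u.1).rep x = (p n).1.1.rep x - u.1.rep x := by
    rw [ae_all_iff]
    intro n
    filter_upwards [OrliczSpace.rep_add (p n).1.1 ((p n).2 • v.1),
      OrliczSpace.rep_smul (p n).2 v.1, OrliczSpace.rep_sub (p n).1.1 u.1] with x h1 h2 h3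
    refine ⟨?_, h3⟩
    change ((p n).1.1 + (p n).2 • v.1).rep x = _
    rw [h1, h2]
  set D : Plane → ℝ := fun x => v.1.rep x ^ 2 + C * ((Phi.toFun (|u.1.rep x| / (r / 6)) + G x +
    Phi.toFun (|v.1.rep x| / (r / 6))) + B)
  have hD : Integrable D (volume.restrict Ω) :=
    ((memLp_two_iff_integrable_sq v.1.rep_memLp.1).1 v.1.rep_memLp).add
      (((((h.integrable_Phi u (by positivity)).add hG).add
        (h.integrable_Phi v (by positivity))).add h.integrable_const_restrict).const_mul C)
  -- The quotients need not converge, but their excess over `b` does tend to `0`; taking positive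
  -- parts turns the limsup inequality into a dominated limit.
  have hlim : Tendsto (fun n => ∫ x in Ω, max (q n x - b x) 0) atTop (𝓝 (∫ _ in Ω, (0 : ℝ))) := by
    refine tendsto_integral_of_dominated_convergence (fun x => D x + |b x|)
      (fun n => (((hq n).sub hb).sup (integrable_zero _ _ _)).1) (hD.add hb.abs)
      (fun n => ?_) ?_
    · filter_upwards [hrep, hGae] with x h1 h2
      have h3 := h.abs_quotient_le x (y := (p n).1.1.rep x) (w := ((p n).1.1 - u.1).rep x)
        (u := u.1.rep x) (v := v.1.rep x) (by rw [(h1 n).2]; ring) (hs0 n) (hs1 n)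
      have h4 : |q n x| ≤ D x := by
        simp only [q, (h1 n).1]
        refine h3.trans ?_
        have := mul_le_mul_of_nonneg_left (h2.1 n) h.C_nonneg
        simp only [D]
        nlinarith
      rw [Real.norm_of_nonneg (le_max_right _ _)]
      refine max_le ?_ ((abs_nonneg _).trans (h4.trans (le_add_of_nonneg_right (abs_nonneg _))))
      linarith [le_abs_self (q n x), neg_abs_le (b x)]
    · filter_upwards [hrep, hGae] with x h1 h2
      have hy : Tendsto (fun n => (p n).1.1.rep x) atTop (𝓝 (u.1.rep x)) := by
        have := h2.2.add_const (u.1.rep x)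
        rw [zero_add] at this
        refine this.congr fun n => ?_
        rw [(h1 n).2]; ring
      refine tendsto_order.2 ⟨fun a ha => Eventually.of_forall fun n =>
        ha.trans_le (le_max_right _ _), fun a ha => ?_⟩
      have hev := (hy.prodMk hst).eventually (eventually_primitive_quotient_le (h.int x) (h.lip x)
        (u.1.rep x) (v.1.rep x) (half_pos ha))
      filter_upwards [hev] with n hn
      simp only [q, (h1 n).1]
      refine max_lt ?_ ha
      simp only [b]
      linarith
  rw [integral_zero] at hlim
  obtain ⟨n, hn⟩ := (hlim.eventually (gt_mem_nhds hε)).exists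
  have hP : Integrable (fun x => max (q n x - b x) 0) (volume.restrict Ω) :=
    ((hq n).sub hb).sup (integrable_zero _ _ _)
  have h1 : ∫ x in Ω, q n x ≤ ∫ x in Ω, (b x + max (q n x - b x) 0) :=
    integral_mono (hq n) (hb.add hP) fun x => by
      dsimp only
      linarith [le_max_left (q n x - b x) 0]
  rw [integral_add hb hP] at h1
  linarith [hqint n]

/-- The class of the indicator function of a set of finite measure. -/
theorem exists_rep_eq_indicator {S : Set Plane} (hS : MeasurableSet S)
    (hfin : volume (S ∩ Ω) < ⊤) :
    ∃ v : EPhi Ω, v.1.rep =ᵐ[volume.restrict Ω] S.indicator fun _ => 1 := by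
  have hm : AEMeasurable (S.indicator fun _ : Plane => (1 : ℝ)) (volume.restrict Ω) :=
    (measurable_const.indicator hS).aemeasurable
  have hmem : MemOrlicz Phi.toFun Ω (S.indicator fun _ => 1) :=
    ⟨locallyIntegrableOn_of_bounded (C := 1) hm (Eventually.of_forall fun x => by
      by_cases hx : x ∈ S <;> simp [hx]), 1, one_pos, modular_indicator_lt_top hS hfin 1 1⟩
  refine ⟨⟨OrliczSpace.ofFun _ hm hmem, ?_⟩, OrliczSpace.rep_ofFun hm hmem⟩
  rw [EPhi, mem_orliczE_iff h.domain]
  intro ρ hρ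
  rw [modular_congr (OrliczSpace.rep_ofFun hm hmem)]
  exact modular_indicator_lt_top hS hfin 1 ρ

theorem memLp_envelope (u : EPhi Ω) :
    MemLp (fun x => upperEnvelope f x (u.1.rep x)) 2 (volume.restrict Ω) ∧
      MemLp (fun x => lowerEnvelope f x (u.1.rep x)) 2 (volume.restrict Ω) := by
  have hg := h.memLp_growthBound u.1.rep_aemeasurable (h.modular_lt_top u h.r_pos)
  constructor
  · refine hg.mono (h.upper _ u.1.rep_aemeasurable).aestronglyMeasurable
      (Eventually.of_forall fun x => ?_)
    rw [Real.norm_eq_abs, Real.norm_of_nonneg (growthBound_nonneg _)]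
    exact h.abs_le_growthBound (right_mem_Icc.2 (h.envelope_le _ _))
  · refine hg.mono (h.lower _ u.1.rep_aemeasurable).aestronglyMeasurable
      (Eventually.of_forall fun x => ?_)
    rw [Real.norm_eq_abs, Real.norm_of_nonneg (growthBound_nonneg _)]
    exact h.abs_le_growthBound (left_mem_Icc.2 (h.envelope_le _ _))

/-- Hahn-Banach extends `ξ` from the image of `EPhi Ω` in L² to all of L² under the bound `K * ‖·‖`,
after which the Riesz representation theorem applies. -/
theorem exists_density {u : EPhi Ω} {ξ : StrongDual ℝ (EPhi Ω)}
    (hξ : ξ ∈ clarkeGradient (Psi Ω f) u) :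
    ∃ η : Plane → ℝ, MemLp η 2 (volume.restrict Ω) ∧
      ∀ v : EPhi Ω, ξ v = ∫ x in Ω, η x * v.1.rep x := by
  obtain ⟨K, hK, hle⟩ := h.exists_clarkeGradient_le_toL2 u
  obtain ⟨g, hg1, hg2⟩ := exists_linearMap_comp_eq_of_le_sublinear
    ((toL2 Ω).comp (EPhi Ω).subtype) (ξ : EPhi Ω →ₗ[ℝ] ℝ) (fun z => K * ‖z‖)
    (fun c hc z => by rw [norm_smul, Real.norm_of_nonneg hc.le]; ring)
    (fun z w => by
      rw [← mul_add]; exact mul_le_mul_of_nonneg_left (norm_add_le z w) hK)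
    (fun v => hle ξ hξ v)
  have hb : ∀ z, ‖g z‖ ≤ K * ‖z‖ := fun z => abs_le.2 ⟨by
    have := hg2 (-z)
    rw [map_neg, norm_neg] at this
    linarith, hg2 z⟩
  set η := (InnerProductSpace.toDual ℝ (Lp ℝ 2 ((volume : Measure Plane).restrict Ω))).symm
    (g.mkContinuous K hb)
  refine ⟨η, Lp.memLp η, fun v => ?_⟩
  have h1 : ξ v = inner ℝ η (toL2 Ω v.1) := by
    rw [InnerProductSpace.toDual_symm_apply]
    exact (hg1 v).symm
  rw [h1, L2.inner_def]
  refine integral_congr_ae ?_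
  filter_upwards [coeFn_toL2 v.1] with x hx
  rw [hx]
  simp [mul_comm]

omit h in
theorem integrableOn_of_memLp_two {g : Plane → ℝ} (hg : MemLp g 2 (volume.restrict Ω))
    {S : Set Plane} (hfin : (volume.restrict Ω) S < ⊤) : IntegrableOn g S (volume.restrict Ω) := by
  have : IsFiniteMeasure (((volume : Measure Plane).restrict Ω).restrict S) :=
    ⟨by rwa [Measure.restrict_apply_univ]⟩
  exact (hg.mono_measure Measure.restrict_le_self).integrable one_le_two

/-- Testing `clarkeDeriv_Psi_le` with the indicator of `S` gives `∫_S η ≤ ∫_S f̄(x,u)`, and with its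
negative `∫_S η ≥ ∫_S f̲(x,u)`. As `S` is an arbitrary measurable set of finite measure, the
inequalities hold pointwise a.e. -/
theorem density_mem_Icc {u : EPhi Ω} {ξ : StrongDual ℝ (EPhi Ω)}
    (hξ : ξ ∈ clarkeGradient (Psi Ω f) u) {η : Plane → ℝ} (hη : MemLp η 2 (volume.restrict Ω))
    (hξη : ∀ v : EPhi Ω, ξ v = ∫ x in Ω, η x * v.1.rep x) :
    ∀ᵐ x ∂(volume.restrict Ω),
      η x ∈ Icc (lowerEnvelope f x (u.1.rep x)) (upperEnvelope f x (u.1.rep x)) := by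
  obtain ⟨hup, hlo⟩ := h.memLp_envelope u
  have key : ∀ S : Set Plane, MeasurableSet S → (volume.restrict Ω) S < ⊤ →
      (∫ x in S, lowerEnvelope f x (u.1.rep x) ∂(volume.restrict Ω)) ≤
        ∫ x in S, η x ∂(volume.restrict Ω) ∧
      (∫ x in S, η x ∂(volume.restrict Ω)) ≤
        ∫ x in S, upperEnvelope f x (u.1.rep x) ∂(volume.restrict Ω) := by
    intro S hS hfin
    rw [Measure.restrict_apply hS] at hfin
    obtain ⟨v, hv⟩ := h.exists_rep_eq_indicator hS hfin
    have hvS : ξ v = ∫ x in S, η x ∂(volume.restrict Ω) := by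
      rw [hξη v, ← integral_indicator hS]
      refine integral_congr_ae ?_
      filter_upwards [hv] with x hx
      rw [hx]
      by_cases hxS : x ∈ S <;> simp [hxS]
    have h1 := (hξ v).trans (h.clarkeDeriv_Psi_le u v)
    have h2 := (hξ (-v)).trans (h.clarkeDeriv_Psi_le u (-v))
    rw [EReal.coe_le_coe_iff] at h1 h2
    rw [map_neg] at h2
    have e1 : ∫ x in Ω, max (upperEnvelope f x (u.1.rep x) * v.1.rep x)
        (lowerEnvelope f x (u.1.rep x) * v.1.rep x) =
        ∫ x in S, upperEnvelope f x (u.1.rep x) ∂(volume.restrict Ω) := by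
      rw [← integral_indicator hS]
      refine integral_congr_ae ?_
      filter_upwards [hv] with x hx
      rw [hx]
      by_cases hxS : x ∈ S <;> simp [hxS, h.envelope_le]
    have e2 : ∫ x in Ω, max (upperEnvelope f x (u.1.rep x) * (-v).1.rep x)
        (lowerEnvelope f x (u.1.rep x) * (-v).1.rep x) =
        -∫ x in S, lowerEnvelope f x (u.1.rep x) ∂(volume.restrict Ω) := by
      rw [← integral_indicator hS, ← integral_neg]
      refine integral_congr_ae ?_
      have hneg := OrliczSpace.rep_smul (-1) v.1
      rw [neg_one_smul] at hneg
      filter_upwards [hv, hneg] with x hx hx'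
      change max (_ * (-v.1).rep x) (_ * (-v.1).rep x) = _
      rw [hx', hx]
      by_cases hxS : x ∈ S <;> simp [hxS, h.envelope_le]
    rw [e1] at h1
    rw [e2] at h2
    exact ⟨by linarith, by linarith⟩
  have hI := fun {g : Plane → ℝ} (hg : MemLp g 2 (volume.restrict Ω)) (S : Set Plane)
    (hS : (volume.restrict Ω) S < ⊤) => integrableOn_of_memLp_two hg hS
  have a1 := ae_nonneg_of_forall_setIntegral_nonneg_of_sigmaFinite
    (μ := volume.restrict Ω) (f := fun x => η x - lowerEnvelope f x (u.1.rep x))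
    (fun S _ hS => hI (hη.sub hlo) S hS) (fun S hS hfin => by
      rw [integral_sub (hI hη S hfin) (hI hlo S hfin)]
      linarith [(key S hS hfin).1])
  have a2 := ae_nonneg_of_forall_setIntegral_nonneg_of_sigmaFinite
    (μ := volume.restrict Ω) (f := fun x => upperEnvelope f x (u.1.rep x) - η x)
    (fun S _ hS => hI (hup.sub hη) S hS) (fun S hS hfin => by
      rw [integral_sub (hI hup S hfin) (hI hη S hfin)]
      linarith [(key S hS hfin).2])
  filter_upwards [a1, a2] with x h1 h2
  simp only [Pi.zero_apply, sub_nonneg] at h1 h2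
  exact ⟨h1, h2⟩

end Admissible

/-! ### Truncated Riesz potentials in the plane -/

section Riesz

/-- The Cauchy-Schwarz inequality for the lower Lebesgue integral. -/
theorem lintegral_mul_sq_le {α : Type*} [MeasurableSpace α] (μ : Measure α) {a b : α → ℝ≥0∞}
    (ha : AEMeasurable a μ) (hb : AEMeasurable b μ) :
    (∫⁻ x, a x * b x ∂μ) ^ 2 ≤ (∫⁻ x, a x ^ 2 ∂μ) * ∫⁻ x, b x ^ 2 ∂μ := by
  have h := ENNReal.lintegral_mul_le_Lp_mul_Lq μ Real.HolderConjugate.two_two ha hb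
  simp only [ENNReal.rpow_ofNat, Pi.mul_apply] at h
  refine (pow_le_pow_left₀ zero_le h 2).trans_eq ?_
  rw [mul_pow, ← ENNReal.rpow_natCast, ← ENNReal.rpow_natCast, ← ENNReal.rpow_mul,
    ← ENNReal.rpow_mul]
  norm_num

/-- The area of the unit disc. -/
def discArea : ℝ := (volume : Measure Plane).real (Metric.ball 0 1)

theorem discArea_pos : 0 < discArea :=
  ENNReal.toReal_pos (Metric.measure_ball_pos volume _ one_pos).ne' measure_ball_lt_top.ne

theorem finrank_plane : Module.finrank ℝ Plane = 2 := by simp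

/-- The kernel `1 / |w|` on the annulus `a ≤ |w| < b`. -/
def annulusKernel (a b : ℝ) (w : Plane) : ℝ≥0∞ :=
  ENNReal.ofReal ((Ico a b).indicator (fun t => t⁻¹) ‖w‖)

theorem measurable_annulusKernel (a b : ℝ) : Measurable (annulusKernel a b) :=
  ENNReal.measurable_ofReal.comp
    ((measurable_inv.indicator measurableSet_Ico).comp measurable_norm)

theorem measurable_annulusKernel_sub (a b : ℝ) (x : Plane) :
    Measurable fun y => annulusKernel a b (y - x) :=
  (measurable_annulusKernel a b).comp (measurable_id.sub_const x)

theorem lintegral_annulusKernel_zero {ε : ℝ} (hε : 0 < ε) :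
    ∫⁻ w, annulusKernel 0 ε w = ENNReal.ofReal (2 * discArea * ε) := by
  have hcongr : EqOn (fun y : ℝ => y ^ (Module.finrank ℝ Plane - 1) •
      (Ico 0 ε).indicator (fun t => t⁻¹) y) ((Iio ε).indicator fun _ => 1) (Ioi 0) := by
    intro y hy
    have hy' : (0 : ℝ) < y := hy
    simp only [finrank_plane]
    by_cases h : y < ε
    · rw [indicator_of_mem (show y ∈ Ico 0 ε from ⟨hy'.le, h⟩),
        indicator_of_mem (show y ∈ Iio ε from h)]
      simp [hy'.ne']
    · rw [indicator_of_notMem (fun h' : y ∈ Ico 0 ε => h h'.2),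
        indicator_of_notMem (show y ∉ Iio ε from h), smul_zero]
  have hIoo : Ioi (0 : ℝ) ∩ Iio ε = Ioo 0 ε := Ioi_inter_Iio
  have hint : Integrable (fun w : Plane => (Ico 0 ε).indicator (fun t => t⁻¹) ‖w‖) := by
    rw [integrable_fun_norm_addHaar (volume : Measure Plane)
      (f := (Ico 0 ε).indicator fun t => t⁻¹),
      integrableOn_congr_fun hcongr measurableSet_Ioi, IntegrableOn,
      integrable_indicator_iff measurableSet_Iio, IntegrableOn,
      Measure.restrict_restrict measurableSet_Iio, inter_comm, hIoo]
    exact integrableOn_const (by simp)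
  have h0 : ∀ w : Plane, 0 ≤ (Ico 0 ε).indicator (fun t => t⁻¹) ‖w‖ := fun w =>
    indicator_nonneg (fun t ht => inv_nonneg.2 ht.1) _
  unfold annulusKernel
  rw [← ofReal_integral_eq_lintegral_ofReal hint (Eventually.of_forall h0),
    integral_fun_norm_addHaar (volume : Measure Plane) ((Ico 0 ε).indicator fun t => t⁻¹),
    setIntegral_congr_fun measurableSet_Ioi hcongr, setIntegral_indicator measurableSet_Iio, hIoo]
  congr 1
  simp [discArea, hε.le]
  ring

theorem lintegral_annulusKernel_sq {ε R : ℝ} (hε : 0 < ε) (hR : ε ≤ R) :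
    ∫⁻ w, annulusKernel ε R w ^ 2 = ENNReal.ofReal (2 * discArea * Real.log (R / ε)) := by
  set k : ℝ → ℝ := (Ico ε R).indicator fun t => (t ^ 2)⁻¹
  have hcongr : EqOn (fun y : ℝ => y ^ (Module.finrank ℝ Plane - 1) • k y)
      ((Ico ε R).indicator fun t => t⁻¹) (Ioi 0) := by
    intro y hy
    have hy' : (0 : ℝ) < y := hy
    simp only [finrank_plane, k]
    by_cases h : y ∈ Ico ε R
    · simp only [indicator_of_mem h]
      simp only [Nat.add_one_sub_one, pow_one, smul_eq_mul]
      field_simp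
    · rw [indicator_of_notMem h, indicator_of_notMem h, smul_zero]
  have hsub : Ioi (0 : ℝ) ∩ Ico ε R = Ico ε R :=
    inter_eq_right.2 fun y hy => hε.trans_le hy.1
  have hcont : ContinuousOn (fun t : ℝ => t⁻¹) (Icc ε R) :=
    continuousOn_inv₀.mono fun y hy => (hε.trans_le hy.1).ne'
  have hint : Integrable (fun w : Plane => k ‖w‖) := by
    rw [integrable_fun_norm_addHaar (volume : Measure Plane) (f := k),
      integrableOn_congr_fun hcongr measurableSet_Ioi, IntegrableOn,
      integrable_indicator_iff measurableSet_Ico, IntegrableOn,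
      Measure.restrict_restrict measurableSet_Ico, inter_comm, hsub]
    exact (hcont.integrableOn_compact isCompact_Icc).mono_set Ico_subset_Icc_self
  have h0 : ∀ w : Plane, 0 ≤ k ‖w‖ := fun w =>
    indicator_nonneg (fun t _ => by positivity) _
  have hsq : ∀ w : Plane, annulusKernel ε R w ^ 2 = ENNReal.ofReal (k ‖w‖) := fun w => by
    unfold annulusKernel
    by_cases h : ‖w‖ ∈ Ico ε R
    · simp only [k, indicator_of_mem h]
      rw [← ENNReal.ofReal_pow (by positivity), inv_pow]
    · simp [k, indicator_of_notMem h]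
  simp_rw [hsq]
  rw [← ofReal_integral_eq_lintegral_ofReal hint (Eventually.of_forall h0),
    integral_fun_norm_addHaar (volume : Measure Plane) k,
    setIntegral_congr_fun measurableSet_Ioi hcongr, setIntegral_indicator measurableSet_Ico, hsub,
    integral_Ico_eq_integral_Ioc, ← intervalIntegral.integral_of_le hR,
    integral_inv_of_pos hε (hε.trans_le hR)]
  congr 1
  simp [discArea]
  ring

/-- The potential of `g` with kernel `1 / |w|` on `a ≤ |w| < b`. -/
def annulusPotential (a b : ℝ) (g : Plane → ℝ≥0∞) (x : Plane) : ℝ≥0∞ :=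
  ∫⁻ y, g y * annulusKernel a b (y - x)

variable {g : Plane → ℝ≥0∞}

theorem measurable_annulusPotential (hg : Measurable g) (a b : ℝ) :
    Measurable (annulusPotential a b g) := by
  refine Measurable.lintegral_prod_right' (f := fun z : Plane × Plane =>
    g z.2 * annulusKernel a b (z.2 - z.1)) ?_
  exact (hg.comp measurable_snd).mul ((measurable_annulusKernel a b).comp
    (measurable_snd.sub measurable_fst))

/-- Cauchy-Schwarz: in the plane `1/|w|²` just fails to be integrable at `0`, and this logarithm is
the source of the exponential integrability. -/
theorem annulusPotential_sq_le (hg : Measurable g) {ε R : ℝ} (hε : 0 < ε) (hR : ε ≤ R)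
    (x : Plane) :
    annulusPotential ε R g x ^ 2 ≤
      (∫⁻ y, g y ^ 2) * ENNReal.ofReal (2 * discArea * Real.log (R / ε)) := by
  rw [← lintegral_annulusKernel_sq hε hR,
    ← lintegral_sub_right_eq_self (fun w => annulusKernel ε R w ^ 2) x]
  exact lintegral_mul_sq_le volume hg.aemeasurable
    ((measurable_annulusKernel ε R).comp (measurable_id.sub_const x)).aemeasurable

/-- Young's inequality: Cauchy-Schwarz for the measure with density the kernel, whose mass is `2 *
discArea * ε`, followed by Tonelli. -/
theorem lintegral_annulusPotential_sq_le (hg : Measurable g) {ε : ℝ} (hε : 0 < ε) :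
    ∫⁻ x, annulusPotential 0 ε g x ^ 2 ≤
      ENNReal.ofReal (2 * discArea * ε) ^ 2 * ∫⁻ y, g y ^ 2 := by
  have hk := measurable_annulusKernel 0 ε
  have h1 : ∀ x, annulusPotential 0 ε g x ^ 2 ≤
      ENNReal.ofReal (2 * discArea * ε) * ∫⁻ y, g y ^ 2 * annulusKernel 0 ε (y - x) := fun x => by
    have hkx : Measurable fun y => annulusKernel 0 ε (y - x) := hk.comp (measurable_id.sub_const x)
    have h2 := lintegral_mul_sq_le (volume.withDensity fun y => annulusKernel 0 ε (y - x))
      hg.aemeasurable (aemeasurable_const (b := (1 : ℝ≥0∞)))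
    simp only [mul_one, one_pow] at h2
    rw [lintegral_withDensity_eq_lintegral_mul _ hkx hg,
      lintegral_withDensity_eq_lintegral_mul _ hkx (hg.pow_const 2),
      lintegral_withDensity_eq_lintegral_mul _ hkx measurable_const] at h2
    simp only [Pi.mul_apply, mul_one] at h2
    rw [lintegral_sub_right_eq_self (fun w => annulusKernel 0 ε w) x,
      lintegral_annulusKernel_zero hε] at h2
    unfold annulusPotential
    simp_rw [mul_comm (g _), mul_comm (g _ ^ 2)]
    rwa [mul_comm (ENNReal.ofReal _)]
  refine (lintegral_mono h1).trans ?_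
  have hm : Measurable (Function.uncurry fun x y : Plane =>
      g y ^ 2 * annulusKernel 0 ε (y - x)) :=
    ((hg.pow_const 2).comp measurable_snd).mul (hk.comp (measurable_snd.sub measurable_fst))
  rw [lintegral_const_mul' _ _ ENNReal.ofReal_ne_top, lintegral_lintegral_swap hm.aemeasurable]
  have h3 : ∀ y, ∫⁻ x, g y ^ 2 * annulusKernel 0 ε (y - x) =
      g y ^ 2 * ENNReal.ofReal (2 * discArea * ε) := fun y => by
    have hky : Measurable fun x => annulusKernel 0 ε (y - x) :=
      hk.comp (measurable_const.sub measurable_id)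
    rw [lintegral_const_mul _ hky,
      lintegral_sub_left_eq_self (fun w => annulusKernel 0 ε w) y, lintegral_annulusKernel_zero hε]
  simp_rw [h3]
  rw [lintegral_mul_const' _ _ ENNReal.ofReal_ne_top, sq, mul_comm (∫⁻ y, g y ^ 2),
    mul_assoc (ENNReal.ofReal _)]

theorem annulusPotential_split (hg : Measurable g) {ε R : ℝ} (x : Plane) :
    annulusPotential 0 R g x ≤ annulusPotential 0 ε g x + annulusPotential ε R g x := by
  unfold annulusPotential
  have hm : Measurable fun y => g y * annulusKernel 0 ε (y - x) :=
    hg.mul (measurable_annulusKernel_sub 0 ε x)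
  rw [← lintegral_add_left hm]
  refine lintegral_mono fun y => ?_
  dsimp only
  rw [← mul_add]
  refine mul_le_mul_right ?_ _
  unfold annulusKernel
  by_cases h : ‖y - x‖ ∈ Ico 0 R
  · by_cases h' : ‖y - x‖ < ε
    · rw [indicator_of_mem h, indicator_of_mem (show ‖y - x‖ ∈ Ico 0 ε from ⟨h.1, h'⟩)]
      exact le_self_add
    · rw [indicator_of_mem h, indicator_of_mem (show ‖y - x‖ ∈ Ico ε R from ⟨not_lt.1 h', h.2⟩)]
      exact le_add_self
  · rw [indicator_of_notMem h]; simp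

theorem annulusPotential_add (hg : Measurable g) {g' : Plane → ℝ≥0∞} (a b : ℝ) (x : Plane) :
    annulusPotential a b (fun y => g y + g' y) x =
      annulusPotential a b g x + annulusPotential a b g' x := by
  unfold annulusPotential
  simp_rw [add_mul]
  exact lintegral_add_left (hg.mul (measurable_annulusKernel_sub a b x)) _

theorem annulusPotential_le_of_le {N : ℝ≥0∞} (hN : ∀ y, g y ≤ N) {R : ℝ} (hR : 0 < R)
    (x : Plane) : annulusPotential 0 R g x ≤ N * ENNReal.ofReal (2 * discArea * R) := by
  rw [← lintegral_annulusKernel_zero hR, ← lintegral_sub_right_eq_self (annulusKernel 0 R) x,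
    ← lintegral_const_mul _ (measurable_annulusKernel_sub 0 R x)]
  exact lintegral_mono fun y => mul_le_mul_left (hN y) _

/-- The distribution function of the potential of a square integrable function has Gaussian
decay. -/
theorem volume_annulusPotential_gt_le (hg : Measurable g) {δ R l : ℝ} (hδ : 0 < δ) (hR : 0 < R)
    (hl : 0 < l) (hgδ : ∫⁻ y, g y ^ 2 ≤ ENNReal.ofReal (δ ^ 2)) :
    volume {x | ENNReal.ofReal l < annulusPotential 0 R g x} ≤
      ENNReal.ofReal (16 * discArea ^ 2 * R ^ 2 * δ ^ 2 / l ^ 2 *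
        Real.exp (-(l ^ 2 / (4 * discArea * δ ^ 2)))) := by
  have hω := discArea_pos
  -- With this `ε` the far part is at most `l / 2` everywhere, as `2 * discArea * log (R / ε) * δ² =
  -- l² / 4`. The near part must then exceed `l / 2`, and Chebyshev with its L² bound gives a
  -- measure of order `ε²`.
  set ε := R * Real.exp (-(l ^ 2 / (8 * discArea * δ ^ 2))) with hεdef
  have hε : 0 < ε := by positivity
  have hεR : ε ≤ R := by
    refine mul_le_of_le_one_right hR.le (Real.exp_le_one_iff.2 ?_)
    have : 0 ≤ l ^ 2 / (8 * discArea * δ ^ 2) := by positivity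
    linarith
  have hlog : Real.log (R / ε) = l ^ 2 / (8 * discArea * δ ^ 2) := by
    rw [hεdef, div_mul_cancel_left₀ hR.ne', ← Real.exp_neg, neg_neg, Real.log_exp]
  have hfar : ∀ x, annulusPotential ε R g x ≤ ENNReal.ofReal (l / 2) := fun x => by
    have h1 := annulusPotential_sq_le hg hε hεR x
    have h2 : annulusPotential ε R g x ^ 2 ≤ ENNReal.ofReal (l / 2) ^ 2 := by
      refine h1.trans ((mul_le_mul_left hgδ _).trans ?_)
      rw [← ENNReal.ofReal_mul (by positivity), ← ENNReal.ofReal_pow (by positivity), hlog]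
      refine ENNReal.ofReal_le_ofReal (le_of_eq ?_)
      field_simp
      norm_num
    exact (ENNReal.pow_le_pow_left_iff two_ne_zero).1 h2
  have hsub : {x | ENNReal.ofReal l < annulusPotential 0 R g x} ⊆
      {x | ENNReal.ofReal (l / 2) ^ 2 ≤ annulusPotential 0 ε g x ^ 2} := by
    intro x hx
    refine pow_le_pow_left₀ (zero_le (a := ENNReal.ofReal (l / 2))) ?_ 2
    by_contra! hcon
    have h1 : annulusPotential 0 R g x ≤ ENNReal.ofReal (l / 2) + ENNReal.ofReal (l / 2) :=
      (annulusPotential_split hg (ε := ε) x).trans (add_le_add hcon.le (hfar x))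
    rw [← ENNReal.ofReal_add (by positivity) (by positivity), add_halves] at h1
    exact absurd hx (not_lt.2 h1)
  refine (measure_mono hsub).trans ?_
  have hch := mul_meas_ge_le_lintegral (μ := (volume : Measure Plane))
    ((measurable_annulusPotential hg 0 ε).pow_const 2) (ENNReal.ofReal (l / 2) ^ 2)
  have hne : ENNReal.ofReal (l / 2) ^ 2 ≠ 0 := by
    simp [hl]
  have hne' : ENNReal.ofReal (l / 2) ^ 2 ≠ ⊤ := by finiteness
  rw [mul_comm] at hch
  refine ((ENNReal.le_div_iff_mul_le (Or.inl hne) (Or.inl hne')).2 hch).trans ?_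
  refine ENNReal.div_le_of_le_mul ((lintegral_annulusPotential_sq_le hg hε).trans
    ((mul_le_mul_right hgδ _).trans ?_))
  rw [← ENNReal.ofReal_pow (by positivity), ← ENNReal.ofReal_pow (by positivity),
    ← ENNReal.ofReal_mul (by positivity), ← ENNReal.ofReal_mul (by positivity)]
  refine ENNReal.ofReal_le_ofReal (le_of_eq ?_)
  have hexp : Real.exp (-(l ^ 2 / (8 * discArea * δ ^ 2))) ^ 2 =
      Real.exp (-(l ^ 2 / (4 * discArea * δ ^ 2))) := by
    rw [← Real.exp_nat_mul]
    congr 1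
    push_cast
    field_simp
    norm_num
  rw [hεdef, ← hexp]
  field_simp
  norm_num

/-- Gaussian decay of the distribution function bounds the integral of `Φ`. -/
theorem lintegral_Phi_le_of_tail {α : Type*} [MeasurableSpace α] {μ : Measure α} {v : α → ℝ}
    (hv : AEMeasurable v μ) {l₀ : ℝ} {K : ℝ≥0∞}
    (htail : ∀ l, l₀ ≤ l → μ {x | l < |v x|} ≤ K * ENNReal.ofReal (Real.exp (-(2 * l ^ 2)))) :
    ∫⁻ x, ENNReal.ofReal (Phi.toFun (v x)) ∂μ ≤
      ENNReal.ofReal (Real.exp (l₀ ^ 2)) * ∫⁻ x, ENNReal.ofReal (v x ^ 2) ∂μ +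
        K * ∑' j : ℕ, ENNReal.ofReal (Real.exp (1 - j)) := by
  set S : ℕ → Set α := fun j => {x | √(l₀ ^ 2 + j) < |v x|}
  have hS : ∀ j, NullMeasurableSet (S j) μ := fun j =>
    nullMeasurableSet_lt aemeasurable_const hv.abs
  set c : ℕ → ℝ≥0∞ := fun j => ENNReal.ofReal (Real.exp (l₀ ^ 2 + j + 1))
  have hpt : ∀ x, ENNReal.ofReal (Phi.toFun (v x)) ≤
      ENNReal.ofReal (Real.exp (l₀ ^ 2)) * ENNReal.ofReal (v x ^ 2) +
        ∑' j, (S j).indicator (fun _ => c j) x := by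
    intro x
    -- Below the threshold `e^a - 1 ≤ a e^a` is used with `a = v²`; above it, values are sorted into
    -- unit layers of `v²`.
    rcases le_or_gt (v x ^ 2) (l₀ ^ 2) with hx | hx
    · refine le_add_right ?_
      rw [← ENNReal.ofReal_mul (Real.exp_pos _).le]
      refine ENNReal.ofReal_le_ofReal ?_
      rw [Phi_apply]
      have h1 := Real.add_one_le_exp (-(v x ^ 2))
      have h2 : Real.exp (v x ^ 2) - 1 ≤ Real.exp (v x ^ 2) * v x ^ 2 := by
        have h3 : Real.exp (v x ^ 2) * Real.exp (-(v x ^ 2)) = 1 := by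
          rw [← Real.exp_add, add_neg_cancel, Real.exp_zero]
        nlinarith [Real.exp_pos (v x ^ 2)]
      exact h2.trans (mul_le_mul_of_nonneg_right (Real.exp_le_exp.2 hx) (sq_nonneg _))
    · refine le_add_left ?_
      -- The layer index for which `l₀² + j < v² ≤ l₀² + j + 1`, with strict inequality on the left
      -- as in `S j`.
      set j := ⌈v x ^ 2 - l₀ ^ 2⌉₊ - 1
      have hpos : 0 < ⌈v x ^ 2 - l₀ ^ 2⌉₊ := Nat.ceil_pos.2 (by linarith)
      have hj : (j : ℝ) + 1 = ⌈v x ^ 2 - l₀ ^ 2⌉₊ := by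
        have : j + 1 = ⌈v x ^ 2 - l₀ ^ 2⌉₊ := Nat.succ_pred_eq_of_pos hpos
        exact_mod_cast this
      have h1 := Nat.le_ceil (v x ^ 2 - l₀ ^ 2)
      have h2 := Nat.ceil_lt_add_one (show 0 ≤ v x ^ 2 - l₀ ^ 2 by linarith)
      have hmem : x ∈ S j := by
        change √(l₀ ^ 2 + j) < |v x|
        rw [← Real.sqrt_sq_eq_abs]
        exact Real.sqrt_lt_sqrt (by positivity) (by linarith)
      refine le_trans ?_ (ENNReal.le_tsum j)
      rw [indicator_of_mem hmem]
      refine ENNReal.ofReal_le_ofReal ?_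
      rw [Phi_apply]
      have : Real.exp (v x ^ 2) ≤ Real.exp (l₀ ^ 2 + j + 1) := Real.exp_le_exp.2 (by linarith)
      linarith
  have hsq : AEMeasurable (fun x => ENNReal.ofReal (v x ^ 2)) μ :=
    ENNReal.measurable_ofReal.comp_aemeasurable (hv.pow_const 2)
  refine (lintegral_mono hpt).trans ?_
  rw [lintegral_add_left' (hsq.const_mul _), lintegral_const_mul' _ _ ENNReal.ofReal_ne_top,
    lintegral_tsum fun j => aemeasurable_const.indicator₀ (hS j)]
  refine add_le_add le_rfl ?_
  rw [← ENNReal.tsum_mul_left]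
  refine ENNReal.tsum_le_tsum fun j => ?_
  have hsqrt : l₀ ≤ √(l₀ ^ 2 + j) := Real.le_sqrt_of_sq_le (by linarith [(Nat.cast_nonneg j : (0:ℝ) ≤ j)])
  rw [lintegral_indicator_const₀ (hS j)]
  -- The tail `exp(-2(l₀² + j))` beats the weight `exp(l₀² + j + 1)`; the product is at most `exp(1
  -- - j)`.
  refine (mul_le_mul_right (htail _ hsqrt) _).trans ?_
  rw [mul_left_comm, ← ENNReal.ofReal_mul (Real.exp_pos _).le, ← Real.exp_add,
    Real.sq_sqrt (by positivity)]
  refine mul_le_mul_right (ENNReal.ofReal_le_ofReal (Real.exp_le_exp.2 ?_)) _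
  nlinarith [sq_nonneg l₀, (Nat.cast_nonneg j : (0:ℝ) ≤ j)]

theorem tsum_exp_one_sub_lt_top : ∑' j : ℕ, ENNReal.ofReal (Real.exp (1 - j)) < ⊤ := by
  have hs : Summable fun j : ℕ => Real.exp (1 - j) := by
    have := (Real.summable_exp_neg_nat).mul_left (Real.exp 1)
    refine this.congr fun j => ?_
    rw [← Real.exp_add, sub_eq_add_neg]
  rw [← ENNReal.ofReal_tsum_of_nonneg (fun j => (Real.exp_pos _).le) hs]
  exact ENNReal.ofReal_lt_top

end Riesz

/-! ### A pointwise estimate for Sobolev functions -/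

section Pointwise

variable {Ω : Set Plane}

theorem inner_gradient (φ : Plane → ℝ) (y c : Plane) :
    inner ℝ c (gradient φ y) = fderiv ℝ φ y c := by
  rw [real_inner_comm, gradient, InnerProductSpace.toDual_symm_apply]

theorem integral_mul_fderiv_of_mem_sobolevH1 {w : SobolevPair Ω} (hw : w ∈ sobolevH1 Ω)
    {φ : Plane → ℝ} (hφ : IsTestFunction Ω φ) (c : Plane) :
    ∫ y in Ω, w.fst y * fderiv ℝ φ y c = -∫ y in Ω, φ y * inner ℝ c (w.snd y) := by
  have h := congrArg (fun v => inner ℝ c v) (hw φ hφ)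
  simp only [inner_neg_right] at h
  rw [← integral_inner (integrable_smul_gradient _ hφ),
    ← integral_inner (integrable_smul_field _ hφ)] at h
  simpa only [inner_smul_right, inner_gradient] using h

/-- A normalized smooth bump function on the ball of radius `r` around `z`. -/
def bumpAt (z : Plane) {r : ℝ} (hr : 0 < r) : Plane → ℝ :=
  (⟨r / 2, r, half_pos hr, half_lt_self hr⟩ : ContDiffBump z).normed volume

section Bump

variable (z : Plane) {r : ℝ} (hr : 0 < r)

theorem contDiff_bumpAt : ContDiff ℝ ∞ (bumpAt z hr) := ContDiffBump.contDiff_normed _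

theorem bumpAt_nonneg (w : Plane) : 0 ≤ bumpAt z hr w := ContDiffBump.nonneg_normed _ _

theorem integral_bumpAt : ∫ w, bumpAt z hr w = 1 := ContDiffBump.integral_normed _

theorem tsupport_bumpAt : tsupport (bumpAt z hr) = Metric.closedBall z r :=
  ContDiffBump.tsupport_normed_eq _

theorem hasCompactSupport_bumpAt : HasCompactSupport (bumpAt z hr) :=
  ContDiffBump.hasCompactSupport_normed _

theorem bumpAt_eq_zero {w : Plane} (hw : w ∉ Metric.closedBall z r) : bumpAt z hr w = 0 :=
  image_eq_zero_of_notMem_tsupport (by rwa [tsupport_bumpAt])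

theorem fderiv_bumpAt_eq_zero {w : Plane} (hw : w ∉ Metric.closedBall z r) :
    fderiv ℝ (bumpAt z hr) w = 0 :=
  image_eq_zero_of_notMem_tsupport fun h =>
    hw (by simpa only [tsupport_bumpAt] using tsupport_fderiv_subset ℝ h)

theorem exists_bumpAt_le : ∃ S, 0 < S ∧ ∀ w, bumpAt z hr w ≤ S := by
  obtain ⟨C, hC⟩ := (hasCompactSupport_bumpAt z hr).exists_bound_of_continuous
    (contDiff_bumpAt z hr).continuous
  exact ⟨max C 1, by positivity, fun w => (le_abs_self _).trans ((hC w).trans (le_max_left _ _))⟩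

theorem hasFDerivAt_bumpAt (w : Plane) :
    HasFDerivAt (bumpAt z hr) (fderiv ℝ (bumpAt z hr) w) w :=
  (((contDiff_bumpAt z hr).differentiable (by simp)) w).hasFDerivAt

/-- The derivative of `τ ↦ τ² ρ(τ w)`. -/
def dilationDeriv (τ : ℝ) (w : Plane) : ℝ :=
  2 * τ * bumpAt z hr (τ • w) + τ ^ 2 * fderiv ℝ (bumpAt z hr) (τ • w) w

theorem hasDerivAt_dilation (w : Plane) (τ : ℝ) :
    HasDerivAt (fun τ : ℝ => τ ^ 2 * bumpAt z hr (τ • w)) (dilationDeriv z hr τ w) τ := by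
  have h1 : HasDerivAt (fun τ : ℝ => τ • w) w τ := by
    simpa using (hasDerivAt_id τ).smul_const w
  have h2 := (hasFDerivAt_bumpAt z hr (τ • w)).comp_hasDerivAt τ h1
  have h3 := (hasDerivAt_pow 2 τ).mul h2
  refine h3.congr_deriv ?_
  simp [dilationDeriv]

theorem continuous_fderiv_bumpAt : Continuous (fderiv ℝ (bumpAt z hr)) :=
  (contDiff_bumpAt z hr).continuous_fderiv (by simp)

theorem continuous_dilationDeriv :
    Continuous fun p : ℝ × Plane => dilationDeriv z hr p.1 p.2 := by
  have h1 := (contDiff_bumpAt z hr).continuous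
  have h2 : Continuous fun p : ℝ × Plane => fderiv ℝ (bumpAt z hr) (p.1 • p.2) p.2 :=
    ((continuous_fderiv_bumpAt z hr).comp (continuous_fst.smul continuous_snd)).clm_apply
      continuous_snd
  unfold dilationDeriv
  fun_prop

/-- The scalar field `y ↦ τ ρ(τ (y - x)) ⟨e, y - x⟩`. -/
def dilationField (x : Plane) (τ : ℝ) (e : Plane) (y : Plane) : ℝ :=
  τ * bumpAt z hr (τ • (y - x)) * inner ℝ e (y - x)

theorem fderiv_dilationField (x : Plane) (τ : ℝ) (e y v : Plane) :
    fderiv ℝ (dilationField z hr x τ e) y v =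
      τ * bumpAt z hr (τ • (y - x)) * inner ℝ e v +
        inner ℝ e (y - x) * (τ ^ 2 * fderiv ℝ (bumpAt z hr) (τ • (y - x)) v) := by
  have h0 : HasFDerivAt (fun y : Plane => y - x) (ContinuousLinearMap.id ℝ Plane) y :=
    (hasFDerivAt_id y).sub_const x
  have h1 : HasFDerivAt (fun y : Plane => τ • (y - x)) (τ • ContinuousLinearMap.id ℝ Plane) y :=
    h0.const_smul τ
  have h2 := ((hasFDerivAt_bumpAt z hr (τ • (y - x))).comp y h1).const_mul τ
  have h3 : HasFDerivAt (fun y : Plane => inner ℝ e (y - x)) (innerSL ℝ e) y :=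
    ((innerSL ℝ e).hasFDerivAt).comp y h0
  have h4 := (h2.mul h3).fderiv
  have h5 : fderiv ℝ (dilationField z hr x τ e) y = _ := h4
  rw [h5]
  simp
  left
  ring

/-- In dimension two the field `w ↦ τ ρ(τw) w` has divergence `∂_τ (τ² ρ(τw))`. Changing the
dilation parameter of an average thus amounts to testing the weak gradient. -/
theorem sum_fderiv_dilationField (x : Plane) (τ : ℝ) (y : Plane) :
    ∑ i, fderiv ℝ (dilationField z hr x τ (EuclideanSpace.basisFun (Fin 2) ℝ i)) y
      (EuclideanSpace.basisFun (Fin 2) ℝ i) = dilationDeriv z hr τ (y - x) := by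
  simp_rw [fderiv_dilationField]
  rw [Finset.sum_add_distrib]
  have h1 : ∀ i, inner ℝ (EuclideanSpace.basisFun (Fin 2) ℝ i)
      (EuclideanSpace.basisFun (Fin 2) ℝ i) = 1 := fun i => by
    rw [real_inner_self_eq_norm_sq, OrthonormalBasis.norm_eq_one]; norm_num
  have h2 : ∑ i, inner ℝ (EuclideanSpace.basisFun (Fin 2) ℝ i) (y - x) *
      (τ ^ 2 * fderiv ℝ (bumpAt z hr) (τ • (y - x)) (EuclideanSpace.basisFun (Fin 2) ℝ i)) =
      τ ^ 2 * fderiv ℝ (bumpAt z hr) (τ • (y - x)) (y - x) := by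
    conv_rhs => rw [← OrthonormalBasis.sum_repr' (EuclideanSpace.basisFun (Fin 2) ℝ) (y - x)]
    rw [map_sum, Finset.mul_sum]
    refine Finset.sum_congr rfl fun i _ => ?_
    rw [map_smul, smul_eq_mul, OrthonormalBasis.sum_repr']
    ring
  rw [h2]
  simp_rw [h1]
  simp [dilationDeriv]
  ring

theorem smul_sub_notMem_closedBall {x y : Plane} {τ : ℝ} (hτ : 0 < τ)
    (h : y ∉ Metric.closedBall (x + τ⁻¹ • z) (τ⁻¹ * r)) :
    τ • (y - x) ∉ Metric.closedBall z r := by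
  contrapose! h
  rw [Metric.mem_closedBall, dist_eq_norm] at h ⊢
  have : y - (x + τ⁻¹ • z) = τ⁻¹ • (τ • (y - x) - z) := by
    rw [smul_sub, smul_smul, inv_mul_cancel₀ hτ.ne', one_smul]; abel
  rw [this, norm_smul, Real.norm_of_nonneg (inv_pos.2 hτ).le]
  exact mul_le_mul_of_nonneg_left h (inv_pos.2 hτ).le

theorem isTestFunction_dilationField {x : Plane} {τ : ℝ} (hτ : 0 < τ)
    (hx : Metric.closedBall (x + τ⁻¹ • z) (τ⁻¹ * r) ⊆ Ω) (e : Plane) :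
    IsTestFunction Ω (dilationField z hr x τ e) := by
  have hs : Function.support (dilationField z hr x τ e) ⊆
      Metric.closedBall (x + τ⁻¹ • z) (τ⁻¹ * r) := by
    intro y hy
    by_contra hcon
    apply hy
    simp [dilationField, bumpAt_eq_zero z hr (smul_sub_notMem_closedBall z hτ hcon)]
  have ht : tsupport (dilationField z hr x τ e) ⊆ Metric.closedBall (x + τ⁻¹ • z) (τ⁻¹ * r) :=
    closure_minimal hs Metric.isClosed_closedBall
  refine ⟨?_, ?_, ht.trans hx⟩
  · have h1 := contDiff_bumpAt z hr
    have h2 : ContDiff ℝ ∞ fun y : Plane => τ • (y - x) :=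
      (contDiff_id.sub contDiff_const).const_smul τ
    have h3 : ContDiff ℝ ∞ fun y : Plane => inner ℝ e (y - x) :=
      (innerSL ℝ e).contDiff.comp (contDiff_id.sub contDiff_const)
    exact (contDiff_const.mul (h1.comp h2)).mul h3
  · exact (isCompact_closedBall _ _).of_isClosed_subset (isClosed_tsupport _) ht

theorem integral_mul_dilationDeriv {w : SobolevPair Ω} (hw : w ∈ sobolevH1 Ω) {x : Plane} {τ : ℝ}
    (hτ : 0 < τ) (hx : Metric.closedBall (x + τ⁻¹ • z) (τ⁻¹ * r) ⊆ Ω) :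
    ∫ y in Ω, w.fst y * dilationDeriv z hr τ (y - x) =
      -∫ y in Ω, τ * bumpAt z hr (τ • (y - x)) * inner ℝ (y - x) (w.snd y) := by
  set b := EuclideanSpace.basisFun (Fin 2) ℝ
  have ht := isTestFunction_dilationField z hr hτ hx
  have h1 := fun i => integral_mul_fderiv_of_mem_sobolevH1 hw (ht (b i)) (b i)
  have hi1 : ∀ i, Integrable (fun y => w.fst y * fderiv ℝ (dilationField z hr x τ (b i)) y (b i))
      (volume.restrict Ω) := fun i => by
    have := Integrable.const_inner (𝕜 := ℝ) (b i) (integrable_smul_gradient w.fst (ht (b i)))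
    simpa only [inner_smul_right, inner_gradient] using this
  have hi2 : ∀ i, Integrable (fun y => dilationField z hr x τ (b i) y * inner ℝ (b i) (w.snd y))
      (volume.restrict Ω) := fun i => by
    have := Integrable.const_inner (𝕜 := ℝ) (b i) (integrable_smul_field w.snd (ht (b i)))
    simpa only [inner_smul_right] using this
  simp_rw [← sum_fderiv_dilationField, Finset.mul_sum]
  rw [integral_finsetSum _ fun i _ => hi1 i, Finset.sum_congr rfl fun i _ => h1 i,
    Finset.sum_neg_distrib, ← integral_finsetSum _ fun i _ => hi2 i]
  congr 1
  refine integral_congr_ae (Eventually.of_forall fun y => ?_)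
  dsimp only
  rw [← OrthonormalBasis.sum_inner_mul_inner b, Finset.mul_sum]
  refine Finset.sum_congr rfl fun i _ => ?_
  rw [dilationField, real_inner_comm (b i) (y - x)]
  ring

end Bump

end Pointwise

/-! ### Integral representation of Sobolev functions along a cone -/

section Representation

variable {Ω : Set Plane} (z : Plane) {r : ℝ} (hr : 0 < r)

theorem smul_notMem_closedBall {w : Plane} {τ : ℝ} (hτ : 0 ≤ τ) (h : ‖z‖ + r < τ * ‖w‖) :
    τ • w ∉ Metric.closedBall z r := by
  rw [Metric.mem_closedBall, dist_eq_norm, not_le]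
  have h1 := norm_sub_norm_le (τ • w) z
  rw [norm_smul, Real.norm_of_nonneg hτ] at h1
  linarith

theorem memLp_bumpAt_dilation (x : Plane) {τ : ℝ} (hτ : 0 < τ) (μ : Measure Plane)
    [IsFiniteMeasureOnCompacts μ] : MemLp (fun y => bumpAt z hr (τ • (y - x))) 2 μ := by
  have hc : Continuous fun y : Plane => bumpAt z hr (τ • (y - x)) :=
    (contDiff_bumpAt z hr).continuous.comp ((continuous_id.sub continuous_const).const_smul τ)
  refine hc.memLp_of_hasCompactSupport (HasCompactSupport.intro
    (isCompact_closedBall (x + τ⁻¹ • z) (τ⁻¹ * r)) fun y hy => ?_)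
  exact bumpAt_eq_zero z hr (smul_sub_notMem_closedBall z hτ hy)

/-- The average of `u` over `Ω` with weight `τ² ρ(τ (y - x))`. -/
def dilationAverage (Ω : Set Plane) (u : Plane → ℝ) (x : Plane) (τ : ℝ) : ℝ :=
  ∫ y in Ω, u y * (τ ^ 2 * bumpAt z hr (τ • (y - x)))

theorem integrable_dilationAverage {u : Plane → ℝ} (hu : MemLp u 2 (volume.restrict Ω)) (x : Plane)
    {τ : ℝ} (hτ : 0 < τ) :
    Integrable (fun y => u y * (τ ^ 2 * bumpAt z hr (τ • (y - x)))) (volume.restrict Ω) :=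
  hu.integrable_mul ((memLp_bumpAt_dilation z hr x hτ _).const_mul (τ ^ 2))

theorem integral_dilationDeriv (w : Plane) (T : ℝ) :
    ∫ τ in (1 : ℝ)..T, dilationDeriv z hr τ w =
      T ^ 2 * bumpAt z hr (T • w) - 1 ^ 2 * bumpAt z hr ((1 : ℝ) • w) := by
  have hc : Continuous fun τ => dilationDeriv z hr τ w :=
    (continuous_dilationDeriv z hr).comp (continuous_id.prodMk continuous_const)
  exact intervalIntegral.integral_eq_sub_of_hasDerivAt
    (fun τ _ => hasDerivAt_dilation z hr w τ) (hc.intervalIntegrable _ _)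

theorem dilationDeriv_eq_zero {w : Plane} {τ : ℝ} (hτ : 1 ≤ τ) (hw : ‖z‖ + r < ‖w‖) :
    dilationDeriv z hr τ w = 0 := by
  have h := smul_notMem_closedBall z (r := r) (w := w) (τ := τ) (by linarith)
    (hw.trans_le (le_mul_of_one_le_left (norm_nonneg w) hτ))
  simp [dilationDeriv, bumpAt_eq_zero z hr h, fderiv_bumpAt_eq_zero z hr h]

theorem integrable_prod_dilationDeriv {u : Plane → ℝ} (hu : MemLp u 2 (volume.restrict Ω))
    (x : Plane) (T : ℝ) :
    Integrable (fun p : ℝ × Plane => u p.2 * dilationDeriv z hr p.1 (p.2 - x))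
      (((volume : Measure ℝ).restrict (Ioc 1 T)).prod (volume.restrict Ω)) := by
  have hcont : Continuous fun p : ℝ × Plane => dilationDeriv z hr p.1 (p.2 - x) :=
    (continuous_dilationDeriv z hr).comp (continuous_fst.prodMk (continuous_snd.sub continuous_const))
  obtain ⟨C, hC⟩ := (isCompact_Icc (a := (1 : ℝ)) (b := T)).prod
    (isCompact_closedBall x (‖z‖ + r)) |>.exists_bound_of_continuousOn hcont.continuousOn
  set B := Metric.closedBall x (‖z‖ + r)
  have hB : Integrable (B.indicator fun y => C * |u y|) (volume.restrict Ω) := by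
    rw [integrable_indicator_iff Metric.isClosed_closedBall.measurableSet]
    refine Integrable.const_mul (Admissible.integrableOn_of_memLp_two hu ?_).abs C
    exact (Measure.restrict_apply_le _ _).trans_lt measure_closedBall_lt_top
  have hum : AEStronglyMeasurable (fun p : ℝ × Plane => u p.2)
      (((volume : Measure ℝ).restrict (Ioc 1 T)).prod (volume.restrict Ω)) := hu.1.comp_snd
  refine Integrable.mono' (hB.comp_snd ((volume : Measure ℝ).restrict (Ioc 1 T)))
    (hum.mul hcont.aestronglyMeasurable) ?_
  have hae : ∀ᵐ p : ℝ × Plane ∂(((volume : Measure ℝ).restrict (Ioc 1 T)).prod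
      (volume.restrict Ω)), p.1 ∈ Ioc 1 T :=
    Measure.quasiMeasurePreserving_fst.ae (ae_restrict_mem measurableSet_Ioc)
  filter_upwards [hae] with p hp
  by_cases hpB : p.2 ∈ B
  · rw [indicator_of_mem hpB, norm_mul, mul_comm, Real.norm_eq_abs (u p.2)]
    exact mul_le_mul_of_nonneg_right (hC p ⟨⟨hp.1.le, hp.2⟩, hpB⟩) (abs_nonneg _)
  · rw [indicator_of_notMem hpB, dilationDeriv_eq_zero z hr hp.1.le, mul_zero, norm_zero]
    simpa [B, dist_eq_norm] using hpB

/-- The fundamental theorem of calculus in `τ` and Fubini, the `τ`-derivative being rewritten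
through the weak gradient. The hypothesis `hx` keeps the supports of the test fields inside `Ω`. -/
theorem dilationAverage_sub {w : SobolevPair Ω} (hw : w ∈ sobolevH1 Ω) {x : Plane}
    (hx : ∀ τ : ℝ, 1 ≤ τ → Metric.closedBall (x + τ⁻¹ • z) (τ⁻¹ * r) ⊆ Ω) {T : ℝ} (hT : 1 ≤ T) :
    dilationAverage z hr Ω w.fst x T - dilationAverage z hr Ω w.fst x 1 =
      ∫ τ in Ioc 1 T, -∫ y in Ω, τ * bumpAt z hr (τ • (y - x)) * inner ℝ (y - x) (w.snd y) := by
  have hu := Lp.memLp w.fst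
  unfold dilationAverage
  rw [← integral_sub (integrable_dilationAverage z hr hu x (by linarith))
    (integrable_dilationAverage z hr hu x one_pos)]
  have h1 : ∀ y, w.fst y * (T ^ 2 * bumpAt z hr (T • (y - x))) -
      w.fst y * (1 ^ 2 * bumpAt z hr ((1 : ℝ) • (y - x))) =
      ∫ τ in Ioc 1 T, w.fst y * dilationDeriv z hr τ (y - x) := fun y => by
    rw [integral_const_mul, ← intervalIntegral.integral_of_le hT, integral_dilationDeriv]
    ring
  simp_rw [h1]
  rw [← integral_integral_swap (f := fun τ y => w.fst y * dilationDeriv z hr τ (y - x))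
    (integrable_prod_dilationDeriv z hr hu x T)]
  refine setIntegral_congr_fun measurableSet_Ioc fun τ hτ => ?_
  exact integral_mul_dilationDeriv z hr hw (by linarith [hτ.1]) (hx τ hτ.1.le)

/-- With `c = ‖z‖ + r`, the integrand vanishes unless `τ‖w‖ ≤ c`. It is then at most `S c` on a
range of length at most `c / ‖w‖`, which produces the kernel `1 / ‖w‖`. The extra `1` in the radius
only ensures that `‖w‖ = c` is inside the half-open annulus. -/
theorem lintegral_bumpAt_dilation_le {S : ℝ} (hS : 0 < S) (hle : ∀ w, bumpAt z hr w ≤ S)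
    (w : Plane) (T : ℝ) :
    ∫⁻ τ in Ioc 1 T, ENNReal.ofReal (τ * bumpAt z hr (τ • w) * ‖w‖) ≤
      ENNReal.ofReal (S * (‖z‖ + r) ^ 2) * annulusKernel 0 (‖z‖ + r + 1) w := by
  have hc : 0 < ‖z‖ + r := by positivity
  rcases eq_or_ne w 0 with rfl | hw0
  · simp
  have hw : 0 < ‖w‖ := norm_pos_iff.2 hw0
  rcases lt_or_ge (‖z‖ + r) ‖w‖ with hwc | hwc
  · rw [setLIntegral_congr_fun (g := fun _ => 0) measurableSet_Ioc fun τ hτ => ?_]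
    · simp
    · have h := smul_notMem_closedBall z (r := r) (w := w) (τ := τ) (by linarith [hτ.1])
        (hwc.trans_le (le_mul_of_one_le_left hw.le hτ.1.le))
      simp [bumpAt_eq_zero z hr h]
  · have hpt : ∀ τ ∈ Ioc 1 T, ENNReal.ofReal (τ * bumpAt z hr (τ • w) * ‖w‖) ≤
        (Ioc 0 ((‖z‖ + r) / ‖w‖)).indicator (fun _ => ENNReal.ofReal (S * (‖z‖ + r))) τ := by
      intro τ hτ
      have hτ0 : 0 < τ := one_pos.trans hτ.1
      rcases le_or_gt τ ((‖z‖ + r) / ‖w‖) with h | h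
      · rw [indicator_of_mem (show τ ∈ Ioc 0 ((‖z‖ + r) / ‖w‖) from ⟨hτ0, h⟩)]
        refine ENNReal.ofReal_le_ofReal ?_
        rw [le_div_iff₀ hw] at h
        calc τ * bumpAt z hr (τ • w) * ‖w‖ = bumpAt z hr (τ • w) * (τ * ‖w‖) := by ring
          _ ≤ S * (‖z‖ + r) := mul_le_mul (hle _) h (by positivity) hS.le
      · rw [div_lt_iff₀ hw] at h
        simp [bumpAt_eq_zero z hr (smul_notMem_closedBall z hτ0.le h)]
    refine (setLIntegral_mono' measurableSet_Ioc hpt).trans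
      ((setLIntegral_le_lintegral _ _).trans ?_)
    rw [lintegral_indicator_const measurableSet_Ioc, Real.volume_Ioc, sub_zero, annulusKernel,
      indicator_of_mem (show ‖w‖ ∈ Ico 0 (‖z‖ + r + 1) from ⟨hw.le, by linarith⟩),
      ← ENNReal.ofReal_mul (by positivity), ← ENNReal.ofReal_mul (by positivity)]
    refine ENNReal.ofReal_le_ofReal (le_of_eq ?_)
    field_simp

/-- The size of the weak gradient, extended by zero. -/
def gradientSize (w : SobolevPair Ω) : Plane → ℝ≥0∞ := Ω.indicator fun y => ‖w.snd y‖ₑ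

theorem measurable_gradientSize (hΩ : MeasurableSet Ω) (w : SobolevPair Ω) :
    Measurable (gradientSize w) :=
  (Lp.stronglyMeasurable w.snd).measurable.enorm.indicator hΩ

theorem enorm_dilationAverage_sub_le (hΩ : MeasurableSet Ω) {S : ℝ} (hS : 0 < S)
    (hle : ∀ w, bumpAt z hr w ≤ S) {w : SobolevPair Ω} (hw : w ∈ sobolevH1 Ω) {x : Plane}
    (hx : ∀ τ : ℝ, 1 ≤ τ → Metric.closedBall (x + τ⁻¹ • z) (τ⁻¹ * r) ⊆ Ω) {T : ℝ} (hT : 1 ≤ T) :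
    ‖dilationAverage z hr Ω w.fst x T - dilationAverage z hr Ω w.fst x 1‖ₑ ≤
      ENNReal.ofReal (S * (‖z‖ + r) ^ 2) *
        annulusPotential 0 (‖z‖ + r + 1) (gradientSize w) x := by
  have hGm : Measurable fun y => ‖w.snd y‖ₑ := (Lp.stronglyMeasurable w.snd).measurable.enorm
  rw [dilationAverage_sub z hr hw hx hT]
  have h1 : ∀ τ ∈ Ioc 1 T,
      ‖-∫ y in Ω, τ * bumpAt z hr (τ • (y - x)) * inner ℝ (y - x) (w.snd y)‖ₑ ≤
      ∫⁻ y in Ω, ENNReal.ofReal (τ * bumpAt z hr (τ • (y - x)) * ‖y - x‖) * ‖w.snd y‖ₑ := by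
    intro τ hτ
    rw [enorm_neg]
    refine (enorm_integral_le_lintegral_enorm _).trans (lintegral_mono fun y => ?_)
    dsimp only
    have hb : 0 ≤ τ * bumpAt z hr (τ • (y - x)) :=
      mul_nonneg (by linarith [hτ.1]) (bumpAt_nonneg z hr _)
    rw [← ofReal_norm, ← ofReal_norm,
      ← ENNReal.ofReal_mul (mul_nonneg hb (norm_nonneg _)), norm_mul, Real.norm_of_nonneg hb,
      mul_assoc _ ‖y - x‖]
    exact ENNReal.ofReal_le_ofReal (mul_le_mul_of_nonneg_left (norm_inner_le_norm _ _) hb)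
  refine (enorm_integral_le_lintegral_enorm _).trans
    ((setLIntegral_mono' measurableSet_Ioc h1).trans ?_)
  have hcont : Continuous fun p : ℝ × Plane =>
      p.1 * bumpAt z hr (p.1 • (p.2 - x)) * ‖p.2 - x‖ := by
    have := (contDiff_bumpAt z hr).continuous
    fun_prop
  have hm : Measurable (Function.uncurry fun (τ : ℝ) (y : Plane) =>
      ENNReal.ofReal (τ * bumpAt z hr (τ • (y - x)) * ‖y - x‖) * ‖w.snd y‖ₑ) :=
    (ENNReal.measurable_ofReal.comp hcont.measurable).mul (hGm.comp measurable_snd)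
  rw [lintegral_lintegral_swap hm.aemeasurable]
  have h2 : ∀ y, ∫⁻ τ in Ioc 1 T, ENNReal.ofReal (τ * bumpAt z hr (τ • (y - x)) * ‖y - x‖) *
      ‖w.snd y‖ₑ ≤ ENNReal.ofReal (S * (‖z‖ + r) ^ 2) *
        (‖w.snd y‖ₑ * annulusKernel 0 (‖z‖ + r + 1) (y - x)) := fun y => by
    rw [lintegral_mul_const' _ _ enorm_ne_top, mul_left_comm, mul_comm]
    exact mul_le_mul_right (lintegral_bumpAt_dilation_le z hr hS hle (y - x) T) _
  refine (lintegral_mono h2).trans ?_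
  rw [lintegral_const_mul' _ _ ENNReal.ofReal_ne_top]
  refine mul_le_mul_right (le_of_eq ?_) _
  rw [annulusPotential, ← lintegral_indicator hΩ]
  refine lintegral_congr fun y => ?_
  by_cases hy : y ∈ Ω <;> simp [gradientSize, hy]

theorem integral_dilation_bumpAt (x : Plane) {τ : ℝ} (hτ : 0 < τ) :
    ∫ y, τ ^ 2 * bumpAt z hr (τ • (y - x)) = 1 := by
  rw [integral_const_mul, integral_sub_right_eq_self (fun y => bumpAt z hr (τ • y)) x,
    Measure.integral_comp_smul, finrank_plane, integral_bumpAt, abs_of_pos (by positivity)]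
  simp [hτ.ne']

theorem tendsto_dilationAverage (hΩ : MeasurableSet Ω) {u : Plane → ℝ}
    (hu : MemLp u 2 (volume.restrict Ω)) :
    ∀ᵐ x ∂(volume.restrict Ω), Tendsto (fun n : ℕ => dilationAverage z hr Ω u x ((n : ℝ) + 1))
      atTop (𝓝 (u x)) := by
  obtain ⟨S, hS, hle⟩ := exists_bumpAt_le z hr
  have hui : LocallyIntegrable (Ω.indicator u) volume :=
    ((memLp_indicator_iff_restrict hΩ).2 hu).locallyIntegrable one_le_two
  -- The averaging balls are not centred at `x`: their centres lie at `‖z‖ / r` times their radius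
  -- from it, an eccentricity this form of Lebesgue differentiation allows.
  have hae := IsUnifLocDoublingMeasure.ae_tendsto_average_norm_sub (μ := (volume : Measure Plane))
    hui (‖z‖ / r)
  filter_upwards [ae_restrict_of_ae hae, ae_restrict_mem hΩ] with x hx hxΩ
  set t : ℕ → ℝ := fun n => (n : ℝ) + 1
  have ht : ∀ n, 0 < t n := fun n => by positivity
  have h1 := hx (l := atTop) (fun n => x + (t n)⁻¹ • z) (fun n => (t n)⁻¹ * r)
    (tendsto_nhdsWithin_iff.2 ⟨by
      have := (tendsto_one_div_add_atTop_nhds_zero_nat (𝕜 := ℝ)).mul_const r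
      simpa [t] using this,
      Eventually.of_forall fun n => mul_pos (inv_pos.2 (ht n)) hr⟩)
    (Eventually.of_forall fun n => by
      rw [Metric.mem_closedBall, dist_eq_norm, sub_add_cancel_left, norm_neg, norm_smul,
        Real.norm_of_nonneg (inv_pos.2 (ht n)).le]
      apply le_of_eq
      field_simp)
  have h2 := tendsto_integral_smul_of_tendsto_average_norm_sub (μ := (volume : Measure Plane))
    (g := fun n y => t n ^ 2 * bumpAt z hr (t n • (y - x))) (S * r ^ 2 * discArea) h1
    (Eventually.of_forall fun n => hui.integrableOn_isCompact (isCompact_closedBall _ _))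
    (tendsto_const_nhds.congr fun n => (integral_dilation_bumpAt z hr x (ht n)).symm)
    (Eventually.of_forall fun n y hy => by
      by_contra hcon
      apply hy
      simp [bumpAt_eq_zero z hr (smul_sub_notMem_closedBall z (ht n) hcon)])
    (Eventually.of_forall fun n y => by
      have hvol : (volume : Measure Plane).real
          (Metric.closedBall (x + (t n)⁻¹ • z) ((t n)⁻¹ * r)) =
          ((t n)⁻¹ * r) ^ 2 * discArea := by
        rw [Measure.real, Measure.addHaar_closedBall _ _
          (mul_pos (inv_pos.2 (ht n)) hr).le, ENNReal.toReal_mul, finrank_plane,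
          ENNReal.toReal_ofReal (by positivity)]
        rfl
      have hω := discArea_pos
      have htn := ht n
      rw [hvol, abs_of_nonneg (mul_nonneg (sq_nonneg _) (bumpAt_nonneg z hr _))]
      have : S * r ^ 2 * discArea / (((t n)⁻¹ * r) ^ 2 * discArea) = t n ^ 2 * S := by
        field_simp
      rw [this]
      exact mul_le_mul_of_nonneg_left (hle _) (sq_nonneg _))
  rw [indicator_of_mem hxΩ] at h2
  refine h2.congr fun n => ?_
  rw [dilationAverage, ← integral_indicator hΩ]
  refine integral_congr_ae (Eventually.of_forall fun y => ?_)
  by_cases hy : y ∈ Ω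
  · simp [hy, t]; ring
  · simp [hy]

theorem abs_dilationAverage_one_le {u : Plane → ℝ} (hu : MemLp u 2 (volume.restrict Ω))
    (x : Plane) :
    |dilationAverage z hr Ω u x 1| ≤
      √(∫ y in Ω, u y ^ 2) * √(∫ y, bumpAt z hr y ^ 2) := by
  have hb := memLp_bumpAt_dilation z hr x one_pos (volume.restrict Ω)
  have hb' := (memLp_two_iff_integrable_sq (memLp_bumpAt_dilation z hr x one_pos volume).1).1
    (memLp_bumpAt_dilation z hr x one_pos volume)
  have h1 := integral_abs_mul_le hu hb
  have h2 : ∫ y in Ω, bumpAt z hr ((1 : ℝ) • (y - x)) ^ 2 ≤ ∫ y, bumpAt z hr y ^ 2 := by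
    refine (setIntegral_le_integral hb' (Eventually.of_forall fun y => sq_nonneg _)).trans
      (le_of_eq ?_)
    simp_rw [one_smul]
    exact integral_sub_right_eq_self (fun y => bumpAt z hr y ^ 2) x
  refine le_trans ?_ (h1.trans (mul_le_mul_of_nonneg_left (Real.sqrt_le_sqrt h2)
    (Real.sqrt_nonneg _)))
  rw [← Real.norm_eq_abs]
  refine (norm_integral_le_integral_norm _).trans (le_of_eq ?_)
  refine integral_congr_ae (Eventually.of_forall fun y => ?_)
  simp

end Representation

/-- Sobolev functions are controlled, at points from which a cone opens into `Ω`, by the potential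
of their gradient. -/
theorem exists_ae_le_annulusPotential {Ω : Set Plane} (z : Plane) {r : ℝ} (hr : 0 < r)
    (hΩ : MeasurableSet Ω) :
    ∃ C R : ℝ, 0 < C ∧ 0 < R ∧ ∀ w ∈ sobolevH1 Ω, ∀ᵐ x ∂(volume.restrict Ω),
      (∀ τ : ℝ, 1 ≤ τ → Metric.closedBall (x + τ⁻¹ • z) (τ⁻¹ * r) ⊆ Ω) →
      ENNReal.ofReal |w.fst x| ≤ ENNReal.ofReal C *
        (ENNReal.ofReal ‖w.fst‖ + annulusPotential 0 R (gradientSize w) x) := by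
  obtain ⟨S, hS, hle⟩ := exists_bumpAt_le z hr
  set C₁ := √(∫ y, bumpAt z hr y ^ 2)
  set C₂ := S * (‖z‖ + r) ^ 2
  have hC₁ : 0 ≤ C₁ := Real.sqrt_nonneg _
  have hC₂ : 0 < C₂ := by positivity
  refine ⟨C₁ + C₂, ‖z‖ + r + 1, by positivity, by positivity, fun w hw => ?_⟩
  filter_upwards [tendsto_dilationAverage z hr hΩ (Lp.memLp w.fst)] with x hx hcone
  have h1 := (ENNReal.continuous_ofReal.tendsto _).comp ((continuous_abs.tendsto _).comp hx)
  refine le_of_tendsto h1 (Eventually.of_forall fun n => ?_)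
  have hn : (1 : ℝ) ≤ (n : ℝ) + 1 := by linarith [(Nat.cast_nonneg n : (0 : ℝ) ≤ n)]
  have h2 := enorm_dilationAverage_sub_le z hr hΩ hS hle hw hcone hn
  have h3 := abs_dilationAverage_one_le z hr (Lp.memLp w.fst) x
  rw [← norm_L2_eq_sqrt] at h3
  simp only [Function.comp]
  have h4 : ENNReal.ofReal |dilationAverage z hr Ω w.fst x ((n : ℝ) + 1)| ≤
      ENNReal.ofReal |dilationAverage z hr Ω w.fst x 1| +
      ‖dilationAverage z hr Ω w.fst x ((n : ℝ) + 1) - dilationAverage z hr Ω w.fst x 1‖ₑ := by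
    rw [← ofReal_norm, ← ENNReal.ofReal_add (abs_nonneg _) (norm_nonneg _),
      Real.norm_eq_abs]
    refine ENNReal.ofReal_le_ofReal ?_
    linarith [abs_sub_abs_le_abs_sub (dilationAverage z hr Ω w.fst x ((n : ℝ) + 1))
      (dilationAverage z hr Ω w.fst x 1)]
  refine h4.trans ?_
  rw [mul_add]
  refine add_le_add ?_ (h2.trans (mul_le_mul_left (ENNReal.ofReal_le_ofReal (by linarith)) _))
  rw [← ENNReal.ofReal_mul (by positivity)]
  refine ENNReal.ofReal_le_ofReal (h3.trans ?_)
  rw [mul_comm]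
  exact mul_le_mul_of_nonneg_right (by linarith) (norm_nonneg _)

/-! ### Cones in smooth domains and the global potential bound -/

theorem annulusPotential_mono_radius {R R' : ℝ} (h : R ≤ R') (g : Plane → ℝ≥0∞) (x : Plane) :
    annulusPotential 0 R g x ≤ annulusPotential 0 R' g x := by
  refine lintegral_mono fun y => mul_le_mul_right (ENNReal.ofReal_le_ofReal ?_) _
  by_cases hy : ‖y - x‖ ∈ Ico 0 R
  · rw [indicator_of_mem hy, indicator_of_mem (show ‖y - x‖ ∈ Ico 0 R' from ⟨hy.1, hy.2.trans_le h⟩)]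
  · rw [indicator_of_notMem hy]
    exact indicator_nonneg (fun t ht => inv_nonneg.2 ht.1) _

/-- Near a boundary point of a smooth domain, translates of a fixed cone lie in the domain. -/
theorem exists_cone_of_graph {Ω : Set Plane} {p : Plane} {r : ℝ} {L : Plane ≃ₗᵢ[ℝ] Plane}
    {γ : ℝ → ℝ} (hr : 0 < r) (hγ : ContDiff ℝ ∞ γ)
    (hΩ : Ω ∩ Metric.ball p r = {x ∈ Metric.ball p r | γ (L x 0) < L x 1}) :
    ∃ (z : Plane) (ρ s : ℝ), 0 < ρ ∧ 0 < s ∧ ∀ x ∈ Metric.ball p s ∩ Ω, ∀ τ : ℝ, 1 ≤ τ →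
      Metric.closedBall (x + τ⁻¹ • z) (τ⁻¹ * ρ) ⊆ Ω := by
  obtain ⟨M, hM⟩ : ∃ M, LipschitzOnWith M γ (Icc (L p 0 - r) (L p 0 + r)) :=
    hγ.contDiffOn.exists_lipschitzOnWith (by simp) (convex_Icc _ _) isCompact_Icc
  set h := r / 4 with hh
  have hh0 : 0 < h := by positivity
  -- The upward shift `s h` must outweigh a vertical error `s ρ` and a variation `M s ρ` of the
  -- graph. The bound `r / 8` keeps the ball within the chart, as `r/4 + r/8 + r/8 < r`.
  set ρ := min (r / 8) (h / (1 + M)) with hρdef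
  have hρ : 0 < ρ := lt_min (by positivity) (by positivity)
  have hρ1 : ρ ≤ r / 8 := min_le_left _ _
  have hρ2 : ρ * (1 + M) ≤ h := (le_div_iff₀ (by positivity)).1 (min_le_right _ _)
  set e : Plane := EuclideanSpace.single 1 1
  have he : ‖e‖ = 1 := by simp [e]
  have hcoord : ∀ (y : Plane) (i : Fin 2), |y i| ≤ ‖y‖ := fun y i => PiLp.norm_apply_le y i
  refine ⟨L.symm (h • e), ρ, r / 8, hρ, by positivity, fun x hx τ hτ y hy => ?_⟩
  have hs0 : 0 < τ⁻¹ := by positivity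
  have hs1 : τ⁻¹ ≤ 1 := inv_le_one_of_one_le₀ hτ
  set s := τ⁻¹
  set w := y - (x + s • L.symm (h • e)) with hw
  have hwn : ‖w‖ ≤ s * ρ := by rwa [Metric.mem_closedBall, dist_eq_norm] at hy
  have hxp : ‖x - p‖ < r / 8 := by simpa [dist_eq_norm] using hx.1
  have hLy : L y = L x + s • h • e + L w := by
    have : y = x + s • L.symm (h • e) + w := by rw [hw]; abel
    conv_lhs => rw [this]
    simp
  have hyx : ‖y - x‖ ≤ s * h + s * ρ := by
    have : y - x = s • L.symm (h • e) + w := by rw [hw]; abel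
    rw [this]
    refine (norm_add_le _ _).trans (add_le_add (le_of_eq ?_) hwn)
    rw [norm_smul, LinearIsometryEquiv.norm_map, norm_smul, he, Real.norm_of_nonneg hs0.le,
      Real.norm_of_nonneg hh0.le, mul_one]
  have hsh : s * h ≤ h := mul_le_of_le_one_left hh0.le hs1
  have hsρ : s * ρ ≤ ρ := mul_le_of_le_one_left hρ.le hs1
  have hyp : ‖y - p‖ < r := by
    have : y - p = (y - x) + (x - p) := by abel
    rw [this]
    refine (norm_add_le _ _).trans_lt ?_
    linarith
  have hmem : ∀ q : Plane, ‖q - p‖ < r → L q 0 ∈ Icc (L p 0 - r) (L p 0 + r) := fun q hq => by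
    have h1 := hcoord (L (q - p)) 0
    rw [L.norm_map, map_sub, PiLp.sub_apply] at h1
    have := abs_le.1 h1
    constructor <;> linarith
  have hgx : γ (L x 0) < L x 1 := by
    have : x ∈ Ω ∩ Metric.ball p r := ⟨hx.2, Metric.ball_subset_ball (by linarith) hx.1⟩
    rw [hΩ] at this
    exact this.2
  have hyb : y ∈ Metric.ball p r := by rwa [Metric.mem_ball, dist_eq_norm]
  have hy' : y ∈ {x ∈ Metric.ball p r | γ (L x 0) < L x 1} := by
    refine ⟨hyb, ?_⟩
    have h0 : L y 0 = L x 0 + L w 0 := by rw [hLy]; simp [e]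
    have h1 : L y 1 = L x 1 + s * h + L w 1 := by rw [hLy]; simp [e]
    have hd := hM.dist_le_mul _ (hmem y hyp) _ (hmem x (by linarith))
    rw [Real.dist_eq, Real.dist_eq, h0, add_sub_cancel_left, ← h0] at hd
    have hLw : ‖L w‖ ≤ s * ρ := by rwa [L.norm_map]
    have hw0 := (hcoord (L w) 0).trans hLw
    have hw1 := (hcoord (L w) 1).trans hLw
    have h2 : (M : ℝ) * |L w 0| ≤ M * (s * ρ) := mul_le_mul_of_nonneg_left hw0 M.2
    have h3 : s * (ρ * (1 + M)) ≤ s * h := mul_le_mul_of_nonneg_left hρ2 hs0.le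
    have h4 := (abs_le.1 hd).2
    have h5 := (abs_le.1 hw1).1
    rw [h1]
    nlinarith
  rw [← hΩ] at hy'
  exact hy'.1

theorem IsSmoothBoundedDomain.exists_cone {Ω : Set Plane} (hΩ : IsSmoothBoundedDomain Ω)
    {p : Plane} (hp : p ∈ closure Ω) :
    ∃ (z : Plane) (ρ s : ℝ), 0 < ρ ∧ 0 < s ∧ ∀ x ∈ Metric.ball p s ∩ Ω, ∀ τ : ℝ, 1 ≤ τ →
      Metric.closedBall (x + τ⁻¹ • z) (τ⁻¹ * ρ) ⊆ Ω := by
  by_cases hpΩ : p ∈ Ω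
  · obtain ⟨r, hr, hball⟩ := Metric.isOpen_iff.1 hΩ.1 p hpΩ
    -- At an interior point `z = 0` suffices: the cone degenerates to concentric balls.
    refine ⟨0, r / 2, r / 2, by positivity, by positivity, fun x hx τ hτ y hy => hball ?_⟩
    rw [smul_zero, add_zero, Metric.mem_closedBall] at hy
    have h1 : τ⁻¹ * (r / 2) ≤ r / 2 :=
      mul_le_of_le_one_left (by positivity) (inv_le_one_of_one_le₀ hτ)
    have h2 := Metric.mem_ball.1 hx.1
    have h3 := dist_triangle y x p
    rw [Metric.mem_ball]
    linarith
  · obtain ⟨r, L, γ, hr, hγ, h⟩ := hΩ.2.2.2 p ⟨hp, by rwa [hΩ.1.interior_eq]⟩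
    exact exists_cone_of_graph hr hγ h

/-- The pointwise bound of Sobolev functions by a multiple of the potential of their gradient, at
almost every point of a set `s`. -/
def HasPotentialBound (Ω s : Set Plane) : Prop :=
  ∃ C R : ℝ, 0 < C ∧ 0 < R ∧ ∀ w ∈ sobolevH1 Ω, ∀ᵐ x ∂(volume.restrict Ω), x ∈ s →
    ENNReal.ofReal |w.fst x| ≤ ENNReal.ofReal C *
      (ENNReal.ofReal ‖w.fst‖ + annulusPotential 0 R (gradientSize w) x)

theorem HasPotentialBound.mono {Ω s t : Set Plane} (hst : s ⊆ t) (h : HasPotentialBound Ω t) :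
    HasPotentialBound Ω s := by
  obtain ⟨C, R, hC, hR, h⟩ := h
  refine ⟨C, R, hC, hR, fun w hw => ?_⟩
  filter_upwards [h w hw] with x hx hxs using hx (hst hxs)

theorem HasPotentialBound.union {Ω s t : Set Plane} (hs : HasPotentialBound Ω s)
    (ht : HasPotentialBound Ω t) : HasPotentialBound Ω (s ∪ t) := by
  obtain ⟨C, R, hC, hR, h⟩ := hs
  obtain ⟨C', R', hC', hR', h'⟩ := ht
  refine ⟨max C C', max R R', lt_max_of_lt_left hC, lt_max_of_lt_left hR, fun w hw => ?_⟩
  filter_upwards [h w hw, h' w hw] with x h1 h2 hx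
  rcases hx with hx | hx
  · exact (h1 hx).trans (mul_le_mul' (ENNReal.ofReal_le_ofReal (le_max_left _ _))
      (add_le_add le_rfl (annulusPotential_mono_radius (le_max_left _ _) _ _)))
  · exact (h2 hx).trans (mul_le_mul' (ENNReal.ofReal_le_ofReal (le_max_right _ _))
      (add_le_add le_rfl (annulusPotential_mono_radius (le_max_right _ _) _ _)))

theorem hasPotentialBound_univ : HasPotentialBound univ univ := by
  obtain ⟨C, R, hC, hR, h⟩ := exists_ae_le_annulusPotential (0 : Plane) one_pos MeasurableSet.univ
  refine ⟨C, R, hC, hR, fun w hw => ?_⟩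
  filter_upwards [h w hw] with x hx _ using hx fun _ _ => subset_univ _

/-- Each point of the compact closure has a neighbourhood with its own cone, hence its own
constants; finitely many neighbourhoods suffice, and the bounds pass to unions by taking maxima. -/
theorem IsSmoothBoundedDomain.hasPotentialBound {Ω : Set Plane} (hΩ : IsSmoothBoundedDomain Ω) :
    HasPotentialBound Ω Ω := by
  refine HasPotentialBound.mono subset_closure ?_
  refine IsCompact.induction_on (p := HasPotentialBound Ω) hΩ.2.2.1.isCompact_closure
    ⟨1, 1, one_pos, one_pos, fun w hw => Eventually.of_forall fun x hx => hx.elim⟩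
    (fun s t hst ht => ht.mono hst) (fun s t hs ht => hs.union ht) fun p hp => ?_
  obtain ⟨z, ρ, s, hρ, hs, hcone⟩ := hΩ.exists_cone hp
  refine ⟨Metric.ball p s, mem_nhdsWithin_of_mem_nhds (Metric.ball_mem_nhds p hs), ?_⟩
  obtain ⟨C, R, hC, hR, h⟩ := exists_ae_le_annulusPotential z hρ hΩ.1.measurableSet
  refine ⟨C, R, hC, hR, fun w hw => ?_⟩
  filter_upwards [h w hw, ae_restrict_mem hΩ.1.measurableSet] with x hx hxΩ hxs
  exact hx (hcone x ⟨hxs, hxΩ⟩)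

/-! ### Trudinger's inequality -/

theorem lintegral_gradientSize_sq {Ω : Set Plane} (hΩ : MeasurableSet Ω) (w : SobolevPair Ω) :
    ∫⁻ x, gradientSize w x ^ 2 = ENNReal.ofReal (‖w.snd‖ ^ 2) := by
  have h1 : ∀ x, gradientSize w x ^ 2 = Ω.indicator (fun y => ‖w.snd y‖ₑ ^ 2) x := fun x => by
    by_cases hx : x ∈ Ω <;> simp [gradientSize, hx]
  simp_rw [h1]
  rw [lintegral_indicator hΩ, ← real_inner_self_eq_norm_sq, L2.inner_def,
    ofReal_integral_eq_lintegral_ofReal]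
  · refine lintegral_congr fun x => ?_
    rw [real_inner_self_eq_norm_sq, ENNReal.ofReal_pow (norm_nonneg _), ofReal_norm]
  · exact L2.integrable_inner w.snd w.snd
  · exact Eventually.of_forall fun x => real_inner_self_nonneg

theorem lintegral_sq_eq_norm_sq {Ω : Set Plane} (u : Lp ℝ 2 ((volume : Measure Plane).restrict Ω)) :
    ∫⁻ x in Ω, ENNReal.ofReal (u x ^ 2) = ENNReal.ofReal (‖u‖ ^ 2) := by
  rw [← ofReal_integral_eq_lintegral_ofReal, norm_L2_eq_sqrt, Real.sq_sqrt]
  · exact integral_nonneg fun x => sq_nonneg _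
  · exact (Lp.memLp u).integrable_sq
  · exact Eventually.of_forall fun x => sq_nonneg _

/-- Exponential integrability of functions controlled by the potential of a function of small
norm in `L²`. -/
theorem modular_Phi_le_of_le_potential {Ω : Set Plane} {u : Plane → ℝ} {g : Plane → ℝ≥0∞}
    (hu : AEMeasurable u (volume.restrict Ω)) (hg : Measurable g) {A C R δ s : ℝ} (hA : 0 ≤ A)
    (hC : 0 < C) (hR : 0 < R) (hδ : 0 < δ) (hs : 0 < s)
    (hgδ : ∫⁻ y, g y ^ 2 ≤ ENNReal.ofReal (δ ^ 2))
    (hle : ∀ᵐ x ∂(volume.restrict Ω), ENNReal.ofReal |u x| ≤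
      ENNReal.ofReal A + ENNReal.ofReal C * annulusPotential 0 R g x)
    (hsδ : 32 * C ^ 2 * discArea * δ ^ 2 ≤ s ^ 2) :
    modular Phi.toFun Ω s u ≤
      ENNReal.ofReal (Real.exp ((max 1 (2 * A / s)) ^ 2)) *
        (∫⁻ x in Ω, ENNReal.ofReal ((u x / s) ^ 2)) +
      ENNReal.ofReal (2 * discArea * R ^ 2) * ∑' j : ℕ, ENNReal.ofReal (Real.exp (1 - j)) := by
  have hω := discArea_pos
  have key := lintegral_Phi_le_of_tail (μ := volume.restrict Ω) (v := fun x => u x / s)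
    (hu.div_const s) (l₀ := max 1 (2 * A / s)) (K := ENNReal.ofReal (2 * discArea * R ^ 2)) ?_
  · refine le_trans (le_of_eq ?_) key
    unfold modular
    refine lintegral_congr fun x => ?_
    rw [← abs_of_pos hs, ← abs_div, Phi.map_abs, abs_of_pos hs]
  intro l hl
  have hl1 : 1 ≤ l := (le_max_left _ _).trans hl
  have hl0 : 0 < l := by linarith
  have hlA : A ≤ s * l / 2 := by
    have := (le_max_right _ _).trans hl
    rw [div_le_iff₀ hs] at this
    linarith
  -- Since `A ≤ s l / 2`, the inequality `|u| > s l` forces the potential to exceed `l'`. The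
  -- condition on `s` and `δ` is exactly that the tail at `l'` decays at least like `exp(-2l²)`, the
  -- rate required by `lintegral_Phi_le_of_tail`.
  set l' := s * l / (2 * C) with hl'
  have hl'0 : 0 < l' := by positivity
  have h1 : (volume.restrict Ω) {x | l < |u x / s|} ≤
      (volume.restrict Ω) {x | ENNReal.ofReal l' < annulusPotential 0 R g x} := by
    refine measure_mono_ae ?_
    filter_upwards [hle] with x hx hxl
    change l < |u x / s| at hxl
    change ENNReal.ofReal l' < annulusPotential 0 R g x
    by_contra hcon
    rw [not_lt] at hcon
    have h2 : ENNReal.ofReal |u x| ≤ ENNReal.ofReal (A + C * l') := by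
      rw [ENNReal.ofReal_add hA (by positivity), ENNReal.ofReal_mul hC.le]
      exact hx.trans (add_le_add le_rfl (mul_le_mul_right hcon _))
    rw [ENNReal.ofReal_le_ofReal_iff (by positivity)] at h2
    rw [abs_div, abs_of_pos hs, lt_div_iff₀ hs] at hxl
    have h3 : C * l' = s * l / 2 := by rw [hl']; field_simp
    linarith
  refine h1.trans ((Measure.restrict_apply_le _ _).trans
    ((volume_annulusPotential_gt_le hg hδ hR hl'0 hgδ).trans ?_))
  rw [← ENNReal.ofReal_mul (by positivity)]
  refine ENNReal.ofReal_le_ofReal (mul_le_mul ?_ (Real.exp_le_exp.2 ?_) (Real.exp_pos _).le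
    (by positivity))
  · rw [div_le_iff₀ (by positivity), hl', div_pow, mul_pow, mul_pow, ← mul_div_assoc,
      le_div_iff₀ (by positivity)]
    have h4 : 32 * C ^ 2 * discArea * δ ^ 2 * 1 ≤ s ^ 2 * l ^ 2 :=
      mul_le_mul hsδ (one_le_pow₀ hl1) zero_le_one (by positivity)
    calc 16 * discArea ^ 2 * R ^ 2 * δ ^ 2 * (2 ^ 2 * C ^ 2)
        = 2 * discArea * R ^ 2 * (32 * C ^ 2 * discArea * δ ^ 2 * 1) := by ring
      _ ≤ 2 * discArea * R ^ 2 * (s ^ 2 * l ^ 2) := mul_le_mul_of_nonneg_left h4 (by positivity)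
  · rw [neg_le_neg_iff, le_div_iff₀ (by positivity), hl', div_pow, le_div_iff₀ (by positivity)]
    calc 2 * l ^ 2 * (4 * discArea * δ ^ 2) * (2 * C) ^ 2
        = 32 * C ^ 2 * discArea * δ ^ 2 * l ^ 2 := by ring
      _ ≤ s ^ 2 * l ^ 2 := mul_le_mul_of_nonneg_right hsδ (sq_nonneg l)
      _ = (s * l) ^ 2 := by ring

/-- A square integrable function is the sum of a bounded one and one of small norm. -/
theorem exists_truncation {g : Plane → ℝ≥0∞} (hg : Measurable g) (htop : ∀ x, g x ≠ ⊤)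
    (hint : ∫⁻ x, g x ^ 2 ≠ ⊤) {ε : ℝ≥0∞} (hε : 0 < ε) :
    ∃ (N : ℕ) (g₁ g₂ : Plane → ℝ≥0∞), Measurable g₁ ∧ Measurable g₂ ∧ (∀ x, g x = g₁ x + g₂ x) ∧
      (∀ x, g₁ x ≤ N) ∧ ∫⁻ x, g₂ x ^ 2 ≤ ε := by
  have hms : ∀ n : ℕ, MeasurableSet {x | g x ≤ n} := fun n => measurableSet_le hg measurable_const
  have ht : Tendsto (fun n : ℕ => ∫⁻ x, ({x | g x ≤ n}ᶜ).indicator g x ^ 2) atTop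
      (𝓝 (∫⁻ _ : Plane, 0)) := by
    refine tendsto_lintegral_of_dominated_convergence (fun x => g x ^ 2)
      (fun n => (hg.indicator (hms n).compl).pow_const 2)
      (fun n => Eventually.of_forall fun x => ?_) hint (Eventually.of_forall fun x => ?_)
    · exact pow_le_pow_left' (indicator_le_self' (fun _ _ => zero_le) x) 2
    · obtain ⟨n, hn⟩ := ENNReal.exists_nat_gt (htop x)
      refine tendsto_const_nhds.congr' ?_
      filter_upwards [eventually_ge_atTop n] with m hm
      have : g x ≤ m := hn.le.trans (by exact_mod_cast hm)
      simp [this]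
  rw [lintegral_zero] at ht
  obtain ⟨N, hN⟩ := (ht.eventually (ge_mem_nhds hε)).exists
  refine ⟨N, {x | g x ≤ N}.indicator g, ({x | g x ≤ N}ᶜ).indicator g, hg.indicator (hms N),
    hg.indicator (hms N).compl, fun x => ?_, fun x => ?_, hN⟩
  · exact (congrFun (indicator_self_add_compl {x | g x ≤ N} g) x).symm
  · by_cases hx : g x ≤ N <;> simp [hx]

section Trudinger

variable {Ω : Set Plane} (hΩ : MeasurableSet Ω) (hb : HasPotentialBound Ω Ω)

include hΩ hb

/-- The gradient splits into a bounded part, whose potential is bounded and is absorbed into `A`,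
and a part of L² norm as small as the scale `s` demands. Arbitrarily small scales are what
membership in `EPhi Ω` requires. -/
theorem modular_lt_top_of_mem_sobolevH1 {w : SobolevPair Ω} (hw : w ∈ sobolevH1 Ω) {s : ℝ}
    (hs : 0 < s) : modular Phi.toFun Ω s w.fst < ⊤ := by
  obtain ⟨C, R, hC, hR, h⟩ := hb
  have hω := discArea_pos
  have hsq := lintegral_gradientSize_sq hΩ w
  set δ := s / √(32 * C ^ 2 * discArea) with hδdef
  have hδ : 0 < δ := by positivity
  obtain ⟨N, g₁, g₂, hg₁, hg₂, hsum, hN, hg₂δ⟩ := exists_truncation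
    (measurable_gradientSize hΩ w) (fun x => by by_cases hx : x ∈ Ω <;> simp [gradientSize, hx])
    (by rw [hsq]; exact ENNReal.ofReal_ne_top)
    (ε := ENNReal.ofReal (δ ^ 2)) (ENNReal.ofReal_pos.2 (by positivity))
  set A := C * (‖w.fst‖ + N * (2 * discArea * R)) with hAdef
  have hA : 0 ≤ A := by positivity
  have hu : AEMeasurable w.fst (volume.restrict Ω) :=
    (Lp.aestronglyMeasurable w.fst).aemeasurable
  refine (modular_Phi_le_of_le_potential hu hg₂ hA hC hR hδ hs hg₂δ ?_ ?_).trans_lt ?_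
  · filter_upwards [h w hw, ae_restrict_mem hΩ] with x hx hxΩ
    refine (hx hxΩ).trans ?_
    have hg : gradientSize w = fun y => g₁ y + g₂ y := funext hsum
    rw [hg, annulusPotential_add hg₁, ← add_assoc, mul_add, hAdef, ENNReal.ofReal_mul hC.le,
      ENNReal.ofReal_add (norm_nonneg _) (by positivity), ENNReal.ofReal_mul (Nat.cast_nonneg N),
      ENNReal.ofReal_natCast]
    gcongr
    exact annulusPotential_le_of_le hN hR x
  · rw [hδdef, div_pow, Real.sq_sqrt (by positivity)]
    apply le_of_eq
    field_simp
  · refine ENNReal.add_lt_top.2 ⟨ENNReal.mul_lt_top ENNReal.ofReal_lt_top ?_,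
      ENNReal.mul_lt_top ENNReal.ofReal_lt_top tsum_exp_one_sub_lt_top⟩
    have h1 : ∀ x, ENNReal.ofReal ((w.fst x / s) ^ 2) =
        ENNReal.ofReal (s ^ 2)⁻¹ * ENNReal.ofReal (w.fst x ^ 2) := fun x => by
      rw [← ENNReal.ofReal_mul (by positivity), div_pow, div_eq_inv_mul]
    simp_rw [h1]
    rw [lintegral_const_mul' _ _ ENNReal.ofReal_ne_top, lintegral_sq_eq_norm_sq]
    exact ENNReal.mul_lt_top ENNReal.ofReal_lt_top ENNReal.ofReal_lt_top

/-- The Trudinger inequality. -/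
theorem exists_modular_le_one_of_norm_le_one :
    ∃ s : ℝ, 0 < s ∧ ∀ w ∈ sobolevH1 Ω, ‖w‖ ≤ 1 → modular Phi.toFun Ω s w.fst ≤ 1 := by
  obtain ⟨C, R, hC, hR, h⟩ := hb
  have hω := discArea_pos
  -- Chosen so that `s² ≥ 32 C² discArea`, the condition for `δ = 1`; no splitting of the gradient
  -- is needed, so the bound `B` is uniform on the unit ball.
  set s := C * (2 + √(32 * discArea)) with hsdef
  have hs : 0 < s := by positivity
  set B : ℝ≥0∞ := ENNReal.ofReal (Real.exp ((max 1 (2 * C / s)) ^ 2)) * ENNReal.ofReal (s ^ 2)⁻¹ +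
      ENNReal.ofReal (2 * discArea * R ^ 2) * ∑' j : ℕ, ENNReal.ofReal (Real.exp (1 - j))
  have hB : B ≠ ⊤ := (ENNReal.add_lt_top.2 ⟨ENNReal.mul_lt_top ENNReal.ofReal_lt_top
    ENNReal.ofReal_lt_top, ENNReal.mul_lt_top ENNReal.ofReal_lt_top tsum_exp_one_sub_lt_top⟩).ne
  -- Enlarging the scale by the factor `max 1 B` brings the modular from `B` down to at most `1`, by
  -- convexity.
  refine ⟨s * max 1 B.toReal, by positivity, fun w hw hw1 => ?_⟩
  have hn := WithLp.prod_norm_sq_eq_of_L2 w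
  have hwsq : ‖w‖ ^ 2 ≤ 1 := pow_le_one₀ (norm_nonneg _) hw1
  have hf : ‖w.fst‖ ^ 2 ≤ 1 := by nlinarith [sq_nonneg ‖w.snd‖]
  have hf1 : ‖w.fst‖ ≤ 1 := by nlinarith [norm_nonneg w.fst]
  have hd : ‖w.snd‖ ^ 2 ≤ 1 ^ 2 := by nlinarith [sq_nonneg ‖w.fst‖]
  have hu : AEMeasurable w.fst (volume.restrict Ω) :=
    (Lp.aestronglyMeasurable w.fst).aemeasurable
  have hle : modular Phi.toFun Ω s w.fst ≤ B := by
    refine (modular_Phi_le_of_le_potential hu (measurable_gradientSize hΩ w) hC.le hC hR one_pos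
      hs ?_ ?_ ?_).trans ?_
    · rw [lintegral_gradientSize_sq hΩ]
      exact ENNReal.ofReal_le_ofReal hd
    · filter_upwards [h w hw, ae_restrict_mem hΩ] with x hx hxΩ
      refine (hx hxΩ).trans ?_
      rw [mul_add]
      gcongr
      exact mul_le_of_le_one_right zero_le (ENNReal.ofReal_le_one.2 hf1)
    · have h0 := Real.sqrt_nonneg (32 * discArea)
      have h2 := Real.sq_sqrt (show 0 ≤ 32 * discArea by positivity)
      have h3 : 32 * discArea ≤ (2 + √(32 * discArea)) ^ 2 := by nlinarith
      rw [hsdef, mul_pow]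
      nlinarith [mul_le_mul_of_nonneg_left h3 (sq_nonneg C)]
    · refine add_le_add (mul_le_mul_right ?_ _) le_rfl
      have h1 : ∀ x, ENNReal.ofReal ((w.fst x / s) ^ 2) =
          ENNReal.ofReal (s ^ 2)⁻¹ * ENNReal.ofReal (w.fst x ^ 2) := fun x => by
        rw [← ENNReal.ofReal_mul (by positivity), div_pow, div_eq_inv_mul]
      simp_rw [h1]
      rw [lintegral_const_mul' _ _ ENNReal.ofReal_ne_top, lintegral_sq_eq_norm_sq]
      exact mul_le_of_le_one_right zero_le (ENNReal.ofReal_le_one.2 hf)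
  refine (modular_scale (le_max_left _ _) _).trans ((mul_le_mul_right hle _).trans ?_)
  rw [← ENNReal.ofReal_toReal hB, ← ENNReal.ofReal_mul (by positivity)]
  refine ENNReal.ofReal_le_one.2 ?_
  rw [ENNReal.toReal_ofReal ENNReal.toReal_nonneg, inv_mul_le_one₀ (by positivity)]
  exact le_max_right _ _

end Trudinger

/-! ### The embedding of H¹ and H¹₀ into E_Φ -/

section Embedding

variable {Ω : Set Plane}

theorem mem_sobolevH1_iff {w : SobolevPair Ω} :
    w ∈ sobolevH1 Ω ↔ ∀ φ : Plane → ℝ, IsTestFunction Ω φ → ∀ c : Plane,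
      ∫ y in Ω, w.fst y * fderiv ℝ φ y c = -∫ y in Ω, φ y * inner ℝ c (w.snd y) := by
  refine ⟨fun hw φ hφ c => integral_mul_fderiv_of_mem_sobolevH1 hw hφ c, fun h φ hφ => ?_⟩
  refine ext_inner_left ℝ fun c => ?_
  rw [inner_neg_right, ← integral_inner (integrable_smul_gradient _ hφ),
    ← integral_inner (integrable_smul_field _ hφ)]
  simpa only [inner_smul_right, inner_gradient] using h φ hφ c

theorem IsTestFunction.continuous_fderiv_apply {φ : Plane → ℝ} (hφ : IsTestFunction Ω φ)
    (c : Plane) : Continuous fun y => fderiv ℝ φ y c :=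
  (hφ.1.continuous_fderiv (by simp)).clm_apply continuous_const

theorem IsTestFunction.hasCompactSupport_fderiv_apply {φ : Plane → ℝ} (hφ : IsTestFunction Ω φ)
    (c : Plane) : HasCompactSupport fun y => fderiv ℝ φ y c :=
  hφ.2.1.fderiv_apply (𝕜 := ℝ) c

/-- Each scalar condition defining the weak gradient equates two inner products with fixed L²
functions, and so is closed. This carries the inclusion of test pairs over to `sobolevH10`. -/
theorem isClosed_sobolevH1 : IsClosed (sobolevH1 Ω : Set (SobolevPair Ω)) := by
  have h1 : (sobolevH1 Ω : Set (SobolevPair Ω)) = ⋂ (φ : Plane → ℝ) (_ : IsTestFunction Ω φ)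
      (c : Plane), {w | ∫ y in Ω, w.fst y * fderiv ℝ φ y c =
        -∫ y in Ω, φ y * inner ℝ c (w.snd y)} := by
    ext w
    simp only [mem_iInter, mem_ofPred_eq]
    exact mem_sobolevH1_iff
  rw [h1]
  refine isClosed_iInter fun φ => isClosed_iInter fun hφ => isClosed_iInter fun c => ?_
  have ha : MemLp (fun y => fderiv ℝ φ y c) 2 (volume.restrict Ω) :=
    (hφ.continuous_fderiv_apply c).memLp_of_hasCompactSupport (hφ.hasCompactSupport_fderiv_apply c)
  have hb : MemLp (fun y => φ y • c) 2 (volume.restrict Ω) :=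
    (hφ.1.continuous.smul continuous_const).memLp_of_hasCompactSupport hφ.2.1.smul_right
  have e1 : ∀ w : SobolevPair Ω, ∫ y in Ω, w.fst y * fderiv ℝ φ y c =
      inner ℝ (ha.toLp _) w.fst := fun w => by
    rw [L2.inner_def]
    refine integral_congr_ae ?_
    filter_upwards [ha.coeFn_toLp] with y hy
    rw [hy]
    simp
  have e2 : ∀ w : SobolevPair Ω, ∫ y in Ω, φ y * inner ℝ c (w.snd y) =
      inner ℝ (hb.toLp _) w.snd := fun w => by
    rw [L2.inner_def]
    refine integral_congr_ae ?_
    filter_upwards [hb.coeFn_toLp] with y hy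
    rw [hy, real_inner_smul_left]
  simp_rw [e1, e2]
  exact isClosed_eq (continuous_const.inner (WithLp.fstL 2 ℝ _ _).continuous)
    (continuous_const.inner (WithLp.sndL 2 ℝ _ _).continuous).neg

theorem testPairs_subset_sobolevH1 : testPairs Ω ⊆ sobolevH1 Ω := by
  rintro w ⟨ψ, hψ, h1, h2⟩
  refine mem_sobolevH1_iff.2 fun φ hφ c => ?_
  have e1 : ∫ y in Ω, w.fst y * fderiv ℝ φ y c = ∫ y in Ω, ψ y * fderiv ℝ φ y c := by
    refine integral_congr_ae ?_
    filter_upwards [h1] with y hy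
    rw [hy]
  have e2 : ∫ y in Ω, φ y * inner ℝ c (w.snd y) = ∫ y in Ω, fderiv ℝ ψ y c * φ y := by
    refine integral_congr_ae ?_
    filter_upwards [h2] with y hy
    rw [hy, inner_gradient, mul_comm]
  have hψ0 : ∀ y ∉ Ω, ψ y = 0 := fun y hy =>
    image_eq_zero_of_notMem_tsupport fun h => hy (hψ.2.2 h)
  have hφ0 : ∀ y ∉ Ω, φ y = 0 := fun y hy =>
    image_eq_zero_of_notMem_tsupport fun h => hy (hφ.2.2 h)
  rw [e1, e2, setIntegral_eq_integral_of_forall_compl_eq_zero fun y hy => by rw [hψ0 y hy, zero_mul],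
    setIntegral_eq_integral_of_forall_compl_eq_zero fun y hy => by rw [hφ0 y hy, mul_zero]]
  have hdiff : ∀ {θ : Plane → ℝ}, IsTestFunction Ω θ → Differentiable ℝ θ := fun hθ =>
    hθ.1.differentiable (by simp)
  refine integral_mul_fderiv_eq_neg_fderiv_mul_of_integrable ?_ ?_ ?_
    (fun x _ => hdiff hψ x) (fun x _ => hdiff hφ x)
  · exact ((hψ.continuous_fderiv_apply c).mul hφ.1.continuous).integrable_of_hasCompactSupport
      hφ.2.1.mul_left
  · exact (hψ.1.continuous.mul (hφ.continuous_fderiv_apply c)).integrable_of_hasCompactSupport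
      hψ.2.1.mul_right
  · exact (hψ.1.continuous.mul hφ.1.continuous).integrable_of_hasCompactSupport hφ.2.1.mul_left

theorem sobolevH10_le_sobolevH1 : sobolevH10 Ω ≤ sobolevH1 Ω :=
  Submodule.topologicalClosure_minimal _ (Submodule.span_le.2 testPairs_subset_sobolevH1)
    isClosed_sobolevH1

/-- The embedding of subspaces of `H¹(Ω)` into `E_Φ(Ω)`. -/
theorem exists_embedding (hΩ : MeasurableSet Ω) (hdom : volume Ω < ⊤ ∨ Ω = univ)
    (hb : HasPotentialBound Ω Ω) {X : Submodule ℝ (SobolevPair Ω)} (hX : X ≤ sobolevH1 Ω) :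
    ∃ ι : X →L[ℝ] EPhi Ω, ∀ w : X, (ι w).1.rep =ᵐ[volume.restrict Ω] w.1.fst := by
  have hmeas : ∀ w : X, AEMeasurable w.1.fst (volume.restrict Ω) := fun w =>
    (Lp.aestronglyMeasurable w.1.fst).aemeasurable
  have hmem : ∀ w : X, MemOrlicz Phi.toFun Ω w.1.fst := fun w =>
    ⟨locallyIntegrableOn_of_memLp (Lp.memLp _), 1, one_pos,
      modular_lt_top_of_mem_sobolevH1 hΩ hb (hX w.2) one_pos⟩
  have hrep := fun w : X => OrliczSpace.rep_ofFun (hmeas w) (hmem w)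
  have hE : ∀ w : X, OrliczSpace.ofFun _ (hmeas w) (hmem w) ∈ EPhi Ω := fun w =>
    (mem_orliczE_iff hdom _).2 fun r hr => by
      rw [modular_congr (hrep w)]
      exact modular_lt_top_of_mem_sobolevH1 hΩ hb (hX w.2) hr
  let T : X →ₗ[ℝ] EPhi Ω :=
    { toFun := fun w => ⟨OrliczSpace.ofFun _ (hmeas w) (hmem w), hE w⟩
      map_add' := fun v w => Subtype.ext (OrliczSpace.ext_rep (by
        refine (hrep (v + w)).trans (EventuallyEq.trans ?_ (OrliczSpace.rep_add _ _).symm)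
        filter_upwards [Lp.coeFn_add v.1.fst w.1.fst, hrep v, hrep w] with x h1 h2 h3
        rw [h2, h3]
        exact h1))
      map_smul' := fun c w => Subtype.ext (OrliczSpace.ext_rep (by
        refine (hrep (c • w)).trans (EventuallyEq.trans ?_ (OrliczSpace.rep_smul _ _).symm)
        filter_upwards [Lp.coeFn_smul c w.1.fst, hrep w] with x h1 h2
        rw [h2]
        exact h1)) }
  obtain ⟨s, hs, hbound⟩ := exists_modular_le_one_of_norm_le_one hΩ hb
  have hball : ∀ w : X, ‖w‖ ≤ 1 → ‖T w‖ ≤ s := fun w hw => by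
    refine OrliczSpace.norm_le_of_mem ⟨hs, ?_⟩
    exact (modular_congr (hrep w)).trans_le (hbound w.1 (hX w.2) hw)
  refine ⟨T.mkContinuous s fun w => ?_, fun w => hrep w⟩
  rcases eq_or_ne w 0 with rfl | hw
  · simp
  have hw' : 0 < ‖w‖ := norm_pos_iff.2 hw
  have h1 := hball (‖w‖⁻¹ • w) (by
    rw [norm_smul, norm_inv, norm_norm, inv_mul_cancel₀ hw'.ne'])
  rwa [map_smul, norm_smul, norm_inv, norm_norm, inv_mul_le_iff₀ hw', mul_comm] at h1

end Embedding

/-! ### Reduction of the two growth conditions to one -/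

section Growth

/-- Expand by `(a + b)² ≤ 2a² + 2b²`. The linear term is absorbed through `2αt² ≤ exp(2αt²) - 1`,
and the scale `(2α)^(-1/2)` turns the right side of this into `Φ`. -/
theorem sq_le_of_growth {α c₁ c₂ t ξ G B : ℝ} (hα : 0 < α) (hB : 0 ≤ B)
    (hc₁ : 0 < c₁) (hc₂ : 0 < c₂) (hGB : G ^ 2 ≤ Real.exp (2 * α * t ^ 2) - 1 + B)
    (hξ : |ξ| ≤ c₁ * |t| + c₂ * G) :
    ξ ^ 2 ≤ (c₁ ^ 2 / α + 2 * c₂ ^ 2) * (Phi.toFun (|t| / (√(2 * α))⁻¹) + B) := by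
  rw [Phi_apply, div_inv_eq_mul, mul_pow, sq_abs, Real.sq_sqrt (by positivity),
    mul_comm (t ^ 2)]
  have h1 : ξ ^ 2 ≤ (c₁ * |t| + c₂ * G) ^ 2 := by
    rw [← sq_abs ξ]
    exact pow_le_pow_left₀ (abs_nonneg _) hξ 2
  have h2 : 2 * α * t ^ 2 ≤ Real.exp (2 * α * t ^ 2) - 1 := by
    linarith [Real.add_one_le_exp (2 * α * t ^ 2)]
  have h3 : c₁ ^ 2 / α * (2 * α * t ^ 2) ≤ c₁ ^ 2 / α * (Real.exp (2 * α * t ^ 2) - 1 + B) :=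
    mul_le_mul_of_nonneg_left (by linarith) (by positivity)
  have h4 : c₁ ^ 2 / α * (2 * α * t ^ 2) = 2 * (c₁ * |t|) ^ 2 := by
    rw [mul_pow, sq_abs]
    field_simp
  have h5 : 2 * c₂ ^ 2 * G ^ 2 ≤ 2 * c₂ ^ 2 * (Real.exp (2 * α * t ^ 2) - 1 + B) :=
    mul_le_mul_of_nonneg_left hGB (by positivity)
  linarith [sq_nonneg (c₁ * |t| - c₂ * G)]

theorem IsSmoothBoundedDomain.volume_lt_top {Ω : Set Plane} (hΩ : IsSmoothBoundedDomain Ω) :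
    volume Ω < ⊤ := hΩ.2.2.1.measure_lt_top

theorem exists_admissible {Ω : Set Plane} {f : Plane → ℝ → ℝ}
    (hf_int : ∀ x, LocallyIntegrable (f x) volume)
    (hF_meas : ∀ t, AEMeasurable (fun x => primitive f x t) volume)
    (hF_lip : ∀ x, LocallyLipschitz (primitive f x))
    (hΩ : (IsSmoothBoundedDomain Ω ∧ GrowthBounded f) ∨ (Ω = Set.univ ∧ GrowthPlane f))
    (h_lower : NMeasurable Ω (lowerEnvelope f)) (h_upper : NMeasurable Ω (upperEnvelope f)) :
    ∃ C r B : ℝ, Admissible Ω f C r B := by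
  have hgrad := fun x t => clarkeGradientReal_primitive (hf_int x) (hF_lip x) t
  rcases hΩ with ⟨hΩ, α, c₁, c₂, hα, hc₁, hc₂, hg⟩ | ⟨hΩ, α, c₁, c₂, hα, hc₁, hc₂, hg⟩
  · refine ⟨c₁ ^ 2 / α + 2 * c₂ ^ 2, (√(2 * α))⁻¹, 1, hf_int, hF_meas, hF_lip, h_lower, h_upper,
      Or.inl hΩ.volume_lt_top, by positivity, by positivity, zero_le_one,
      Or.inl hΩ.volume_lt_top, fun x t ξ hξ => ?_⟩
    rw [← hgrad] at hξ
    -- Here `G = exp(αt²)`, and `G² = (exp(2αt²) - 1) + 1` accounts for `B = 1`.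
    refine sq_le_of_growth hα zero_le_one hc₁ hc₂ (le_of_eq ?_) (hg x t ξ hξ)
    rw [← Real.exp_nat_mul, sub_add_cancel]
    congr 1
    push_cast
    ring
  · refine ⟨c₁ ^ 2 / α + 2 * c₂ ^ 2, (√(2 * α))⁻¹, 0, hf_int, hF_meas, hF_lip, h_lower, h_upper,
      Or.inr hΩ, by positivity, by positivity, le_rfl, Or.inr rfl, fun x t ξ hξ => ?_⟩
    rw [← hgrad] at hξ
    have h1 : 1 ≤ Real.exp (α * t ^ 2) := Real.one_le_exp (by positivity)
    -- Here `G = exp(αt²) - 1`; since `(e - 1)² ≤ e² - 1` for `e ≥ 1`, no constant is left over, as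
    -- infinite measure demands.
    refine sq_le_of_growth hα le_rfl hc₁ hc₂ ?_ (hg x t ξ hξ)
    have h2 : Real.exp (2 * α * t ^ 2) = Real.exp (α * t ^ 2) ^ 2 := by
      rw [← Real.exp_nat_mul]
      congr 1
      push_cast
      ring
    rw [h2]
    nlinarith

end Growth

end OrliczClarke

end

/-! ### Assembly of the theorem -/

open OrliczClarke in
theorem theorem4p3 (Ω : Set Plane) (f : Plane → ℝ → ℝ)
    (hf_int : ∀ x, LocallyIntegrable (f x) volume)
    (hF_meas : ∀ t, AEMeasurable (fun x => primitive f x t) volume)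
    (hF_lip : ∀ x, LocallyLipschitz (primitive f x))
    (hΩ : (IsSmoothBoundedDomain Ω ∧ GrowthBounded f) ∨ (Ω = Set.univ ∧ GrowthPlane f))
    (h_lower : NMeasurable Ω (lowerEnvelope f))
    (h_upper : NMeasurable Ω (upperEnvelope f)) :
    (∀ u : EPhi Ω, IntegrableOn (fun x => primitive f x (u.1.rep x)) Ω volume) ∧
    LocallyLipschitz (Psi Ω f) ∧
    (∀ (x : Plane) (t : ℝ), clarkeGradientReal (primitive f x) t =
      Set.Icc (lowerEnvelope f x t) (upperEnvelope f x t)) ∧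
    (∀ u : EPhi Ω, ∀ ξ ∈ clarkeGradient (Psi Ω f) u,
      ∃ η : Plane → ℝ, MemOrlicz (conjugate Phi.toFun) Ω η ∧
        (∀ v : EPhi Ω, IntegrableOn (fun x => η x * v.1.rep x) Ω volume ∧
          ξ v = ∫ x in Ω, η x * v.1.rep x) ∧
        ∀ᵐ x ∂(volume.restrict Ω), η x ∈ clarkeGradientReal (primitive f x) (u.1.rep x) ∧
          η x ∈ Set.Icc (lowerEnvelope f x (u.1.rep x)) (upperEnvelope f x (u.1.rep x))) ∧
    (∀ X : Submodule ℝ (SobolevPair Ω), X = sobolevH1 Ω ∨ X = sobolevH10 Ω →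
      ∃ ι : X →L[ℝ] EPhi Ω, (∀ w : X, (ι w).1.rep =ᵐ[volume.restrict Ω] w.1.fst) ∧
        ∀ w : X, ∀ ζ ∈ clarkeGradient (PsiOn X f) w,
          ∃ ξ ∈ clarkeGradient (Psi Ω f) (ι w), ζ = ξ.comp ι) := by
  obtain ⟨C, r, B, h⟩ := exists_admissible hf_int hF_meas hF_lip hΩ h_lower h_upper
  have hgrad := fun x t => clarkeGradientReal_primitive (hf_int x) (hF_lip x) t
  refine ⟨h.integrable_primitive, h.locallyLipschitz_Psi, hgrad, fun u ξ hξ => ?_, fun X hX => ?_⟩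
  · obtain ⟨η, hη, hξη⟩ := h.exists_density hξ
    refine ⟨η, memOrlicz_conjugate_Phi_of_memLp hη,
      fun v => ⟨hη.integrable_mul v.1.rep_memLp, hξη v⟩, ?_⟩
    filter_upwards [h.density_mem_Icc hξ hη hξη] with x hx
    exact ⟨by rwa [hgrad], hx⟩
  · have hΩ' : MeasurableSet Ω ∧ HasPotentialBound Ω Ω := by
      rcases hΩ with ⟨hΩ, _⟩ | ⟨rfl, _⟩
      · exact ⟨hΩ.1.measurableSet, hΩ.hasPotentialBound⟩
      · exact ⟨MeasurableSet.univ, hasPotentialBound_univ⟩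
    have hX' : X ≤ sobolevH1 Ω := by
      rcases hX with rfl | rfl
      · exact le_rfl
      · exact sobolevH10_le_sobolevH1
    have hemb := exists_embedding (X := X) hΩ'.1 h.domain hΩ'.2 hX'
    obtain ⟨ι, hι⟩ := hemb
    refine ⟨ι, hι, fun w ζ hζ => exists_mem_clarkeGradient_comp h.locallyLipschitz_Psi ι w ?_⟩
    -- The two functionals use different representatives, but these agree a.e. on `Ω`, so the chain
    -- rule applies to `Psi Ω f` composed with `ι`.
    have heq : PsiOn X f = fun w => Psi Ω f (ι w) := funext fun w => by
      refine integral_congr_ae ?_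
      filter_upwards [hι w] with x hx
      rw [hx]
    rwa [heq] at hζ
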